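/- **Conventions.** An abstract Wiener space $(X,H,\mu)$ consists of a real separable Banach space $X$, a centered Gaussian Borel measure $\mu$ on $X$, and the Cameron–Martin space $H\hookrightarrow X$ of $\mu$, i.e. the Hilbert space of all $x\in X$ for which $$\|x\|_H:=\sup\Big\{|\ell(x)| : \ell\in X^*,\ \int_X \ell^2\,d\mu\le 1\Big\}<\infty .$$ A strongly continuous semigroup on $X$ is a family $(T_t)_{t\ge0}$ of bounded operators on $X$ with $T_{t+u}=T_tT_u$ and $\|T_tx-x\|_X\to0$ as $t\downarrow 0$ for all $x\in X$; a strongly continuous multiplicative semigroup is a family $(Q_\epsilon)_{\epsilon\in(0,1]}$ of bounded operators on $X$ with $Q_\epsilon Q_\delta=Q_{\epsilon\delta}$ and $\|Q_\epsilon x-x\|_X\to0$ as $\epsilon\uparrow1$ for all $x\in X$. A point $x\in X$ is a cluster point at infinity of $\gamma:[0,\infty)\to X$ if $\gamma(t_n)\to x$ in $X$ for some sequence $t_n\uparrow\infty$; it is a cluster point at zero of $\gamma:(0,1]\to X$ if $\gamma(\epsilon_n)\to x$ in $X$ for some sequence $\epsilon_n\downarrow0$. **Proposition 1.2.** (a)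 Let $(X,H,\mu)$ be an abstract Wiener space and let $(S_t)_{t\ge0}$ be a family of bounded operators $H\to H$ such that 1. $S_{t+u}=S_tS_u$ for all $t,u\ge0$; 2. $S_tS_t^*=I$ for all $t\ge 0$, where $S_t^*$ is the adjoint in $H$; 3. $\langle S_tx,y\rangle_H\to0$ as $t\to\infty$ for all $x,y\in H$; 4. $(S_t)_{t\ge0}$ extends to a strongly continuous semigroup on $X$, still denoted $(S_t)_{t\ge 0}$. Then for $\mu$-almost every $x\in X$ the set of cluster points at infinity of $\big(\frac{S_tx}{\sqrt{2\log t}}\big)_{t\ge0}$ in $X$ is equal to the closed unit ball of $H$. (b) (Multiplicative form.) Let $(X,H,\mu)$ be an abstract Wiener space and let $(R_\epsilon)_{\epsilon\in(0,1]}$ be a family of bounded operators $H\to H$ such that 1. $R_\epsilon R_\delta=R_{\epsilon\delta}$ for all $\epsilon,\delta\in(0,1]$; 2. $R_\epsilon R_\epsilon^*=I$ for all $\epsilon\in(0,1]$; 3. $\langle R_\epsilon x,y\rangle_H\to0$ as $\epsilon\to0$ for all $x,y\in H$; 4. $(R_\epsilon)_{\epsilon\in(0,1]}$ extends to a strongly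 continuous multiplicative semigroup on $X$, still denoted $(R_\epsilon)_{\epsilon\in(0,1]}$. Then for $\mu$-almost every $x\in X$ the set of cluster points at zero of $\big(\frac{R_\epsilon x}{\sqrt{2\log\log(1/\epsilon)}}\big)_{\epsilon\in(0,1]}$ in $X$ is equal to the closed unit ball of $H$. (c) (Strassen's classical law.) Let $B$ be a standard real Brownian motion. Then almost surely the set of cluster points at zero, in $C[0,1]$ with the uniform norm, of the family of functions $u\mapsto \frac{\epsilon^{-1/2}B(\epsilon u)}{\sqrt{2\log\log(1/\epsilon)}}$, $\epsilon\in(0,1]$, is equal to $$\Big\{f\in C[0,1] : f(u)=\int_0^u g(s)\,ds \text{ for all } u\in[0,1], \text{ for some } g \text{ with } \int_0^1 g(s)^2\,ds\le1\Big\}.$$ (The quotients are considered for large $t$, respectively small $\epsilon$, where the logarithms are positive.) -/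

import Mathlib

open Filter Topology MeasureTheory ProbabilityTheory
open scoped NNReal ENNReal RealInnerProductSpace

noncomputable section

/-- The Cameron-Martin norm of `x` with respect to a centered Gaussian measure `μ`, namely
`sup {|ℓ x| : ℓ ∈ X*, ∫ ℓ² dμ ≤ 1}`, with the value `∞` if the supremum is infinite. -/
def cameronMartinNorm {X : Type*} [NormedAddCommGroup X] [NormedSpace ℝ X] [MeasurableSpace X]
    (μ : Measure X) (x : X) : ℝ≥0∞ :=
  ⨆ (ℓ : StrongDual ℝ X) (_ : ∫ y, (ℓ y) ^ 2 ∂μ ≤ 1), ‖ℓ x‖ₑ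

/-- `(X, H, μ)` is an abstract Wiener space, where the Hilbert space `H` is regarded as a subspace
of the Banach space `X` by means of the embedding `i`: the measure `μ` is a centered Gaussian
measure on `X`, and `H` is its Cameron-Martin space, that is, the image of `H` consists of the
vectors of finite Cameron-Martin norm, and the norm of `H` is the Cameron-Martin norm. (Hence `i`
is injective, and the inner product of `H` is determined by polarization.) -/
structure IsAbstractWienerSpace {X H : Type*} [NormedAddCommGroup X] [NormedSpace ℝ X]
    [MeasurableSpace X] [NormedAddCommGroup H] [InnerProductSpace ℝ H]
    (i : H →L[ℝ] X) (μ : Measure X) : Prop where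
  isGaussian : IsGaussian μ
  centered : ∀ ℓ : StrongDual ℝ X, ∫ x, ℓ x ∂μ = 0
  range_eq : Set.range i = {x | cameronMartinNorm μ x < ∞}
  norm_eq : ∀ h : H, cameronMartinNorm μ (i h) = ‖h‖ₑ

/-- A strongly continuous semigroup `(T_t)_{t ≥ 0}` of bounded operators on `X`.
The identity `T 0 = 1` is a consequence: `T 0 (T t x) = T t x`, and one lets `t` tend to `0`. -/
structure IsStronglyContinuousSemigroup {X : Type*} [NormedAddCommGroup X] [NormedSpace ℝ X]
    (T : ℝ≥0 → X →L[ℝ] X) : Prop where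
  map_add : ∀ t u : ℝ≥0, T (t + u) = T t ∘L T u
  tendsto_zero : ∀ x : X, Tendsto (fun t => T t x) (𝓝[>] 0) (𝓝 x)

/-- A strongly continuous multiplicative semigroup `(Q_ε)_{ε ∈ (0,1]}` of bounded operators
on `X`. -/
structure IsStronglyContinuousMulSemigroup {X : Type*} [NormedAddCommGroup X] [NormedSpace ℝ X]
    (Q : Set.Ioc (0 : ℝ) 1 → X →L[ℝ] X) : Prop where
  map_mul : ∀ ε δ : Set.Ioc (0 : ℝ) 1, Q (ε * δ) = Q ε ∘L Q δ
  tendsto_one : ∀ x : X, Tendsto (fun ε => Q ε x) (𝓝[<] 1) (𝓝 x)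

/-- The set of cluster points at infinity of `γ : [0,∞) → X`. -/
def clusterPointsAtInfinity {X : Type*} [TopologicalSpace X] (γ : ℝ≥0 → X) : Set X :=
  {x | ∃ t : ℕ → ℝ≥0, Monotone t ∧ Tendsto t atTop atTop ∧
    Tendsto (fun n => γ (t n)) atTop (𝓝 x)}

/-- The set of cluster points at zero of `γ : (0,1] → X`. -/
def clusterPointsAtZero {X : Type*} [TopologicalSpace X] (γ : Set.Ioc (0 : ℝ) 1 → X) : Set X :=
  {x | ∃ ε : ℕ → Set.Ioc (0 : ℝ) 1, Antitone ε ∧ Tendsto (fun n => (ε n : ℝ)) atTop (𝓝 0) ∧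
    Tendsto (fun n => γ (ε n)) atTop (𝓝 x)}

/-- The Brownian rescaling `f ↦ (u ↦ ε^{-1/2} f (ε u))` on `C[0,1]`. -/
def brownianRescaling (ε : Set.Ioc (0 : ℝ) 1) (f : C(unitInterval, ℝ)) : C(unitInterval, ℝ) where
  toFun u := (√(ε : ℝ))⁻¹ * f (⟨(ε : ℝ), ε.2.1.le, ε.2.2⟩ * u)
  continuous_toFun := by fun_prop

/-- The closed unit ball of the Cameron-Martin space of Brownian motion on `[0,1]`: the primitives
`f`, vanishing at `0`, of functions `g` with `∫₀¹ g² ≤ 1`. -/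
def strassenBall : Set C(unitInterval, ℝ) :=
  {f | ∃ g : ℝ → ℝ, MemLp g 2 (volume.restrict (Set.Icc 0 1)) ∧ ∫ s in (0 : ℝ)..1, (g s) ^ 2 ≤ 1 ∧
    ∀ u : unitInterval, f u = ∫ s in (0 : ℝ)..(u : ℝ), g s}

end

/-! ### Gaussian integration by parts -/

/-! For ℓ in X* let e in H be its image under the adjoint of the embedding (`dualEmbedding`); then
‖e‖² = ∫ ℓ² dμ. Because S_t is a coisometry, T_t preserves every variance ∫ ℓ² dμ and hence the
measure μ (`map_eq_self`). So t ↦ T_t x is a stationary Gaussian process, and the weak convergence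
S_t → 0 says that ℓ(T_t x) decorrelates.

Cluster points lie in the ball. The ball is cut out by countably many conditions |ℓ| ≤ 1. The
Gaussian tail and Borel-Cantelli give |ℓ(T_t x)| ≤ (1+o(1)) √(2 log t) along grids of arbitrarily
fine mesh, and strong continuity moves a cluster point from arbitrary times to grid times
(`ae_clusterPointsAtInfinity_subset`).

The ball consists of cluster points. Let ∫ ℓ² dμ = 1. Among n unit Gaussians with small pairwise
covariances the maximum is at least (1-ε) √(2 log n) with probability at least 1-ε
(`exists_forall_measureReal_forall_lt_le`). This follows by comparing a smooth maximum with that of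
independent variables through Gaussian interpolation. Hence ℓ(T_n x) ≥ (1-ε) √(2 log n) infinitely
often (`ae_frequently_le_dual`). Fernique's inequality on quotients by finite-dimensional subspaces
makes the normalised sequence relatively compact (`ae_exists_subseq_tendsto`). A limit z along such
times lies in the unit ball and has ℓ(z) ≥ 1 with ‖e‖ = 1, so z = i(e) by the equality case of
Cauchy-Schwarz. Such points are dense in the ball for the norm of X, since mixing supplies weakly
null unit vectors and i is compact; cluster sets are closed.

The multiplicative form is the substitution ε = exp(-t). For Brownian motion, H is L²[0,1], embedded
by g ↦ ∫₀ᵘ g = ⟪1_{(0,u]}, g⟫, and the invariance of Wiener measure under rescaling provides the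
coisometries. -/

lemma hasDerivAt_gaussianPDFReal {v : ℝ≥0} (hv : v ≠ 0) (x : ℝ) :
    HasDerivAt (gaussianPDFReal 0 v) (-(x / v) * gaussianPDFReal 0 v x) x := by
  have hv' : (v : ℝ) ≠ 0 := by exact_mod_cast hv
  rw [gaussianPDFReal_def]
  have h : HasDerivAt (fun x : ℝ => -(x - 0) ^ 2 / (2 * (v : ℝ))) (-(x / v)) x := by
    have h1 := (((hasDerivAt_id x).sub_const 0).pow 2).neg.div_const (2 * (v : ℝ))
    refine h1.congr_deriv ?_
    simp
    field_simp
  refine ((h.exp).const_mul ((√(2 * Real.pi * v))⁻¹)).congr_deriv ?_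
  ring

/-- Stein's identity for a real Gaussian variable. -/
lemma integral_id_mul_gaussianReal {v : ℝ≥0} {f f' : ℝ → ℝ} {A B : ℝ}
    (hf : ∀ x, HasDerivAt f (f' x) x) (hf' : Continuous f') (hA : ∀ x, |f x| ≤ A)
    (hB : ∀ x, |f' x| ≤ B) :
    ∫ x, x * f x ∂(gaussianReal 0 v) = v * ∫ x, f' x ∂(gaussianReal 0 v) := by
  by_cases hv : v = 0
  · simp [hv]
  have hv' : (v : ℝ) ≠ 0 := by exact_mod_cast hv
  have hcf : Continuous f := continuous_iff_continuousAt.2 fun x => (hf x).continuousAt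
  have hid : Integrable (fun x : ℝ => gaussianPDFReal 0 v x * x) := by
    have h : Integrable (fun x : ℝ => x) (gaussianReal 0 v) :=
      IsGaussian.integrable_id
    rw [gaussianReal_of_var_ne_zero _ hv] at h
    have := (integrable_withDensity_iff_integrable_smul' (measurable_gaussianPDF 0 v)
      (ae_of_all _ fun x => gaussianPDF_lt_top)).1 h
    simpa using this
  rw [integral_gaussianReal_eq_integral_smul hv, integral_gaussianReal_eq_integral_smul hv]
  have key := integral_mul_deriv_eq_deriv_mul_of_integrable (u := f) (u' := f')
    (v := gaussianPDFReal 0 v) (v' := fun x => -(x / v) * gaussianPDFReal 0 v x)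
    (fun x _ => hf x) (fun x _ => hasDerivAt_gaussianPDFReal hv x) ?_ ?_ ?_
  · simp only [smul_eq_mul]
    have h1 : ∫ x, gaussianPDFReal 0 v x * (x * f x)
        = -(v * ∫ x, f x * (-(x / v) * gaussianPDFReal 0 v x)) := by
      rw [← integral_const_mul, ← integral_neg]
      congr 1; ext x; field_simp
    rw [h1, key]
    simp only [mul_neg, neg_neg]
    congr 2; ext x; ring
  · have : f * (fun x => -(x / v) * gaussianPDFReal 0 v x)
        = fun x => f x * (-(v : ℝ)⁻¹ * (gaussianPDFReal 0 v x * x)) := by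
      ext x; simp; left; ring
    rw [this]
    exact (hid.const_mul _).bdd_mul hcf.aestronglyMeasurable (ae_of_all _ hA)
  · exact (integrable_gaussianPDFReal 0 v).bdd_mul hf'.aestronglyMeasurable (ae_of_all _ hB)
  · exact (integrable_gaussianPDFReal 0 v).bdd_mul hcf.aestronglyMeasurable (ae_of_all _ hA)

section

variable {E : Type*} [NormedAddCommGroup E] [NormedSpace ℝ E] [MeasurableSpace E] [BorelSpace E]

lemma map_dual_eq_gaussianReal {μ : Measure E} [IsGaussian μ]
    (hμ : ∀ ℓ : StrongDual ℝ E, ∫ x, ℓ x ∂μ = 0) (ℓ : StrongDual ℝ E) :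
    μ.map ℓ = gaussianReal 0 (∫ x, ℓ x ^ 2 ∂μ).toNNReal := by
  rw [IsGaussian.map_eq_gaussianReal ℓ, hμ ℓ,
    variance_of_integral_eq_zero (by fun_prop) (hμ ℓ)]

lemma integrable_dual_mul_dual (μ : Measure E) [IsGaussian μ] (ℓ ℓ' : StrongDual ℝ E) :
    Integrable (fun x => ℓ x * ℓ' x) μ :=
  (IsGaussian.memLp_dual μ ℓ 2 (by simp)).integrable_mul (IsGaussian.memLp_dual μ ℓ' 2 (by simp))

lemma integrable_dual_sq (μ : Measure E) [IsGaussian μ] (ℓ : StrongDual ℝ E) :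
    Integrable (fun x => ℓ x ^ 2) μ := by
  simpa [sq] using integrable_dual_mul_dual μ ℓ ℓ

/-- Gaussian integration by parts. -/
lemma integral_dual_mul_comp {ι : Type*} [Fintype ι] {μ : Measure E} [IsGaussian μ]
    (hμ : ∀ ℓ : StrongDual ℝ E, ∫ x, ℓ x ∂μ = 0) (U : StrongDual ℝ E) (V : ι → StrongDual ℝ E)
    {g : (ι → ℝ) → ℝ} {g' : (ι → ℝ) → (ι → ℝ) →L[ℝ] ℝ} {A B : ℝ}
    (hg : ∀ w, HasFDerivAt g (g' w) w) (hg' : Continuous g') (hA : ∀ w, |g w| ≤ A)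
    (hB : ∀ w, ‖g' w‖ ≤ B) :
    ∫ x, U x * g (fun l => V l x) ∂μ
      = ∫ x, g' (fun l => V l x) (fun l => ∫ y, U y * V l y ∂μ) ∂μ := by
  set v : ℝ := ∫ x, U x ^ 2 ∂μ with hv
  have hv0 : 0 ≤ v := integral_nonneg fun x => sq_nonneg _
  have hgc : Continuous g := continuous_iff_continuousAt.2 fun x => (hg x).continuousAt
  -- If Var U = 0 then U = 0 almost surely and both sides vanish; otherwise one may divide by v.
  by_cases hvz : v = 0
  · have hU : ∀ᵐ x ∂μ, U x = 0 := by
      have := (integral_eq_zero_iff_of_nonneg (fun x => sq_nonneg (U x))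
        (integrable_dual_sq μ U)).1 hvz
      filter_upwards [this] with x hx
      simpa using hx
    have h1 : ∫ x, U x * g (fun l => V l x) ∂μ = 0 := by
      refine integral_eq_zero_of_ae ?_
      filter_upwards [hU] with x hx
      simp [hx]
    have h2 : (fun l => ∫ y, U y * V l y ∂μ) = 0 := by
      ext l
      refine integral_eq_zero_of_ae ?_
      filter_upwards [hU] with x hx
      simp [hx]
    rw [h1, h2]; simp
  set b : ι → ℝ := fun l => ∫ y, U y * V l y ∂μ with hb
  set c : ι → ℝ := fun l => b l / v with hc
  -- Regression of V on U: the residual W is uncorrelated with U, hence independent of it. Stein's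
  -- identity then applies in the variable U with W frozen.
  let W : ι → StrongDual ℝ E := fun l => V l - c l • U
  have hind : IndepFun (fun x => U x) (fun x l => W l x) μ := by
    have hG : HasGaussianLaw (fun x => ((fun _ : Unit => U x), fun l => W l x)) μ :=
      ⟨isGaussian_map ((ContinuousLinearMap.pi fun _ : Unit => U).prod (ContinuousLinearMap.pi W))⟩
    have := HasGaussianLaw.indepFun_of_covariance_eval (X := fun (_ : Unit) x => U x)
      (Y := fun l x => W l x) hG ?_
    · exact this.comp (φ := fun f : Unit → ℝ => f ()) (ψ := id) (measurable_pi_apply ())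
        measurable_id
    · intro _ l
      rw [covariance_eq_sub (IsGaussian.memLp_dual μ U 2 (by simp))
        (IsGaussian.memLp_dual μ (W l) 2 (by simp)), hμ U, zero_mul, sub_zero]
      have : ∀ x, ((fun x => U x) * fun x => W l x) x = U x * V l x - c l * U x ^ 2 := by
        intro x; simp [W]; ring
      simp_rw [this]
      rw [integral_sub (integrable_dual_mul_dual μ U (V l)) ((integrable_dual_sq μ U).const_mul _),
        integral_const_mul, ← hv]
      simp only [hc, hb]
      field_simp
      simp
  have hmap := (indepFun_iff_map_prod_eq_prod_map_map (by fun_prop) (by fun_prop)).1 hind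
  have hmU := map_dual_eq_gaussianReal hμ U
  have hVW : ∀ x, (fun l => V l x) = (fun l => W l x) + U x • c := by
    intro x; ext l; simp [W]; ring
  have hWm : AEMeasurable (fun x l => W l x) μ := by fun_prop
  have := Measure.isProbabilityMeasure_map hWm
  have hUW : AEMeasurable (fun x => (U x, fun l => W l x)) μ := by fun_prop
  have hUi : Integrable (fun u : ℝ => u) (gaussianReal 0 v.toNNReal) := IsGaussian.integrable_id
  have hs : ∀ (w : ι → ℝ), Continuous fun s : ℝ => w + s • c := fun w => by fun_prop
  calc ∫ x, U x * g (fun l => V l x) ∂μ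
      = ∫ z : ℝ × (ι → ℝ), z.1 * g (z.2 + z.1 • c) ∂(μ.map fun x => (U x, fun l => W l x)) := by
        rw [integral_map hUW]
        · simp_rw [hVW]
        · exact Continuous.aestronglyMeasurable (by fun_prop)
    _ = ∫ w, ∫ u, u * g (w + u • c) ∂(gaussianReal 0 v.toNNReal) ∂(μ.map fun x l => W l x) := by
        rw [hmap, hmU, ← hv, integral_prod_symm]
        refine Integrable.mul_bdd (c := A) ?_ ?_ ?_
        · exact hUi.comp_fst _
        · exact Continuous.aestronglyMeasurable (by fun_prop)
        · exact ae_of_all _ fun z => hA _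
    _ = ∫ w, ∫ u, g' (w + u • c) b ∂(gaussianReal 0 v.toNNReal) ∂(μ.map fun x l => W l x) := by
        congr 1; ext w
        rw [integral_id_mul_gaussianReal (f := fun u => g (w + u • c))
          (f' := fun u => g' (w + u • c) c) (A := A) (B := B * ‖c‖)]
        · rw [← integral_const_mul]
          congr 1; ext u
          have : b = v • c := by ext l; simp [hc]; field_simp
          rw [this, map_smul, Real.coe_toNNReal _ hv0, smul_eq_mul]
        · intro u
          have h1 : HasDerivAt (fun s : ℝ => w + s • c) ((1 : ℝ) • c) u :=
            ((hasDerivAt_id u).smul_const c).const_add w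
          have h2 := (hg (w + u • c)).comp_hasDerivAt u h1
          rw [one_smul] at h2
          exact h2
        · exact (hg'.comp (hs w)).clm_apply continuous_const
        · exact fun u => hA _
        · exact fun u => ((g' _).le_opNorm c).trans (by gcongr; exact hB _)
    _ = ∫ z : ℝ × (ι → ℝ), g' (z.2 + z.1 • c) b ∂(μ.map fun x => (U x, fun l => W l x)) := by
        rw [hmap, hmU, ← hv, integral_prod_symm]
        refine Integrable.of_bound (C := B * ‖b‖) ?_ (ae_of_all _ fun z => ?_)
        · exact Continuous.aestronglyMeasurable
            ((hg'.comp (by fun_prop)).clm_apply continuous_const)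
        · exact ((g' _).le_opNorm b).trans (by gcongr; exact hB _)
    _ = ∫ x, g' (fun l => V l x) b ∂μ := by
        rw [integral_map hUW]
        · simp_rw [hVW]
        · exact Continuous.aestronglyMeasurable
            ((hg'.comp (by fun_prop)).clm_apply continuous_const)

end

/-! ### Smooth maxima of Gaussian vectors -/

section

variable {ι : Type*} [Fintype ι]

/-- The smooth maximum `β⁻¹ log ∑ exp (β wₖ)`. -/
noncomputable def smoothMax (β : ℝ) (w : ι → ℝ) : ℝ := β⁻¹ * Real.log (∑ k, Real.exp (β * w k))

/-- The weights `exp (β wₖ) / ∑ exp (β wₗ)`, the partial derivatives of the smooth maximum. -/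
noncomputable def softmax (β : ℝ) (w : ι → ℝ) (k : ι) : ℝ :=
  Real.exp (β * w k) / ∑ l, Real.exp (β * w l)

lemma hasFDerivAt_sum_exp (β : ℝ) (w : ι → ℝ) :
    HasFDerivAt (fun w : ι → ℝ => ∑ l, Real.exp (β * w l))
      (∑ l, (β * Real.exp (β * w l)) • ContinuousLinearMap.proj (R := ℝ) (φ := fun _ : ι => ℝ) l)
      w := by
  refine HasFDerivAt.fun_sum fun l _ => ?_
  have h := ((hasFDerivAt_apply (𝕜 := ℝ) l w).const_mul β).exp
  refine h.congr_fderiv ?_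
  rw [smul_smul, mul_comm]

variable [Nonempty ι]

lemma sum_exp_pos (β : ℝ) (w : ι → ℝ) : 0 < ∑ l, Real.exp (β * w l) :=
  Finset.sum_pos (fun _ _ => Real.exp_pos _) Finset.univ_nonempty

lemma softmax_nonneg (β : ℝ) (w : ι → ℝ) (k : ι) : 0 ≤ softmax β w k :=
  div_nonneg (Real.exp_pos _).le (sum_exp_pos β w).le

lemma sum_softmax (β : ℝ) (w : ι → ℝ) : ∑ k, softmax β w k = 1 := by
  simp_rw [softmax, ← Finset.sum_div]
  exact div_self (sum_exp_pos β w).ne'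

lemma softmax_le_one (β : ℝ) (w : ι → ℝ) (k : ι) : softmax β w k ≤ 1 := by
  rw [← sum_softmax β w]
  exact Finset.single_le_sum (fun l _ => softmax_nonneg β w l) (Finset.mem_univ k)

lemma continuous_softmax (β : ℝ) (k : ι) : Continuous fun w : ι → ℝ => softmax β w k := by
  unfold softmax
  exact Continuous.div (by fun_prop) (by fun_prop) fun w => (sum_exp_pos β w).ne'

lemma hasFDerivAt_smoothMax {β : ℝ} (hβ : β ≠ 0) (w : ι → ℝ) :
    HasFDerivAt (smoothMax (ι := ι) β)
      (∑ l, softmax β w l • ContinuousLinearMap.proj (R := ℝ) (φ := fun _ : ι => ℝ) l) w := by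
  have h := ((hasFDerivAt_sum_exp β w).log (sum_exp_pos β w).ne').const_mul β⁻¹
  refine h.congr_fderiv ?_
  rw [Finset.smul_sum, Finset.smul_sum]
  refine Finset.sum_congr rfl fun l _ => ?_
  rw [smul_smul, smul_smul, softmax]
  congr 1
  field_simp

lemma hasFDerivAt_softmax (β : ℝ) (k : ι) (w : ι → ℝ) :
    HasFDerivAt (fun w : ι → ℝ => softmax β w k)
      ((β * softmax β w k) • (ContinuousLinearMap.proj (R := ℝ) (φ := fun _ : ι => ℝ) k
        - ∑ l, softmax β w l • ContinuousLinearMap.proj (R := ℝ) (φ := fun _ : ι => ℝ) l)) w := by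
  have h1 := ((hasFDerivAt_apply (𝕜 := ℝ) k w).const_mul β).exp
  have h2 := (hasDerivAt_inv (sum_exp_pos β w).ne').comp_hasFDerivAt w (hasFDerivAt_sum_exp β w)
  have h := h1.mul h2
  refine h.congr_fderiv ?_
  ext c
  have hS := (sum_exp_pos β w).ne'
  simp only [softmax, add_apply, smul_apply, sub_apply, sum_apply, ContinuousLinearMap.proj_apply,
    smul_eq_mul, Function.comp]
  have : ∑ x, Real.exp (β * w x) / (∑ l, Real.exp (β * w l)) * c x
      = (∑ x, Real.exp (β * w x) * c x) / ∑ l, Real.exp (β * w l) := by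
    rw [Finset.sum_div]; exact Finset.sum_congr rfl fun _ _ => by ring
  rw [this]
  have : ∑ x, β * Real.exp (β * w x) * c x = β * ∑ x, Real.exp (β * w x) * c x := by
    rw [Finset.mul_sum]; exact Finset.sum_congr rfl fun _ _ => by ring
  rw [this]
  field_simp
  ring

lemma le_smoothMax {β : ℝ} (hβ : 0 < β) (w : ι → ℝ) (k : ι) : w k ≤ smoothMax β w := by
  unfold smoothMax
  rw [← div_eq_inv_mul, le_div_iff₀ hβ, Real.le_log_iff_exp_le (sum_exp_pos β w), mul_comm]
  exact Finset.single_le_sum (f := fun k => Real.exp (β * w k)) (fun l _ => (Real.exp_pos _).le)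
    (Finset.mem_univ k)

lemma smoothMax_le {β : ℝ} (hβ : 0 < β) {w : ι → ℝ} {a : ℝ} (h : ∀ k, w k ≤ a) :
    smoothMax β w ≤ a + Real.log (Fintype.card ι) / β := by
  have hc : (0 : ℝ) < Fintype.card ι := by exact_mod_cast Fintype.card_pos
  have h1 : ∑ k, Real.exp (β * w k) ≤ Fintype.card ι * Real.exp (β * a) := by
    refine (Finset.sum_le_card_nsmul _ _ (Real.exp (β * a)) fun k _ => ?_).trans ?_
    · gcongr; exact h k
    · simp
  have h2 := Real.log_le_log (sum_exp_pos β w) h1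
  rw [Real.log_mul hc.ne' (Real.exp_pos _).ne', Real.log_exp] at h2
  unfold smoothMax
  rw [← div_eq_inv_mul, div_le_iff₀ hβ, add_mul, div_mul_cancel₀ _ hβ.ne']
  linarith

lemma continuous_smoothMax (β : ℝ) : Continuous (smoothMax (ι := ι) β) := by
  unfold smoothMax
  exact continuous_const.mul (Continuous.log (by fun_prop) fun w => (sum_exp_pos β w).ne')

lemma abs_smoothMax_le {β : ℝ} (hβ : 0 < β) (w : ι → ℝ) :
    |smoothMax β w| ≤ (∑ k, |w k|) + Real.log (Fintype.card ι) / β := by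
  have h0 : ∀ k, |w k| ≤ ∑ k, |w k| := fun k =>
    Finset.single_le_sum (f := fun k => |w k|) (fun _ _ => abs_nonneg _) (Finset.mem_univ k)
  have hl : 0 ≤ Real.log (Fintype.card ι) / β :=
    div_nonneg (Real.log_nonneg (by exact_mod_cast Fintype.card_pos)) hβ.le
  refine abs_le.2 ⟨?_, smoothMax_le hβ fun k => (le_abs_self _).trans (h0 k)⟩
  obtain ⟨k⟩ := ‹Nonempty ι›
  have := le_smoothMax hβ w k
  have := neg_abs_le (w k)
  have := h0 k
  linarith

lemma continuous_softmax_dual {E : Type*} [NormedAddCommGroup E] [NormedSpace ℝ E] (β : ℝ)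
    (V : ι → StrongDual ℝ E) (k : ι) : Continuous fun x => softmax β (fun l => V l x) k :=
  (continuous_softmax β k).comp (f := fun x l => V l x) (by fun_prop)

variable {E : Type*} [NormedAddCommGroup E] [NormedSpace ℝ E] [MeasurableSpace E] [BorelSpace E]

lemma integrable_smoothMax {β : ℝ} (hβ : 0 < β) (μ : Measure E) [IsGaussian μ]
    (V : ι → StrongDual ℝ E) : Integrable (fun x => smoothMax β fun k => V k x) μ := by
  refine Integrable.mono' (g := fun x => (∑ k, |V k x|) + Real.log (Fintype.card ι) / β) ?_ ?_ ?_
  · exact (integrable_finsetSum _ fun k _ => (IsGaussian.integrable_dual μ (V k)).abs).add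
      (integrable_const _)
  · exact ((continuous_smoothMax β).comp (by fun_prop)).aestronglyMeasurable
  · exact ae_of_all _ fun x => abs_smoothMax_le hβ _

/-- Integration by parts in each summand. With V a moving Gaussian vector and U its velocity, the
left side is the derivative of the mean smooth maximum, so that derivative becomes an expression in
the covariances of U and V. -/
lemma integral_sum_dual_mul_softmax {μ : Measure E} [IsGaussian μ]
    (hμ : ∀ ℓ : StrongDual ℝ E, ∫ x, ℓ x ∂μ = 0) (β : ℝ) (U V : ι → StrongDual ℝ E) :
    ∫ x, ∑ k, U k x * softmax β (fun l => V l x) k ∂μ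
      = ∫ x, ∑ k, β * softmax β (fun l => V l x) k * ((∫ y, U k y * V k y ∂μ)
          - ∑ l, softmax β (fun l => V l x) l * ∫ y, U k y * V l y ∂μ) ∂μ := by
  have hsV : ∀ k, Continuous fun x => softmax β (fun l => V l x) k := fun k =>
    continuous_softmax_dual β V k
  rw [integral_finsetSum, integral_finsetSum]
  · refine Finset.sum_congr rfl fun k _ => ?_
    rw [integral_dual_mul_comp hμ (U k) V (A := 1) (B := |β| * (1 + Fintype.card ι))
      (fun w => hasFDerivAt_softmax β k w)]
    · simp
    · have := continuous_softmax (ι := ι) β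
      fun_prop
    · intro w
      rw [abs_of_nonneg (softmax_nonneg β w k)]
      exact softmax_le_one β w k
    · intro w
      have hp : ∀ l : ι, ‖ContinuousLinearMap.proj (R := ℝ) (φ := fun _ : ι => ℝ) l‖ ≤ 1 :=
        fun l => ContinuousLinearMap.opNorm_le_bound _ zero_le_one fun x => by
          simpa using norm_le_pi_norm x l
      rw [norm_smul, norm_mul, Real.norm_eq_abs]
      have h1 : ‖softmax β w k‖ ≤ 1 := by
        rw [Real.norm_of_nonneg (softmax_nonneg β w k)]; exact softmax_le_one β w k
      have h2 : ‖∑ l, softmax β w l • ContinuousLinearMap.proj (R := ℝ) (φ := fun _ : ι => ℝ) l‖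
          ≤ Fintype.card ι := by
        refine (norm_sum_le _ _).trans ((Finset.sum_le_card_nsmul _ _ 1 fun l _ => ?_).trans ?_)
        · rw [norm_smul, Real.norm_of_nonneg (softmax_nonneg β w l)]
          exact mul_le_one₀ (softmax_le_one β w l) (norm_nonneg _) (hp l)
        · simp
      calc |β| * ‖softmax β w k‖ * ‖_‖ ≤ |β| * 1 * (1 + Fintype.card ι) := by
            gcongr
            exact (norm_sub_le _ _).trans (add_le_add (hp k) h2)
        _ = _ := by ring
  · intro k _
    refine Integrable.of_bound (C := |β| * (|∫ y, U k y * V k y ∂μ|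
      + ∑ l, |∫ y, U k y * V l y ∂μ|)) ?_ (ae_of_all _ fun x => ?_)
    · exact Continuous.aestronglyMeasurable (by fun_prop)
    · have h1 := softmax_nonneg β (fun l => V l x)
      have h2 := softmax_le_one β (fun l => V l x)
      rw [norm_mul, norm_mul, Real.norm_eq_abs, Real.norm_of_nonneg (h1 k)]
      have h3 : ‖(∫ y, U k y * V k y ∂μ)
          - ∑ l, softmax β (fun l => V l x) l * ∫ y, U k y * V l y ∂μ‖
          ≤ |∫ y, U k y * V k y ∂μ| + ∑ l, |∫ y, U k y * V l y ∂μ| := by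
        refine (norm_sub_le _ _).trans (add_le_add le_rfl ((norm_sum_le _ _).trans ?_))
        refine Finset.sum_le_sum fun l _ => ?_
        rw [norm_mul, Real.norm_of_nonneg (h1 l)]
        exact mul_le_of_le_one_left (norm_nonneg _) (h2 l)
      calc _ ≤ |β| * 1 * (|∫ y, U k y * V k y ∂μ| + ∑ l, |∫ y, U k y * V l y ∂μ|) := by
            gcongr; exact h2 k
        _ = _ := by rw [mul_one]
  · intro k _
    refine (IsGaussian.integrable_dual μ (U k)).mul_bdd (c := 1)
      (hsV k).aestronglyMeasurable (ae_of_all _ fun x => ?_)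
    rw [Real.norm_of_nonneg (softmax_nonneg _ _ k)]
    exact softmax_le_one _ _ k

/-- Gaussian interpolation between a family `X` with small covariances and an orthonormal family
`Y` which is independent of it. -/
lemma integral_smoothMax_le_add {μ : Measure E} [IsGaussian μ]
    (hμ : ∀ ℓ : StrongDual ℝ E, ∫ x, ℓ x ∂μ = 0) {β δ : ℝ} (hβ : 0 < β) (hδ : 0 ≤ δ)
    (X Y : ι → StrongDual ℝ E) (hX : ∀ k, ∫ x, X k x * X k x ∂μ = 1)
    (hXδ : ∀ k l, k ≠ l → ∫ x, X k x * X l x ∂μ ≤ δ)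
    (hY : ∀ k, ∫ x, Y k x * Y k x ∂μ = 1) (hY0 : ∀ k l, k ≠ l → ∫ x, Y k x * Y l x ∂μ = 0)
    (hXY : ∀ k l, ∫ x, X k x * Y l x ∂μ = 0) :
    ∫ x, smoothMax β (fun k => Y k x) ∂μ ≤ ∫ x, smoothMax β (fun k => X k x) ∂μ + β * δ / 2 := by
  -- V rotates from Y at θ = 0 to X at θ = π/2, and U is its derivative in θ.
  let V : ℝ → ι → StrongDual ℝ E := fun θ k => Real.cos θ • Y k + Real.sin θ • X k
  let U : ℝ → ι → StrongDual ℝ E := fun θ k => Real.cos θ • X k - Real.sin θ • Y k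
  have hderiv : ∀ θ, HasDerivAt (fun θ => ∫ x, smoothMax β (fun k => V θ k x) ∂μ)
      (∫ x, ∑ k, U θ k x * softmax β (fun l => V θ l x) k ∂μ) θ := by
    intro θ
    refine (hasDerivAt_integral_of_dominated_loc_of_deriv_le (s := Set.univ)
      (bound := fun x => ∑ k, (|X k x| + |Y k x|))
      (F := fun θ x => smoothMax β fun k => V θ k x)
      (F' := fun θ x => ∑ k, U θ k x * softmax β (fun l => V θ l x) k)
      Filter.univ_mem ?_ ?_ ?_ ?_ ?_ ?_).2
    · exact Eventually.of_forall fun θ => (integrable_smoothMax hβ μ (V θ)).aestronglyMeasurable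
    · exact integrable_smoothMax hβ μ (V θ)
    · refine Continuous.aestronglyMeasurable (continuous_finsetSum _ fun k _ => ?_)
      exact (U θ k).continuous.mul (continuous_softmax_dual β (V θ) k)
    · refine ae_of_all _ fun x θ _ => (norm_sum_le _ _).trans (Finset.sum_le_sum fun k _ => ?_)
      rw [norm_mul, Real.norm_of_nonneg (softmax_nonneg _ _ k)]
      refine (mul_le_of_le_one_right (norm_nonneg _) (softmax_le_one _ _ k)).trans ?_
      have h1 := Real.abs_cos_le_one θ
      have h2 := Real.abs_sin_le_one θ
      calc ‖U θ k x‖ ≤ |Real.cos θ| * |X k x| + |Real.sin θ| * |Y k x| := by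
            simp only [U, sub_apply, smul_apply,
              smul_eq_mul, Real.norm_eq_abs]
            rw [← abs_mul, ← abs_mul]
            exact abs_sub _ _
        _ ≤ 1 * |X k x| + 1 * |Y k x| := by gcongr
        _ = _ := by ring
    · exact integrable_finsetSum _ fun k _ => (IsGaussian.integrable_dual μ (X k)).abs.add
        (IsGaussian.integrable_dual μ (Y k)).abs
    · refine ae_of_all _ fun x θ _ => ?_
      have h1 : HasDerivAt (fun θ => fun k => V θ k x) (fun k => U θ k x) θ := by
        refine hasDerivAt_pi.2 fun k => ?_
        have := ((Real.hasDerivAt_cos θ).mul_const (Y k x)).add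
          ((Real.hasDerivAt_sin θ).mul_const (X k x))
        refine this.congr_deriv ?_
        simp [U]; ring
      have h2 := (hasFDerivAt_smoothMax hβ.ne' (fun k => V θ k x)).comp_hasDerivAt θ h1
      refine h2.congr_deriv ?_
      simp [mul_comm]
  have hcov : ∀ θ k l, ∫ x, U θ k x * V θ l x ∂μ
      = Real.sin θ * Real.cos θ * (∫ x, X k x * X l x ∂μ - ∫ x, Y k x * Y l x ∂μ) := by
    intro θ k l
    have : ∀ x, U θ k x * V θ l x = Real.sin θ * Real.cos θ * (X k x * X l x)
        - Real.sin θ * Real.cos θ * (Y k x * Y l x) + (Real.cos θ) ^ 2 * (X k x * Y l x)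
        - (Real.sin θ) ^ 2 * (X l x * Y k x) := by
      intro x; simp [U, V]; ring
    simp_rw [this]
    have i1 := integrable_dual_mul_dual μ
    rw [integral_sub, integral_add, integral_sub, integral_const_mul, integral_const_mul,
      integral_const_mul, integral_const_mul, hXY, hXY]
    · ring
    all_goals
      first
      | exact (i1 _ _).const_mul _
      | exact ((i1 _ _).const_mul _).sub ((i1 _ _).const_mul _)
      | exact (((i1 _ _).const_mul _).sub ((i1 _ _).const_mul _)).add ((i1 _ _).const_mul _)
  -- The diagonal covariances of U and V vanish because X and Y have equal variances. The others are
  -- at most δ sin θ cos θ, and the softmax weights sum to one, so the number of variables does not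
  -- enter.
  have hlow : ∀ θ, 0 ≤ Real.sin θ * Real.cos θ → -(β * δ * (Real.sin θ * Real.cos θ))
      ≤ ∫ x, ∑ k, U θ k x * softmax β (fun l => V θ l x) k ∂μ := by
    intro θ hθ
    rw [integral_sum_dual_mul_softmax hμ]
    have hc : -(β * δ * (Real.sin θ * Real.cos θ))
        = ∫ x, -(β * δ * (Real.sin θ * Real.cos θ)) ∂μ := by simp
    rw [hc]
    refine integral_mono (integrable_const _) ?_ fun x => ?_
    · refine integrable_finsetSum _ fun k _ => ?_
      have hsV : ∀ k, Continuous fun x => softmax β (fun l => V θ l x) k := fun k =>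
        continuous_softmax_dual β (V θ) k
      have hb : ∀ k, Integrable (fun x => softmax β (fun l => V θ l x) k) μ := fun k =>
        Integrable.of_bound (C := 1) (hsV k).aestronglyMeasurable (ae_of_all _ fun x => by
          rw [Real.norm_of_nonneg (softmax_nonneg _ _ k)]
          exact softmax_le_one _ _ k)
      refine Integrable.bdd_mul (c := |β|) ?_
        (continuous_const.mul (hsV k)).aestronglyMeasurable (ae_of_all _ fun x => ?_)
      · exact (integrable_const _).sub (integrable_finsetSum _ fun l _ => (hb l).mul_const _)
      · rw [norm_mul, Real.norm_of_nonneg (softmax_nonneg _ _ k), Real.norm_eq_abs]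
        exact mul_le_of_le_one_right (abs_nonneg _) (softmax_le_one _ _ k)
    · simp only [hcov, hX, hY, sub_self, mul_zero, zero_sub]
      set p := softmax β (fun l => V θ l x)
      have hp0 : ∀ k, 0 ≤ p k := softmax_nonneg _ _
      have hp1 : ∑ k, p k = 1 := sum_softmax _ _
      have h1 : ∀ k, ∑ l, p l * (Real.sin θ * Real.cos θ
          * (∫ x, X k x * X l x ∂μ - ∫ x, Y k x * Y l x ∂μ)) ≤ Real.sin θ * Real.cos θ * δ := by
        intro k
        calc _ ≤ ∑ l, p l * (Real.sin θ * Real.cos θ * δ) := by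
              refine Finset.sum_le_sum fun l _ => mul_le_mul_of_nonneg_left
                (mul_le_mul_of_nonneg_left ?_ hθ) (hp0 l)
              by_cases hkl : k = l
              · subst hkl; rw [hX, hY]; simpa using hδ
              · rw [hY0 k l hkl, sub_zero]; exact hXδ k l hkl
          _ = _ := by rw [← Finset.sum_mul, hp1, one_mul]
      calc -(β * δ * (Real.sin θ * Real.cos θ))
          = ∑ k, β * p k * -(Real.sin θ * Real.cos θ * δ) := by
            rw [← Finset.sum_mul, ← Finset.mul_sum, hp1]; ring
        _ ≤ _ := Finset.sum_le_sum fun k _ =>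
            mul_le_mul_of_nonneg_left (neg_le_neg (h1 k)) (mul_nonneg hβ.le (hp0 k))
  -- The added term is an antiderivative of the possible loss βδ sin θ cos θ; over the quarter turn
  -- it grows by βδ/2.
  have hmono : MonotoneOn (fun θ => ∫ x, smoothMax β (fun k => V θ k x) ∂μ
      + β * δ * (Real.sin θ ^ 2 / 2)) (Set.Icc 0 (Real.pi / 2)) := by
    have hd : ∀ θ, HasDerivAt (fun θ => ∫ x, smoothMax β (fun k => V θ k x) ∂μ
      + β * δ * (Real.sin θ ^ 2 / 2)) ((∫ x, ∑ k, U θ k x * softmax β (fun l => V θ l x) k ∂μ)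
        + β * δ * (Real.sin θ * Real.cos θ)) θ := by
      intro θ
      refine ((hderiv θ).add ((((Real.hasDerivAt_sin θ).pow 2).div_const 2).const_mul
        (β * δ))).congr_deriv ?_
      push_cast; ring
    refine monotoneOn_of_deriv_nonneg (convex_Icc _ _)
      (fun θ _ => (hd θ).continuousAt.continuousWithinAt)
      (fun θ _ => (hd θ).differentiableAt.differentiableWithinAt) fun θ hθ => ?_
    rw [interior_Icc] at hθ
    rw [(hd θ).deriv]
    have := hlow θ (mul_nonneg (Real.sin_nonneg_of_nonneg_of_le_pi hθ.1.le (by linarith [hθ.2,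
      Real.pi_pos])) (Real.cos_nonneg_of_neg_pi_div_two_le_of_le (by linarith [hθ.1, Real.pi_pos])
        hθ.2.le))
    linarith
  have h := hmono (Set.left_mem_Icc.2 (by positivity)) (Set.right_mem_Icc.2 (by positivity))
    (by positivity)
  have e : β * δ * ((1 : ℝ) ^ 2 / 2) = β * δ / 2 := by ring
  simpa only [V, Real.cos_zero, Real.sin_zero, Real.cos_pi_div_two, Real.sin_pi_div_two, one_smul,
    zero_smul, add_zero, zero_add, ne_eq, OfNat.ofNat_ne_zero, not_false_eq_true, zero_pow,
    zero_div, mul_zero, e] using h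

end

/-! ### Maxima of weakly correlated Gaussian variables -/

lemma le_gaussianReal_Ici {u : ℝ} (hu : 0 ≤ u) :
    (√(2 * Real.pi))⁻¹ * Real.exp (-(u + 1) ^ 2 / 2) ≤ (gaussianReal 0 1).real (Set.Ici u) := by
  have h1 : (gaussianReal 0 1).real (Set.Icc u (u + 1)) ≤ (gaussianReal 0 1).real (Set.Ici u) :=
    measureReal_mono Set.Icc_subset_Ici_self
  refine le_trans ?_ h1
  rw [measureReal_def, gaussianReal_apply_eq_integral 0 one_ne_zero, ENNReal.toReal_ofReal
    (integral_nonneg fun x => gaussianPDFReal_nonneg _ _ _)]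
  have h2 : ∫ _ in Set.Icc u (u + 1), (√(2 * Real.pi))⁻¹ * Real.exp (-(u + 1) ^ 2 / 2)
      = (√(2 * Real.pi))⁻¹ * Real.exp (-(u + 1) ^ 2 / 2) := by
    simp
  rw [← h2]
  refine setIntegral_mono_on (integrable_const _) (integrable_gaussianPDFReal 0 1).integrableOn
    measurableSet_Icc fun x hx => ?_
  simp only [gaussianPDFReal, NNReal.coe_one, mul_one, sub_zero]
  gcongr
  exacts [hu.trans hx.1, hx.2]

/-- The inequality 1 + y ≤ exp y at y = u(x-u) dominates the positive part by an exponential whose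
Gaussian mean is explicit. -/
lemma integral_posPart_sub_gaussianReal_le {u : ℝ} (hu : 0 < u) :
    ∫ x, max (x - u) 0 ∂(gaussianReal 0 1) ≤ Real.exp (-u ^ 2 / 2) / u := by
  have h1 : ∀ x : ℝ, max (x - u) 0 ≤ Real.exp (-u ^ 2) / u * Real.exp (u * x) := by
    intro x
    rw [div_mul_eq_mul_div, ← Real.exp_add, le_div_iff₀ hu]
    refine max_mul_of_nonneg _ _ hu.le |>.le.trans (max_le ?_ ?_)
    · have := Real.add_one_le_exp (-u ^ 2 + u * x)
      nlinarith
    · rw [zero_mul]; positivity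
  have h2 : Integrable (fun x => Real.exp (-u ^ 2) / u * Real.exp (u * x)) (gaussianReal 0 1) :=
    (integrable_exp_mul_gaussianReal u).const_mul _
  refine (integral_mono_of_nonneg (ae_of_all _ fun x => le_max_right _ _) h2
    (ae_of_all _ h1)).trans ?_
  rw [integral_const_mul]
  have h3 := mgf_gaussianReal (X := id) (p := gaussianReal 0 1) (μ := 0) (v := 1) (by simp) u
  simp only [mgf, id] at h3
  rw [h3, div_mul_eq_mul_div, ← Real.exp_add]
  refine le_of_eq ?_
  congr 2
  push_cast; ring

lemma integral_sq_gaussianReal : ∫ x, x ^ 2 ∂(gaussianReal 0 1) = 1 := by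
  have h := variance_id_gaussianReal (μ := 0) (v := 1)
  rw [variance_of_integral_eq_zero (by fun_prop) (by simp)] at h
  simpa using h

lemma integral_abs_gaussianReal_le : ∫ x, |x| ∂(gaussianReal 0 1) ≤ 1 := by
  have h2 : Integrable (fun x : ℝ => x ^ 2) (gaussianReal 0 1) :=
    (memLp_id_gaussianReal 2).integrable_sq
  have h : ∫ x, |x| ∂(gaussianReal 0 1) ≤ ∫ x, (1 / 2 + 1 / 2 * x ^ 2) ∂(gaussianReal 0 1) := by
    refine integral_mono_of_nonneg (ae_of_all _ fun x => abs_nonneg _)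
      ((integrable_const _).add (h2.const_mul _)) (ae_of_all _ fun x => ?_)
    have := sq_abs x
    simp only
    nlinarith [sq_nonneg (|x| - 1)]
  rw [integral_add (integrable_const _) (h2.const_mul _), integral_const_mul,
    integral_sq_gaussianReal] at h
  simpa using h.trans (by norm_num)

section

variable {ι : Type*} [Fintype ι]

instance isGaussian_pi_gaussianReal : IsGaussian (Measure.pi fun _ : ι => gaussianReal 0 1) := by
  have h : iIndepFun (fun (i : ι) (ω : ι → ℝ) => ω i) (Measure.pi fun _ : ι => gaussianReal 0 1) :=
    iIndepFun_pi (X := fun _ => (id : ℝ → ℝ)) fun _ => aemeasurable_id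
  have hX : ∀ i : ι, HasGaussianLaw (fun ω : ι → ℝ => ω i)
      (Measure.pi fun _ : ι => gaussianReal 0 1) := fun i => ⟨by
    have h : (Measure.pi fun _ : ι => gaussianReal 0 1).map (fun ω : ι → ℝ => ω i)
        = gaussianReal 0 1 := (measurePreserving_eval (fun _ : ι => gaussianReal 0 1) i).map_eq
    rw [h]; infer_instance⟩
  have h' := (iIndepFun.hasGaussianLaw hX h).isGaussian_map
  simpa using h'

lemma integral_comp_eval_pi (k : ι) {f : ℝ → ℝ} (hf : Continuous f) :
    ∫ y, f (y k) ∂(Measure.pi fun _ : ι => gaussianReal 0 1) = ∫ x, f x ∂(gaussianReal 0 1) := by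
  have h := integral_map (μ := Measure.pi fun _ : ι => gaussianReal 0 1) (φ := Function.eval k)
    (f := f) (measurable_pi_apply k).aemeasurable hf.aestronglyMeasurable
  rw [(measurePreserving_eval (fun _ : ι => gaussianReal 0 1) k).map_eq] at h
  exact h.symm

lemma integral_eval_mul_eval_pi (k l : ι) (hkl : k ≠ l) :
    ∫ y, y k * y l ∂(Measure.pi fun _ : ι => gaussianReal 0 1) = 0 := by
  have h := (iIndepFun_pi (μ := fun _ : ι => gaussianReal 0 1) (X := fun _ => (id : ℝ → ℝ))
    fun _ => aemeasurable_id).indepFun hkl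
  have h2 := h.integral_mul_eq_mul_integral (measurable_pi_apply k).aestronglyMeasurable
    (measurable_pi_apply l).aestronglyMeasurable
  have h3 : ∫ y : ι → ℝ, y k ∂(Measure.pi fun _ : ι => gaussianReal 0 1) = 0 := by
    exact (integral_comp_eval_pi k continuous_id).trans (by simp)
  simpa [h3] using h2

/-- Unless all coordinates stay below u, the smooth maximum is at least u. By independence that
exception has probability at most (1-q)ⁿ ≤ exp(-nq). On it one fixed coordinate serves as lower
bound, at a mean cost of at most 1. -/
lemma le_integral_smoothMax_pi [Nonempty ι] {β u q : ℝ} (hβ : 0 < β) (hu : 0 ≤ u)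
    (hq : q ≤ (gaussianReal 0 1).real (Set.Ici u)) :
    u * (1 - Real.exp (-(Fintype.card ι * q))) - 1
      ≤ ∫ y, smoothMax β (fun k : ι => y k) ∂(Measure.pi fun _ : ι => gaussianReal 0 1) := by
  set P := Measure.pi fun _ : ι => gaussianReal 0 1
  obtain ⟨k₀⟩ := id ‹Nonempty ι›
  let A : Set (ι → ℝ) := Set.univ.pi fun _ => Set.Iio u
  have hA : MeasurableSet A := MeasurableSet.univ_pi fun _ => measurableSet_Iio
  have hPA : P.real A ≤ Real.exp (-(Fintype.card ι * q)) := by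
    have h1 : P.real A = ((gaussianReal 0 1).real (Set.Iio u)) ^ Fintype.card ι := by
      simp [measureReal_def, P, A, Measure.pi_pi]
    have h2 : (gaussianReal 0 1).real (Set.Iio u) = 1 - (gaussianReal 0 1).real (Set.Ici u) := by
      rw [← probReal_compl_eq_one_sub measurableSet_Ici, Set.compl_Ici]
    rw [h1, ← mul_neg, Real.exp_nat_mul]
    gcongr
    have := Real.add_one_le_exp (-q)
    linarith
  have hint : Integrable (fun y : ι → ℝ => smoothMax β fun k => y k) P :=
    integrable_smoothMax hβ P fun k => ContinuousLinearMap.proj k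
  have hk : Integrable (fun y : ι → ℝ => |y k₀|) P :=
    (IsGaussian.integrable_dual P (ContinuousLinearMap.proj (R := ℝ) (φ := fun _ : ι => ℝ) k₀)).abs
  have hi' : Integrable (fun y : ι → ℝ => u - A.indicator (fun _ => u) y) P :=
    (integrable_const u).sub ((integrable_const u).indicator hA)
  have hi : Integrable (fun y : ι → ℝ => u - A.indicator (fun _ => u) y - |y k₀|) P :=
    hi'.sub hk
  have h := integral_mono hi hint fun y => by
    by_cases hy : y ∈ A
    · simp only [Set.indicator_of_mem hy, sub_self, zero_sub]
      exact (neg_abs_le _).trans (le_smoothMax hβ (fun k => y k) k₀)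
    · simp only [Set.indicator_of_notMem hy, sub_zero]
      simp only [A, Set.mem_pi, Set.mem_univ, true_imp_iff, Set.mem_Iio, not_forall, not_lt] at hy
      obtain ⟨k, hk⟩ := hy
      have := le_smoothMax hβ (fun k => y k) k
      have := abs_nonneg (y k₀)
      linarith
  refine le_trans ?_ h
  rw [integral_sub hi' hk,
    integral_sub (integrable_const u) ((integrable_const u).indicator hA),
    integral_indicator_const _ hA, integral_comp_eval_pi k₀ continuous_abs]
  have := integral_abs_gaussianReal_le
  simp only [integral_const, probReal_univ, smul_eq_mul, one_mul]
  nlinarith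

end

lemma tendsto_sqrt_two_mul_log : Tendsto (fun n : ℕ => √(2 * Real.log n)) atTop atTop :=
  Real.tendsto_sqrt_atTop.comp ((Real.tendsto_log_atTop.comp
    tendsto_natCast_atTop_atTop).const_mul_atTop two_pos)

/-- For a suitable c this bounds from below the expected number of n standard normals that exceed
(1-η)s, where s = √(2 log n). Since n = exp(s²/2), the exponent is a difference of squares, which
factors into two terms growing linearly in s. -/
lemma tendsto_natCast_mul_exp_sq {η c : ℝ} (hη : 0 < η) (hη1 : η < 1) (hc : 0 < c) :
    Tendsto (fun n : ℕ => n * (c * Real.exp (-((1 - η) * √(2 * Real.log n) + 1) ^ 2 / 2)))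
      atTop atTop := by
  have h : Tendsto (fun s : ℝ => c * Real.exp ((η * s + (-1)) * (((2 - η) * s + 1) / 2)))
      atTop atTop := by
    refine Tendsto.const_mul_atTop hc (Real.tendsto_exp_atTop.comp (Tendsto.atTop_mul_atTop₀ ?_ ?_))
    · exact tendsto_atTop_add_const_right _ _ (tendsto_id.const_mul_atTop hη)
    · exact (tendsto_atTop_add_const_right _ _
        (tendsto_id.const_mul_atTop (by linarith))).atTop_div_const two_pos
  refine (h.comp tendsto_sqrt_two_mul_log).congr' ?_
  filter_upwards [eventually_ge_atTop 1] with n hn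
  have hn' : (1 : ℝ) ≤ n := by exact_mod_cast hn
  have hs : √(2 * Real.log n) ^ 2 = 2 * Real.log n :=
    Real.sq_sqrt (mul_nonneg two_pos.le (Real.log_nonneg hn'))
  simp only [Function.comp]
  set s := √(2 * Real.log n)
  have hn2 : (n : ℝ) = Real.exp (s ^ 2 / 2) := by
    rw [hs, mul_div_cancel_left₀ _ (two_ne_zero), Real.exp_log (by linarith)]
  rw [hn2, mul_left_comm, ← Real.exp_add]
  congr 2
  ring

/-- The maximum of `n` centered Gaussian variables of unit variance with small covariances is at
least `(1 - ε) √(2 log n)` with high probability. -/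
theorem exists_forall_measureReal_forall_lt_le {ε : ℝ} (hε : 0 < ε) (hε1 : ε < 1) :
    ∃ δ > 0, ∃ n₀ : ℕ, ∀ (ι : Type) [Fintype ι], n₀ ≤ Fintype.card ι →
      ∀ {E : Type*} [NormedAddCommGroup E] [NormedSpace ℝ E] [MeasurableSpace E] [BorelSpace E]
        {μ : Measure E} [IsGaussian μ], (∀ ℓ : StrongDual ℝ E, ∫ x, ℓ x ∂μ = 0) →
      ∀ X : ι → StrongDual ℝ E, (∀ k, ∫ x, X k x * X k x ∂μ = 1) →
        (∀ k l, k ≠ l → ∫ x, X k x * X l x ∂μ ≤ δ) →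
        μ.real {x | ∀ k, X k x < (1 - ε) * √(2 * Real.log (Fintype.card ι))} ≤ ε := by
  set c : ℝ := (√(2 * Real.pi))⁻¹ with hcdef
  have hc : 0 < c := by positivity
  -- All errors below add up to at most ε²L, whereas the bad event A lowers the mean of the maximum
  -- by εL times its probability; hence that probability is at most ε.
  set η : ℝ := ε ^ 2 / 4 with hη
  have hη0 : 0 < η := by positivity
  have hη1 : η < 1 := by nlinarith
  have hδ0 : 0 < η ^ 2 := by positivity
  have e1 := (Real.tendsto_exp_neg_atTop_nhds_zero.comp
    (tendsto_natCast_mul_exp_sq hη0 hη1 hc)).eventually_le_const (show (0 : ℝ) < ε ^ 2 / 8 by positivity)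
  have e2 := tendsto_sqrt_two_mul_log.eventually_ge_atTop (max 1 (16 / ε ^ 2))
  obtain ⟨n₀, hn₀⟩ := eventually_atTop.1 (e1.and e2)
  refine ⟨η ^ 2, hδ0, n₀, ?_⟩
  intro ι _ hcard E _ _ _ _ μ _ hμ X hX hXδ
  obtain ⟨hr, hL⟩ := hn₀ _ hcard
  set N := Fintype.card ι with hN
  set L := √(2 * Real.log N) with hLdef
  have hL1 : 1 ≤ L := (le_max_left _ _).trans hL
  have hL2 : 16 / ε ^ 2 ≤ L := (le_max_right _ _).trans hL
  have hL0 : 0 < L := by linarith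
  have hlog : Real.log N = L ^ 2 / 2 := by
    have : 0 ≤ 2 * Real.log N := by
      by_contra h
      rw [hLdef, Real.sqrt_eq_zero_of_nonpos (le_of_not_ge h)] at hL0
      exact lt_irrefl _ hL0
    rw [hLdef, Real.sq_sqrt this]; ring
  have hNpos : 0 < N := by
    rcases Nat.eq_zero_or_pos N with h | h
    · rw [h] at hlog; simp at hlog; exact absurd hlog.symm (by positivity)
    · exact h
  have : Nonempty ι := Fintype.card_pos_iff.1 hNpos
  have hNexp : (N : ℝ) = Real.exp (L ^ 2 / 2) := by
    rw [← hlog, Real.exp_log (by exact_mod_cast hNpos)]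
  -- This choice balances the smoothing error log N / β and the interpolation error βη²/2: both
  -- equal Lη/2.
  set β := L / η with hβ
  have hβ0 : 0 < β := by positivity
  -- comparison with an independent family
  let Q := Measure.pi fun _ : ι => gaussianReal 0 1
  have hQ : IsGaussian Q := isGaussian_pi_gaussianReal
  have hQ0 : ∀ ℓ : StrongDual ℝ (ι → ℝ), ∫ y, ℓ y ∂Q = 0 := by
    intro ℓ
    have h1 : ∫ y, y ∂Q = 0 := by
      ext k
      exact (IsGaussian.integral_dual (μ := Q)
        (ContinuousLinearMap.proj (R := ℝ) (φ := fun _ : ι => ℝ) k)).symm.trans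
          ((integral_comp_eval_pi k continuous_id).trans (by simp))
    rw [IsGaussian.integral_dual, h1, map_zero]
  have hν : ∀ ℓ : StrongDual ℝ (E × (ι → ℝ)), ∫ z, ℓ z ∂(μ.prod Q) = 0 := by
    intro ℓ
    have h1 : ∀ z : E × (ι → ℝ), ℓ z = ℓ.comp (ContinuousLinearMap.inl ℝ _ _) z.1
        + ℓ.comp (ContinuousLinearMap.inr ℝ _ _) z.2 := by
      intro z
      rw [ContinuousLinearMap.comp_apply, ContinuousLinearMap.comp_apply, ← map_add]
      simp
    simp_rw [h1]
    rw [integral_add ((IsGaussian.integrable_dual μ _).comp_fst Q)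
      ((IsGaussian.integrable_dual Q _).comp_snd μ),
      integral_fun_fst (fun x => ℓ.comp (ContinuousLinearMap.inl ℝ _ _) x),
      integral_fun_snd (fun x => ℓ.comp (ContinuousLinearMap.inr ℝ _ _) x), hμ, hQ0]
    simp
  have hcomp := integral_smoothMax_le_add (μ := μ.prod Q) hν hβ0 hδ0.le
    (fun k => (X k).comp (ContinuousLinearMap.fst ℝ E (ι → ℝ)))
    (fun k => (ContinuousLinearMap.proj (R := ℝ) (φ := fun _ : ι => ℝ) k).comp
      (ContinuousLinearMap.snd ℝ E (ι → ℝ))) ?_ ?_ ?_ ?_ ?_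
  rotate_left
  · intro k
    simpa using (integral_fun_fst (ν := Q) fun x => X k x * X k x).trans (by simp [hX k])
  · intro k l hkl
    have := integral_fun_fst (μ := μ) (ν := Q) fun x => X k x * X l x
    simp only [probReal_univ, one_smul] at this
    simpa [this] using hXδ k l hkl
  · intro k
    have h1 := integral_fun_snd (μ := μ) (ν := Q) fun y => y k * y k
    have h2 := (integral_comp_eval_pi (ι := ι) k (f := fun x => x * x) (by fun_prop))
    have h3 := integral_sq_gaussianReal
    simp_rw [sq] at h3
    simp only [probReal_univ, one_smul] at h1
    simpa using h1.trans (h2.trans h3)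
  · intro k l hkl
    have h1 := integral_fun_snd (μ := μ) (ν := Q) fun y => y k * y l
    simp only [probReal_univ, one_smul] at h1
    simpa using h1.trans (integral_eval_mul_eval_pi k l hkl)
  · intro k l
    have h1 := integral_prod_mul (μ := μ) (ν := Q) (fun x => X k x) fun y => y l
    rw [hμ, zero_mul] at h1
    simpa using h1
  have hcomp1 := integral_fun_fst (μ := μ) (ν := Q) fun x => smoothMax β fun k => X k x
  have hcomp2 := integral_fun_snd (μ := μ) (ν := Q) fun y => smoothMax β fun k => y k
  simp only [probReal_univ, one_smul] at hcomp1 hcomp2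
  simp only [ContinuousLinearMap.comp_apply, ContinuousLinearMap.coe_fst',
    ContinuousLinearMap.coe_snd', ContinuousLinearMap.proj_apply, hcomp1, hcomp2] at hcomp
  have hlow := le_integral_smoothMax_pi (ι := ι) hβ0
    (mul_nonneg (by linarith : 0 ≤ 1 - η) hL0.le) (le_gaussianReal_Ici (u := (1 - η) * L)
      (mul_nonneg (by linarith : 0 ≤ 1 - η) hL0.le))
  -- the upper bound on the smooth maximum
  set A := {x | ∀ k, X k x < (1 - ε) * L} with hAdef
  have hA : MeasurableSet A := by
    rw [hAdef, Set.ofPred_forall]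
    exact MeasurableSet.iInter fun k => measurableSet_lt (by fun_prop) measurable_const
  have hpos : ∀ k, Integrable (fun x => max (X k x - L) 0) μ := fun k =>
    ((IsGaussian.integrable_dual μ (X k)).sub (integrable_const L)).pos_part
  have hposint : ∀ k, ∫ x, max (X k x - L) 0 ∂μ ≤ Real.exp (-L ^ 2 / 2) / L := by
    intro k
    have h1 := map_dual_eq_gaussianReal hμ (X k)
    have h2 : ∫ x, X k x ^ 2 ∂μ = 1 := by simpa [sq] using hX k
    rw [h2, Real.toNNReal_one] at h1
    have h3 := integral_posPart_sub_gaussianReal_le hL0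
    rwa [← h1, integral_map (by fun_prop) (Continuous.aestronglyMeasurable (by fun_prop))] at h3
  have hi1 : Integrable (fun x => L - A.indicator (fun _ => ε * L) x) μ :=
    (integrable_const L).sub ((integrable_const _).indicator hA)
  have hi2 : Integrable (fun x => ∑ k, max (X k x - L) 0) μ :=
    integrable_finsetSum _ fun k _ => hpos k
  have hi3 : Integrable (fun x => L - A.indicator (fun _ => ε * L) x
      + ∑ k, max (X k x - L) 0) μ := hi1.add hi2
  -- The maximum is at most L plus the total excess over L, and on A it is smaller by εL.
  have hup : ∫ x, smoothMax β (fun k => X k x) ∂μ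
      ≤ ∫ x, (L - A.indicator (fun _ => ε * L) x + ∑ k, max (X k x - L) 0
        + Real.log N / β) ∂μ := by
    refine integral_mono (integrable_smoothMax hβ0 μ X) ?_ fun x => ?_
    · exact hi3.add (integrable_const _)
    · have hs : 0 ≤ ∑ k, max (X k x - L) 0 := Finset.sum_nonneg fun k _ => le_max_right _ _
      refine smoothMax_le hβ0 fun k => ?_
      by_cases hx : x ∈ A
      · rw [Set.indicator_of_mem hx]
        have := hx k
        linarith
      · rw [Set.indicator_of_notMem hx]
        have h1 := Finset.single_le_sum (f := fun k => max (X k x - L) 0)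
          (fun k _ => le_max_right _ _) (Finset.mem_univ k)
        have h2 := le_max_left (X k x - L) 0
        linarith
  rw [integral_add hi3 (integrable_const _), integral_add hi1 hi2,
    integral_sub (integrable_const L) ((integrable_const _).indicator hA),
    integral_indicator_const _ hA, integral_finsetSum _ fun k _ => hpos k] at hup
  simp only [integral_const, probReal_univ, smul_eq_mul, one_mul] at hup
  -- L is exactly the level at which N exp(-L²/2) = 1, so the mean total excess is at most 1/L.
  have hsum : ∑ k, ∫ x, max (X k x - L) 0 ∂μ ≤ 1 / L := by
    refine (Finset.sum_le_sum fun k _ => hposint k).trans ?_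
    rw [Finset.sum_const, Finset.card_univ, nsmul_eq_mul, ← hN, hNexp, ← mul_div_assoc,
      ← Real.exp_add]
    simp [neg_div]
  have hb1 : Real.log N / β = L * η / 2 := by rw [hlog, hβ]; field_simp
  have hb2 : β * η ^ 2 / 2 = L * η / 2 := by rw [hβ]; field_simp
  rw [hb1] at hup
  rw [hb2] at hcomp
  set r := Real.exp (-(N * (c * Real.exp (-((1 - η) * L + 1) ^ 2 / 2)))) with hrdef
  have hr' : r ≤ ε ^ 2 / 8 := hr
  have hr0 : 0 ≤ r := (Real.exp_pos _).le
  have hLinv : 1 / L ≤ ε ^ 2 / 16 := by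
    rw [div_le_iff₀ hL0]
    have := (div_le_iff₀ (by positivity : (0 : ℝ) < ε ^ 2)).1 hL2
    nlinarith
  have hLinv1 : 1 / L ≤ 1 := by rw [div_le_one hL0]; exact hL1
  have hone : 1 ≤ ε ^ 2 / 16 * L := (div_le_iff₀ hL0).1 hLinv
  set p := μ.real A
  have hmain : p * (ε * L) ≤ ε ^ 2 * L := by
    have h1 : (1 - η) * L * (1 - r) ≥ L - η * L - r * L := by
      have : 0 ≤ η * L * r := by positivity
      nlinarith
    have h2 : r * L ≤ ε ^ 2 / 8 * L := by gcongr
    have h3 : 1 / L ≤ ε ^ 2 / 16 * L := hLinv1.trans hone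
    have h4 : η * L = ε ^ 2 / 4 * L := by rw [hη]
    have h5 : L * η / 2 = ε ^ 2 / 8 * L := by rw [hη]; ring
    have h6 : 0 < ε ^ 2 * L := by positivity
    have h7 := hlow.trans hcomp
    linarith
  have : p * (ε * L) ≤ ε * (ε * L) := by linarith [hmain]
  exact le_of_mul_le_mul_right this (by positivity)

/-! ### Cluster points -/

/-- A filter cluster point first gives times without order. Ramsey extraction makes them monotone or
strictly decreasing, and the latter is incompatible with divergence to infinity. -/
lemma exists_monotone_tendsto_of_mapClusterPt {X : Type*} [TopologicalSpace X]
    [FirstCountableTopology X] {γ : ℝ≥0 → X} {x : X} (h : MapClusterPt x atTop γ) :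
    ∃ t : ℕ → ℝ≥0, Monotone t ∧ Tendsto t atTop atTop ∧
      Tendsto (fun n => γ (t n)) atTop (𝓝 x) := by
  have : NeBot (atTop ⊓ comap γ (𝓝 x)) := by
    rw [neBot_inf_comap_iff_map, inf_comm]; exact h
  obtain ⟨s, hs⟩ := exists_seq_tendsto (atTop ⊓ comap γ (𝓝 x))
  obtain ⟨hs1, hs2⟩ := tendsto_inf.1 hs
  rw [tendsto_comap_iff] at hs2
  obtain ⟨g, hg⟩ := exists_increasing_or_nonincreasing_subseq (· ≤ ·) s
  have hgt : Tendsto g atTop atTop := g.strictMono.tendsto_atTop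
  refine ⟨fun n => s (g n), ?_, hs1.comp hgt, hs2.comp hgt⟩
  rcases hg with hg | hg
  · exact monotone_iff_forall_lt.2 fun m n hmn => hg m n hmn
  · obtain ⟨n, hn, hn'⟩ := ((eventually_gt_atTop 0).and
      ((hs1.comp hgt).eventually_ge_atTop (s (g 0)))).exists
    exact absurd hn' (hg 0 n hn)

lemma mem_clusterPointsAtInfinity_iff {X : Type*} [TopologicalSpace X]
    [FirstCountableTopology X] {γ : ℝ≥0 → X} {x : X} :
    x ∈ clusterPointsAtInfinity γ ↔ MapClusterPt x atTop γ := by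
  refine ⟨?_, exists_monotone_tendsto_of_mapClusterPt⟩
  rintro ⟨t, -, ht, hx⟩
  exact hx.mapClusterPt.of_comp ht

lemma clusterPointsAtInfinity_eq {X : Type*} [TopologicalSpace X]
    [FirstCountableTopology X] (γ : ℝ≥0 → X) :
    clusterPointsAtInfinity γ = {x | MapClusterPt x atTop γ} :=
  Set.ext fun _ => mem_clusterPointsAtInfinity_iff

lemma isClosed_clusterPointsAtInfinity {X : Type*} [TopologicalSpace X]
    [FirstCountableTopology X] (γ : ℝ≥0 → X) : IsClosed (clusterPointsAtInfinity γ) := by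
  rw [clusterPointsAtInfinity_eq]
  exact isClosed_setOfPred_clusterPt

/-- The point `exp (-t)` of `(0, 1]`. -/
noncomputable def expNeg (t : ℝ≥0) : Set.Ioc (0 : ℝ) 1 :=
  ⟨Real.exp (-t), Real.exp_pos _, Real.exp_le_one_iff.2 (neg_nonpos.2 t.2)⟩

lemma expNeg_add (t u : ℝ≥0) : expNeg (t + u) = expNeg t * expNeg u := by
  ext
  simp [expNeg, Real.exp_add, add_comm]

lemma strictAnti_expNeg : StrictAnti expNeg := fun t u h => by
  have : (t : ℝ) < u := h
  exact Subtype.coe_lt_coe.1 (Real.exp_lt_exp.2 (neg_lt_neg this))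

lemma surjective_expNeg : Function.Surjective expNeg := fun ε =>
  ⟨⟨-Real.log ε, neg_nonneg.2 (Real.log_nonpos ε.2.1.le ε.2.2)⟩, by
    ext
    change Real.exp (-(-Real.log ε)) = ε
    rw [neg_neg, Real.exp_log ε.2.1]⟩

lemma tendsto_coe_expNeg_comp_iff {α : Type*} {l : Filter α} {t : α → ℝ≥0} :
    Tendsto (fun a => (expNeg (t a) : ℝ)) l (𝓝 0) ↔ Tendsto t l atTop := by
  simp only [expNeg, Real.tendsto_exp_comp_nhds_zero, tendsto_neg_atBot_iff]
  exact NNReal.tendsto_coe_atTop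

lemma clusterPointsAtZero_eq {X : Type*} [TopologicalSpace X] (γ : Set.Ioc (0 : ℝ) 1 → X) :
    clusterPointsAtZero γ = clusterPointsAtInfinity fun t => γ (expNeg t) := by
  ext x
  constructor
  · rintro ⟨ε, hε, hε0, hx⟩
    choose t ht using fun n => surjective_expNeg (ε n)
    refine ⟨t, fun m n hmn => ?_, tendsto_coe_expNeg_comp_iff.1 (by simpa only [ht] using hε0),
      by simpa only [ht] using hx⟩
    have := hε hmn
    rwa [← ht, ← ht, strictAnti_expNeg.le_iff_ge] at this
  · rintro ⟨t, ht, ht', hx⟩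
    exact ⟨fun n => expNeg (t n), fun m n hmn => strictAnti_expNeg.antitone (ht hmn),
      tendsto_coe_expNeg_comp_iff.2 ht', hx⟩

/-! ### Approximation by finite-dimensional subspaces -/

lemma norm_mkQL_eq_infDist {X : Type*} [NormedAddCommGroup X] [NormedSpace ℝ X]
    (F : Submodule ℝ X) (x : X) : ‖F.mkQL x‖ = Metric.infDist x F :=
  QuotientAddGroup.norm_mk (S := F.toAddSubgroup) x

lemma exists_dist_lt_of_norm_mkQL_lt {X : Type*} [NormedAddCommGroup X] [NormedSpace ℝ X]
    {F : Submodule ℝ X} {x : X} {r : ℝ} (h : ‖F.mkQL x‖ < r) : ∃ z ∈ F, dist x z < r := by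
  rw [norm_mkQL_eq_infDist, Metric.infDist_lt_iff ⟨0, F.zero_mem⟩] at h
  exact h

/-- A bounded sequence which is eventually close to finite-dimensional subspaces has a
convergent subsequence. -/
lemma exists_subseq_tendsto_of_norm_mkQL_le {X : Type*} [NormedAddCommGroup X] [NormedSpace ℝ X]
    [CompleteSpace X] {y : ℕ → X} {M : ℝ} (hM : ∀ᶠ n in atTop, ‖y n‖ ≤ M)
    (hF : ∀ ε > 0, ∃ F : Submodule ℝ X, FiniteDimensional ℝ F ∧ ∀ᶠ n in atTop, ‖F.mkQL (y n)‖ ≤ ε)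
    (ψ : ℕ → ℕ) :
    ∃ z, ∃ φ : ℕ → ℕ, StrictMono φ ∧ Tendsto (fun n => y (ψ (φ n))) atTop (𝓝 z) := by
  have htb : TotallyBounded (Set.range y) := by
    refine Metric.totallyBounded_iff.2 fun ε hε => ?_
    obtain ⟨F, hFfin, hFε⟩ := hF (ε / 4) (by positivity)
    obtain ⟨N, hN⟩ := eventually_atTop.1 (hM.and hFε)
    have hprop : ProperSpace F := FiniteDimensional.proper ℝ F
    -- The tail of the sequence is close to a bounded, hence totally bounded, part of F. A finite
    -- net of that part together with the finitely many initial terms is a net of the whole range.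
    obtain ⟨t, ht, htc⟩ := Metric.totallyBounded_iff.1
      (isCompact_closedBall (0 : F) (M + ε)).totallyBounded (ε / 2) (by positivity)
    refine ⟨(fun z : F => (z : X)) '' t ∪ y '' Set.Iio N, (ht.image _).union
      ((Set.finite_Iio N).image _), ?_⟩
    rintro _ ⟨n, rfl⟩
    by_cases hn : n < N
    · exact Set.mem_biUnion (Or.inr ⟨n, hn, rfl⟩) (Metric.mem_ball_self hε)
    · obtain ⟨h1, h2⟩ := hN n (not_lt.1 hn)
      obtain ⟨z, hzF, hz⟩ := exists_dist_lt_of_norm_mkQL_lt (h2.trans_lt (by linarith : _ < ε / 2))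
      have hz' : (⟨z, hzF⟩ : F) ∈ Metric.closedBall (0 : F) (M + ε) := by
        rw [mem_closedBall_zero_iff]
        change ‖z‖ ≤ M + ε
        have := norm_sub_norm_le z (y n)
        rw [← dist_eq_norm, dist_comm] at this
        linarith
      obtain ⟨w, hw, hzw⟩ := Set.mem_iUnion₂.1 (htc hz')
      refine Set.mem_biUnion (Or.inl ⟨w, hw, rfl⟩) ?_
      rw [Metric.mem_ball] at hzw ⊢
      have h3 := dist_triangle (y n) z w
      have h4 : dist z (w : X) < ε / 2 := hzw
      linarith
  have hK : IsCompact (closure (Set.range y)) :=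
    htb.closure.isCompact_of_isClosed isClosed_closure
  -- The closure of the full range is compact, so ψ need not be increasing.
  obtain ⟨z, -, φ, hφ, hz⟩ := hK.tendsto_subseq (x := fun n => y (ψ n))
    fun n => subset_closure ⟨_, rfl⟩
  exact ⟨z, φ, hφ, hz⟩

section

variable {X : Type*} [NormedAddCommGroup X] [NormedSpace ℝ X] [CompleteSpace X]
  [SecondCountableTopology X] [MeasurableSpace X] [BorelSpace X]

lemma integrable_norm_sq_clm {G : Type*} [SeminormedAddCommGroup G] [NormedSpace ℝ G]
    (μ : Measure X) [IsGaussian μ] (L : X →L[ℝ] G) : Integrable (fun x => ‖L x‖ ^ 2) μ := by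
  have h : Integrable (fun x : X => ‖x‖ ^ 2) μ := IsGaussian.memLp_two_id.integrable_norm_pow two_ne_zero
  refine (h.const_mul (‖L‖ ^ 2)).mono' (Continuous.aestronglyMeasurable (by fun_prop))
    (ae_of_all _ fun x => ?_)
  rw [Real.norm_of_nonneg (by positivity), ← mul_pow]
  gcongr
  exact L.le_opNorm x

/-- The distance to the span of the first n points of a dense sequence tends to zero pointwise, and
its square is dominated by ‖x‖², integrable for a Gaussian measure. -/
lemma exists_integral_norm_mkQL_sq_le (μ : Measure X) [IsGaussian μ] {ε : ℝ} (hε : 0 < ε) :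
    ∃ F : Submodule ℝ X, FiniteDimensional ℝ F ∧ ∫ x, ‖F.mkQL x‖ ^ 2 ∂μ ≤ ε := by
  let F : ℕ → Submodule ℝ X := fun n =>
    Submodule.span ℝ (TopologicalSpace.denseSeq X '' Set.Iio n)
  have hF : ∀ n, FiniteDimensional ℝ (F n) := fun n =>
    FiniteDimensional.span_of_finite ℝ ((Set.finite_Iio n).image _)
  have h0 : ∀ x : X, Tendsto (fun n => ‖(F n).mkQL x‖ ^ 2) atTop (𝓝 0) := by
    intro x
    have : Tendsto (fun n => ‖(F n).mkQL x‖) atTop (𝓝 0) := by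
      refine Metric.tendsto_atTop.2 fun r hr => ?_
      obtain ⟨k, hk⟩ := Metric.denseRange_iff.1 (TopologicalSpace.denseRange_denseSeq X) x r hr
      refine ⟨k + 1, fun n hn => ?_⟩
      rw [dist_zero_right, norm_norm, norm_mkQL_eq_infDist]
      have hmem : TopologicalSpace.denseSeq X k ∈ F n :=
        Submodule.subset_span ⟨k, Set.mem_Iio.2 (by omega), rfl⟩
      exact (Metric.infDist_le_dist_of_mem hmem).trans_lt hk
    simpa using this.pow 2
  have hlim := tendsto_integral_of_dominated_convergence (μ := μ) (fun x => ‖x‖ ^ 2)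
    (F := fun n x => ‖(F n).mkQL x‖ ^ 2) (f := fun _ => 0)
    (fun n => (integrable_norm_sq_clm μ (F n).mkQL).aestronglyMeasurable)
    (IsGaussian.memLp_two_id.integrable_norm_pow two_ne_zero)
    (fun n => ae_of_all _ fun x => ?_) (ae_of_all _ h0)
  · rw [integral_zero] at hlim
    obtain ⟨n, hn⟩ := (hlim.eventually_le_const hε).exists
    exact ⟨F n, hF n, hn⟩
  · rw [Real.norm_of_nonneg (by positivity)]
    gcongr
    rw [norm_mkQL_eq_infDist]
    simpa using Metric.infDist_le_dist_of_mem (x := x) (F n).zero_mem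

end

/-! ### Abstract Wiener spaces -/

section

variable {X H : Type*} [NormedAddCommGroup X] [NormedSpace ℝ X]
  [NormedAddCommGroup H] [InnerProductSpace ℝ H] [CompleteSpace H]

/-- The adjoint `X* → H` of the embedding `H → X`. -/
noncomputable def dualEmbedding (i : H →L[ℝ] X) : StrongDual ℝ X →ₗ[ℝ] H where
  toFun ℓ := (InnerProductSpace.toDual ℝ H).symm (ℓ.comp i)
  map_add' ℓ ℓ' := by
    rw [ContinuousLinearMap.add_comp, map_add]
  map_smul' c ℓ := by
    rw [ContinuousLinearMap.smul_comp, map_smulₛₗ]; rfl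

lemma inner_dualEmbedding (i : H →L[ℝ] X) (ℓ : StrongDual ℝ X) (h : H) :
    ⟪dualEmbedding i ℓ, h⟫ = ℓ (i h) :=
  InnerProductSpace.toDual_symm_apply

lemma dualEmbedding_comp {i : H →L[ℝ] X} {S : H →L[ℝ] H} {T : X →L[ℝ] X}
    (h : ∀ h, T (i h) = i (S h)) (ℓ : StrongDual ℝ X) :
    dualEmbedding i (ℓ.comp T) = S.adjoint (dualEmbedding i ℓ) := by
  refine ext_inner_right ℝ fun k => ?_
  rw [inner_dualEmbedding, ContinuousLinearMap.adjoint_inner_left, inner_dualEmbedding,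
    ContinuousLinearMap.comp_apply, h]

/-- The orthogonal complement of the range is the kernel of i, because X* separates the points of X.
-/
lemma dense_range_dualEmbedding {i : H →L[ℝ] X} (hi : Function.Injective i) :
    Dense (Set.range (dualEmbedding i)) := by
  have : Dense ((LinearMap.range (dualEmbedding i) : Submodule ℝ H) : Set H) := by
    rw [Submodule.dense_iff_topologicalClosure_eq_top, Submodule.topologicalClosure_eq_top_iff,
      Submodule.eq_bot_iff]
    intro h hh
    refine hi ?_
    rw [map_zero, SeparatingDual.eq_zero_iff_forall_dual_eq_zero (R := ℝ)]
    intro ℓ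
    rw [← inner_dualEmbedding]
    exact hh _ ⟨ℓ, rfl⟩
  rwa [LinearMap.coe_range] at this

end

section

variable {X H : Type*} [NormedAddCommGroup X] [NormedSpace ℝ X] [CompleteSpace X]
  [SecondCountableTopology X] [MeasurableSpace X] [BorelSpace X]
  [NormedAddCommGroup H] [InnerProductSpace ℝ H] [CompleteSpace H]
  {i : H →L[ℝ] X} {μ : Measure X}

set_option linter.unusedSectionVars false

namespace IsAbstractWienerSpace

lemma injective (hW : IsAbstractWienerSpace i μ) : Function.Injective i := by
  refine (injective_iff_map_eq_zero i).2 fun h hh => ?_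
  have := hW.norm_eq h
  rw [hh] at this
  have h0 : ‖h‖ₑ = 0 := by rw [← this]; simp [cameronMartinNorm]
  exact enorm_eq_zero.1 h0

/-- Homogeneity of the Cameron-Martin norm. The variance of ℓ may vanish, so ℓ is divided by a
number c > √v, which is then lowered to √v. -/
lemma abs_dual_le (hW : IsAbstractWienerSpace i μ) (ℓ : StrongDual ℝ X) (h : H) :
    |ℓ (i h)| ≤ ‖h‖ * √(∫ x, ℓ x ^ 2 ∂μ) := by
  have key : ∀ c > 0, ∫ x, ℓ x ^ 2 ∂μ ≤ c ^ 2 → |ℓ (i h)| ≤ ‖h‖ * c := by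
    intro c hc hv
    have h1 : ∫ x, ((c⁻¹ • ℓ) x) ^ 2 ∂μ ≤ 1 := by
      simp only [smul_apply, smul_eq_mul, mul_pow, integral_const_mul]
      rw [inv_pow, inv_mul_le_iff₀ (by positivity)]
      simpa using hv
    have h2 : ‖(c⁻¹ • ℓ) (i h)‖ₑ ≤ ‖h‖ₑ := by
      rw [← hW.norm_eq h]
      exact le_iSup₂ (f := fun (ℓ : StrongDual ℝ X) (_ : ∫ y, (ℓ y) ^ 2 ∂μ ≤ 1) => ‖ℓ (i h)‖ₑ)
        (c⁻¹ • ℓ) h1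
    rw [enorm_le_iff_norm_le] at h2
    rw [smul_apply, norm_smul, norm_inv, Real.norm_of_nonneg hc.le,
      inv_mul_le_iff₀ hc, Real.norm_eq_abs] at h2
    linarith
  set v := ∫ x, ℓ x ^ 2 ∂μ
  have hv0 : 0 ≤ v := integral_nonneg fun x => sq_nonneg _
  have hlim : Tendsto (fun ε : ℝ => ‖h‖ * (√v + ε)) (𝓝[>] 0) (𝓝 (‖h‖ * (√v + 0))) :=
    ((tendsto_const_nhds.add tendsto_id).const_mul _).mono_left nhdsWithin_le_nhds
  rw [add_zero] at hlim
  refine ge_of_tendsto hlim ?_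
  filter_upwards [self_mem_nhdsWithin] with ε hε
  have hε' : 0 < ε := hε
  refine key _ (by positivity) ?_
  nlinarith [Real.sq_sqrt hv0, Real.sqrt_nonneg v]

/-- The bound from above is `abs_dual_le` tested on the vector e itself. For the other direction,
the Bochner integral y of ℓ(x)x has Cameron-Martin norm at most √v, so y = i(h) with ‖h‖ ≤ √v; then
v = ℓ(y) = ⟪e, h⟫ ≤ ‖e‖ √v. -/
lemma norm_dualEmbedding_sq (hW : IsAbstractWienerSpace i μ) (ℓ : StrongDual ℝ X) :
    ‖dualEmbedding i ℓ‖ ^ 2 = ∫ x, ℓ x ^ 2 ∂μ := by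
  have := hW.isGaussian
  set v := ∫ x, ℓ x ^ 2 ∂μ with hv
  set e := dualEmbedding i ℓ with he
  have hv0 : 0 ≤ v := integral_nonneg fun x => sq_nonneg _
  have hle : ‖e‖ ≤ √v := by
    have h1 := hW.abs_dual_le ℓ e
    rw [← inner_dualEmbedding, ← he, real_inner_self_eq_norm_sq, abs_of_nonneg (sq_nonneg _),
      sq] at h1
    rcases (norm_nonneg e).eq_or_lt with h0 | h0
    · rw [← h0]; exact Real.sqrt_nonneg _
    · exact le_of_mul_le_mul_left h1 h0
  refine le_antisymm ((pow_le_pow_left₀ (norm_nonneg _) hle 2).trans_eq (Real.sq_sqrt hv0)) ?_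
  rcases hv0.eq_or_lt with h0 | h0
  · rw [← h0]; positivity
  have hc : 0 < √v := Real.sqrt_pos.2 h0
  have hint : Integrable (fun x => ℓ x • x) μ :=
    (IsGaussian.memLp_two_id (μ := μ)).smul (IsGaussian.memLp_dual μ ℓ 2 (by simp)) |>.integrable le_rfl
  set y := ∫ x, ℓ x • x ∂μ with hy
  have hyℓ : ∀ ℓ' : StrongDual ℝ X, ℓ' y = ∫ x, ℓ x * ℓ' x ∂μ := by
    intro ℓ'
    rw [hy, ← ContinuousLinearMap.integral_comp_comm ℓ' hint]
    simp
  have hcm : cameronMartinNorm μ y ≤ ENNReal.ofReal (√v) := by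
    refine iSup₂_le fun ℓ' hℓ' => ?_
    rw [Real.enorm_eq_ofReal_abs]
    refine ENNReal.ofReal_le_ofReal ?_
    rw [hyℓ]
    -- Weighted arithmetic-geometric mean inequality; after integration it plays the role of
    -- Cauchy-Schwarz.
    have hb : ∀ x, |ℓ x * ℓ' x| ≤ ℓ x ^ 2 / (2 * √v) + √v / 2 * ℓ' x ^ 2 := by
      intro x
      rw [abs_mul, ← sq_abs (ℓ x), ← sq_abs (ℓ' x)]
      have : |ℓ x| ^ 2 / (2 * √v) + √v / 2 * |ℓ' x| ^ 2 - |ℓ x| * |ℓ' x|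
          = (|ℓ x| - √v * |ℓ' x|) ^ 2 / (2 * √v) := by field_simp; ring
      have h2 : 0 ≤ (|ℓ x| - √v * |ℓ' x|) ^ 2 / (2 * √v) := by positivity
      linarith
    have hi1 := integrable_dual_sq μ ℓ
    have hi2 := integrable_dual_sq μ ℓ'
    calc |∫ x, ℓ x * ℓ' x ∂μ| ≤ ∫ x, |ℓ x * ℓ' x| ∂μ := abs_integral_le_integral_abs
      _ ≤ ∫ x, (ℓ x ^ 2 / (2 * √v) + √v / 2 * ℓ' x ^ 2) ∂μ :=
          integral_mono (integrable_dual_mul_dual μ ℓ ℓ').abs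
            ((hi1.div_const _).add (hi2.const_mul _)) hb
      _ = v / (2 * √v) + √v / 2 * ∫ x, ℓ' x ^ 2 ∂μ := by
          rw [integral_add (hi1.div_const _) (hi2.const_mul _), integral_div, integral_const_mul]
      _ ≤ v / (2 * √v) + √v / 2 * 1 := by gcongr
      _ = √v := by
          have := Real.mul_self_sqrt hv0
          field_simp
          nlinarith
  have hrange : y ∈ Set.range i := by
    rw [hW.range_eq]
    exact hcm.trans_lt ENNReal.ofReal_lt_top
  obtain ⟨h, hh⟩ := hrange
  have hnorm : ‖h‖ ≤ √v := by
    have h1 := hW.norm_eq h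
    rw [hh] at h1
    rw [h1, ← ofReal_norm] at hcm
    exact (ENNReal.ofReal_le_ofReal_iff hc.le).1 hcm
  have h1 : v = ⟪e, h⟫ := by
    rw [he, inner_dualEmbedding, hh, hyℓ, hv]
    simp_rw [sq]
  have h2 : v ≤ ‖e‖ * √v := h1.le.trans ((real_inner_le_norm _ _).trans (by gcongr))
  have h3 : √v ≤ ‖e‖ := by
    exact le_of_mul_le_mul_right ((Real.mul_self_sqrt hv0).le.trans h2) hc
  calc v = √v ^ 2 := (Real.sq_sqrt hv0).symm
    _ ≤ ‖e‖ ^ 2 := by gcongr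

lemma inner_dualEmbedding_dualEmbedding (hW : IsAbstractWienerSpace i μ)
    (ℓ ℓ' : StrongDual ℝ X) :
    ⟪dualEmbedding i ℓ, dualEmbedding i ℓ'⟫ = ∫ x, ℓ x * ℓ' x ∂μ := by
  have := hW.isGaussian
  have h1 := hW.norm_dualEmbedding_sq (ℓ + ℓ')
  rw [map_add, norm_add_sq_real, hW.norm_dualEmbedding_sq, hW.norm_dualEmbedding_sq] at h1
  have h2 : ∀ x, (ℓ + ℓ') x ^ 2 = ℓ x ^ 2 + ℓ' x ^ 2 + 2 * (ℓ x * ℓ' x) := by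
    intro x; simp; ring
  have i1 := integrable_dual_sq μ ℓ
  have i2 := integrable_dual_sq μ ℓ'
  simp_rw [h2] at h1
  have i3 : Integrable (fun x => ℓ x ^ 2 + ℓ' x ^ 2) μ := i1.add i2
  rw [integral_add i3 ((integrable_dual_mul_dual μ ℓ ℓ').const_mul _),
    integral_add i1 i2, integral_const_mul] at h1
  linarith

/-- Hahn-Banach reduces the bound to a functional g ∘ L with ‖g‖ ≤ 1. A seminormed target admits the
quotients X/F, for which this estimate yields compactness of the embedding. -/
lemma norm_clm_le (hW : IsAbstractWienerSpace i μ) {G : Type*} [SeminormedAddCommGroup G]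
    [NormedSpace ℝ G] (L : X →L[ℝ] G) (h : H) :
    ‖L (i h)‖ ≤ ‖h‖ * √(∫ x, ‖L x‖ ^ 2 ∂μ) := by
  have := hW.isGaussian
  obtain ⟨g, hg, hgL⟩ := exists_dual_vector'' ℝ (L (i h))
  have h1 := hW.abs_dual_le (g.comp L) h
  rw [ContinuousLinearMap.comp_apply, hgL] at h1
  simp only [RCLike.ofReal_real_eq_id, id, abs_norm] at h1
  refine h1.trans ?_
  gcongr
  · exact integrable_dual_sq μ _
  · exact integrable_norm_sq_clm μ L
  · intro x
    simp only
    rw [← sq_abs]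
    gcongr
    simpa using (g.le_of_opNorm_le hg (L x))

/-- The unit ball of the Cameron-Martin space is cut out by countably many functionals. -/
lemma exists_countable_dual (hW : IsAbstractWienerSpace i μ) :
    ∃ D : Set (StrongDual ℝ X), D.Countable ∧ (∀ ℓ ∈ D, ∫ x, ℓ x ^ 2 ∂μ ≤ 1) ∧
      ∀ y, (∀ ℓ ∈ D, |ℓ y| ≤ 1) → y ∈ i '' Metric.closedBall (0 : H) 1 := by
  -- Lindelöf: countably many of the open sets {|ℓ| > 1} already cover the complement of the ball.
  obtain ⟨D, hD1, hD2, hD3⟩ := TopologicalSpace.isOpen_biUnion_countable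
    {ℓ : StrongDual ℝ X | ∫ x, ℓ x ^ 2 ∂μ ≤ 1} (fun ℓ => {y | 1 < |ℓ y|})
    (fun ℓ _ => isOpen_lt continuous_const (by fun_prop))
  refine ⟨D, hD2, fun ℓ hℓ => hD1 hℓ, fun y hy => ?_⟩
  have hy' : y ∉ ⋃ ℓ ∈ D, {y | 1 < |ℓ y|} := by
    simpa using hy
  rw [hD3] at hy'
  have hcm : cameronMartinNorm μ y ≤ 1 := by
    refine iSup₂_le fun ℓ hℓ => ?_
    have : |ℓ y| ≤ 1 := by
      by_contra h
      exact hy' (Set.mem_biUnion (show ℓ ∈ {ℓ : StrongDual ℝ X | ∫ x, ℓ x ^ 2 ∂μ ≤ 1} from hℓ)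
        (not_le.1 h))
    rw [Real.enorm_eq_ofReal_abs]
    simpa using this
  have hrange : y ∈ Set.range i := by
    rw [hW.range_eq]
    exact hcm.trans_lt ENNReal.one_lt_top
  obtain ⟨h, rfl⟩ := hrange
  refine ⟨h, ?_, rfl⟩
  rw [hW.norm_eq, ← ofReal_norm, ENNReal.ofReal_le_one] at hcm
  simpa using hcm

/-- The embedding is compact. -/
lemma exists_subseq_tendsto_zero (hW : IsAbstractWienerSpace i μ) {k : ℕ → H} {M : ℝ}
    (hM : ∀ n, ‖k n‖ ≤ M) (hk : ∀ h : H, Tendsto (fun n => ⟪h, k n⟫) atTop (𝓝 0)) :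
    ∃ φ : ℕ → ℕ, StrictMono φ ∧ Tendsto (fun n => i (k (φ n))) atTop (𝓝 0) := by
  have := hW.isGaussian
  have hM0 : 0 ≤ M := (norm_nonneg _).trans (hM 0)
  have hF : ∀ ε > 0, ∃ F : Submodule ℝ X, FiniteDimensional ℝ F ∧
      ∀ᶠ n in atTop, ‖F.mkQL (i (k n))‖ ≤ ε := by
    intro ε hε
    obtain ⟨F, hF, hFε⟩ := exists_integral_norm_mkQL_sq_le μ
      (ε := (ε / (M + 1)) ^ 2) (by positivity)
    refine ⟨F, hF, Eventually.of_forall fun n => (hW.norm_clm_le F.mkQL (k n)).trans ?_⟩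
    have h1 : √(∫ x, ‖F.mkQL x‖ ^ 2 ∂μ) ≤ ε / (M + 1) := Real.sqrt_le_iff.2 ⟨by positivity, hFε⟩
    calc ‖k n‖ * √(∫ x, ‖F.mkQL x‖ ^ 2 ∂μ) ≤ (M + 1) * (ε / (M + 1)) := by
          gcongr
          linarith [hM n]
      _ = ε := by field_simp
  obtain ⟨z, φ, hφ, hz⟩ := exists_subseq_tendsto_of_norm_mkQL_le (y := fun n => i (k n))
    (M := ‖i‖ * M) (Eventually.of_forall fun n => (i.le_opNorm _).trans (by gcongr; exact hM n))
    hF id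
  refine ⟨φ, hφ, ?_⟩
  -- Weak convergence to zero in H identifies the limit through all functionals.
  have hz0 : z = 0 := by
    rw [SeparatingDual.eq_zero_iff_forall_dual_eq_zero (R := ℝ)]
    intro ℓ
    refine tendsto_nhds_unique ((ℓ.continuous.tendsto z).comp hz) ?_
    refine ((hk (dualEmbedding i ℓ)).comp hφ.tendsto_atTop).congr fun n => ?_
    simp [inner_dualEmbedding]
  simpa [hz0] using hz

/-- An operator whose restriction to the Cameron-Martin space is a coisometry preserves `μ`. -/
lemma map_eq_self (hW : IsAbstractWienerSpace i μ) {S : H →L[ℝ] H} {T : X →L[ℝ] X}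
    (hS : S ∘L S.adjoint = ContinuousLinearMap.id ℝ H) (hT : ∀ h, T (i h) = i (S h)) :
    μ.map T = μ := by
  have := hW.isGaussian
  have : IsGaussian (μ.map T) := inferInstance
  refine Measure.ext_of_charFunDual (funext fun ℓ => ?_)
  have hT0 : ∀ ℓ : StrongDual ℝ X, ∫ x, ℓ x ∂(μ.map T) = 0 := fun ℓ => by
    rw [integral_map (by fun_prop) (by fun_prop)]
    exact hW.centered (ℓ.comp T)
  rw [IsGaussian.charFunDual_eq_of_forall_strongDual_eq_zero hT0,
    IsGaussian.charFunDual_eq_of_forall_strongDual_eq_zero hW.centered,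
    variance_of_integral_eq_zero (by fun_prop) (hT0 ℓ),
    variance_of_integral_eq_zero (by fun_prop) (hW.centered ℓ),
    integral_map (by fun_prop) (by fun_prop)]
  -- Both measures are centered Gaussian, so only variances matter: the image of ℓ ∘ T in H is S*e,
  -- and S* is an isometry.
  have h1 := hW.norm_dualEmbedding_sq (ℓ.comp T)
  rw [dualEmbedding_comp hT, ← real_inner_self_eq_norm_sq,
    ContinuousLinearMap.adjoint_inner_left, ← ContinuousLinearMap.comp_apply, hS,
    ContinuousLinearMap.id_apply, real_inner_self_eq_norm_sq, hW.norm_dualEmbedding_sq] at h1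
  simp only [ContinuousLinearMap.comp_apply] at h1
  rw [h1]

end IsAbstractWienerSpace

end

/-! ### Almost sure upper bounds -/

/-- The Borel-Cantelli lemma for events whose probabilities decay like `n ^ (-p)`. -/
lemma ae_eventually_notMem_of_le_exp_log {Ω : Type*} [MeasurableSpace Ω] {μ : Measure Ω}
    [IsProbabilityMeasure μ] {A : ℕ → Set Ω} {C p : ℝ} (hp : 1 < p)
    (hA : ∀ n ≥ 1, μ.real (A n) ≤ C * Real.exp (-(p * Real.log n))) :
    ∀ᵐ ω ∂μ, ∀ᶠ n in atTop, ω ∉ A n := by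
  have hs : Summable fun n : ℕ => μ.real (A (n + 1)) := by
    have h1 : Summable fun n : ℕ => C * (((n + 1 : ℕ) : ℝ) ^ (-p)) :=
      ((summable_nat_add_iff 1).2 (Real.summable_nat_rpow.2 (by linarith))).mul_left C
    refine h1.of_nonneg_of_le (fun _ => measureReal_nonneg) fun n => ?_
    refine (hA (n + 1) (by omega)).trans_eq ?_
    rw [Real.rpow_def_of_pos (by positivity)]
    congr 2; ring
  have h2 : ∑' n, μ (A (n + 1)) ≠ ∞ := by
    have h3 := hs.tsum_ofReal_ne_top
    simpa [measureReal_def] using h3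
  filter_upwards [ae_eventually_notMem h2] with ω hω
  obtain ⟨N, hN⟩ := eventually_atTop.1 hω
  refine eventually_atTop.2 ⟨N + 1, fun n hn => ?_⟩
  obtain ⟨m, rfl⟩ : ∃ m, n = m + 1 := ⟨n - 1, by omega⟩
  exact hN m (by omega)

lemma exp_neg_mul_sq_sqrt_two_mul_log {n : ℕ} (hn : 1 ≤ n) (c : ℝ) :
    Real.exp (-(c * √(2 * Real.log n)) ^ 2 / 2) = Real.exp (-(c ^ 2 * Real.log n)) := by
  rw [mul_pow, Real.sq_sqrt (mul_nonneg two_pos.le (Real.log_nonneg (by exact_mod_cast hn)))]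
  congr 1; ring

/-! ### Gaussian tails of functionals and of seminorms, and relative compactness -/

section

variable {X : Type*} [NormedAddCommGroup X] [NormedSpace ℝ X] [MeasurableSpace X] [BorelSpace X]

lemma measureReal_le_dual_le {μ : Measure X} [IsGaussian μ]
    (hμ : ∀ ℓ : StrongDual ℝ X, ∫ x, ℓ x ∂μ = 0) {ℓ : StrongDual ℝ X} (hℓ : ∫ x, ℓ x ^ 2 ∂μ ≤ 1)
    {r : ℝ} (hr : 0 ≤ r) : μ.real {x | r ≤ ℓ x} ≤ Real.exp (-r ^ 2 / 2) := by
  have hmap := map_dual_eq_gaussianReal hμ ℓ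
  have hint : Integrable (fun x => Real.exp (r * ℓ x)) μ := by
    have h := integrable_exp_mul_gaussianReal (μ := 0) (v := (∫ x, ℓ x ^ 2 ∂μ).toNNReal) r
    rw [← hmap] at h
    exact h.comp_measurable ℓ.measurable
  refine (measure_ge_le_exp_mul_mgf r hr hint).trans ?_
  rw [mgf_gaussianReal hmap, ← Real.exp_add, Real.exp_le_exp,
    Real.coe_toNNReal _ (integral_nonneg fun x => sq_nonneg _)]
  nlinarith [sq_nonneg r, mul_le_mul_of_nonneg_right hℓ (sq_nonneg r)]

lemma measureReal_le_abs_dual_le {μ : Measure X} [IsGaussian μ]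
    (hμ : ∀ ℓ : StrongDual ℝ X, ∫ x, ℓ x ∂μ = 0) {ℓ : StrongDual ℝ X} (hℓ : ∫ x, ℓ x ^ 2 ∂μ ≤ 1)
    {r : ℝ} (hr : 0 ≤ r) : μ.real {x | r ≤ |ℓ x|} ≤ 2 * Real.exp (-r ^ 2 / 2) := by
  have h : {x | r ≤ |ℓ x|} = {x | r ≤ ℓ x} ∪ {x | r ≤ (-ℓ) x} := by
    ext x; simp [le_abs]
  rw [h, two_mul]
  refine (measureReal_union_le _ _).trans (add_le_add (measureReal_le_dual_le hμ hℓ hr)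
    (measureReal_le_dual_le hμ (ℓ := -ℓ) (by simpa using hℓ) hr))

/-- By invariance and the Gaussian tail the exceptional probabilities are at most 2 n^(-c²), which
is summable; no independence enters. -/
lemma ae_eventually_abs_dual_lt {μ : Measure X} [IsGaussian μ]
    (hμ : ∀ ℓ : StrongDual ℝ X, ∫ x, ℓ x ∂μ = 0) {U : ℕ → X →L[ℝ] X} (hU : ∀ n, μ.map (U n) = μ)
    {ℓ : StrongDual ℝ X} (hℓ : ∫ x, ℓ x ^ 2 ∂μ ≤ 1) {c : ℝ} (hc : 1 < c) :
    ∀ᵐ x ∂μ, ∀ᶠ n in atTop, |ℓ (U n x)| < c * √(2 * Real.log n) := by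
  have h := ae_eventually_notMem_of_le_exp_log (μ := μ) (C := 2) (p := c ^ 2)
    (A := fun n => {x | c * √(2 * Real.log n) ≤ |ℓ (U n x)|}) (by nlinarith) fun n hn => ?_
  · filter_upwards [h] with x hx
    filter_upwards [hx] with n hn
    exact not_le.1 hn
  · have h1 := measureReal_le_abs_dual_le hμ hℓ (r := c * √(2 * Real.log n)) (by positivity)
    rw [exp_neg_mul_sq_sqrt_two_mul_log hn] at h1
    refine le_trans (le_of_eq ?_) h1
    have hm : MeasurableSet {x | c * √(2 * Real.log n) ≤ |ℓ x|} :=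
      measurableSet_le measurable_const (by fun_prop)
    have h2 := measureReal_def (μ.map (U n)) {x | c * √(2 * Real.log n) ≤ |ℓ x|}
    rw [Measure.map_apply (U n).measurable hm, hU n] at h2
    rw [h2, measureReal_def]; rfl

/-- Fernique's inequality with explicit dependence on the scale `a`. -/
lemma exists_measureReal_lt_norm_clm_le :
    ∃ κ > 0, ∃ C : ℝ, ∀ {X G : Type*} [NormedAddCommGroup X] [NormedSpace ℝ X] [CompleteSpace X]
      [SecondCountableTopology X] [MeasurableSpace X] [BorelSpace X]
      [SeminormedAddCommGroup G] [NormedSpace ℝ G] [SecondCountableTopology G]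
      {μ : Measure X} [IsGaussian μ] (_ : ∀ ℓ : StrongDual ℝ X, ∫ x, ℓ x ∂μ = 0)
      (L : X →L[ℝ] G) {a : ℝ}, 0 < a → ∫ x, ‖L x‖ ^ 2 ∂μ ≤ a ^ 2 / 4 → ∀ r ≥ 0,
      μ.real {x | r ≤ ‖L x‖} ≤ C * Real.exp (-(κ * (r / a) ^ 2)) := by
  -- Fernique's argument needs a ball of measure above 1/2. Fixing the level 3/4 makes κ and C
  -- independent of the measure and of the operator.
  set c : ℝ≥0∞ := 3 / 4 with hc
  have hc1 : c.toReal = 3 / 4 := by simp [hc]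
  have hc_gt : 2⁻¹ < c := by
    rw [← ENNReal.toReal_lt_toReal (by simp) (by rw [hc]; finiteness), hc1]; norm_num
  have hc_lt : c < 1 := by
    rw [← ENNReal.toReal_lt_toReal (by rw [hc]; finiteness) (by simp), hc1]; norm_num
  have hc2 : (1 - c).toReal = 1 / 4 := by
    rw [ENNReal.toReal_sub_of_le hc_lt.le (by simp), hc1]; norm_num
  have hκ := Fernique.logRatio_pos hc_gt hc_lt
  set κ := Fernique.logRatio c
  set K : ℝ≥0∞ := .ofReal (Real.exp κ)
    + ∑' n, .ofReal (Real.exp (-2⁻¹ * Real.log (c / (1 - c)).toReal * 2 ^ n)) with hK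
  have hKtop : K ≠ ∞ := by
    refine (ENNReal.add_lt_top.mpr ⟨ENNReal.ofReal_lt_top, ?_⟩).ne
    refine Summable.tsum_ofReal_lt_top <|
      Real.summable_exp_nat_mul_of_ge ?_ (fun i ↦ mod_cast (Nat.lt_pow_self (by simp)).le)
    refine mul_neg_of_neg_of_pos (by simp) (Real.log_pos ?_)
    rw [ENNReal.toReal_div, hc1, hc2]; norm_num
  refine ⟨κ, hκ, K.toReal, ?_⟩
  intro X G _ _ _ _ _ _ _ _ _ μ _ hμ L a ha hL r hr
  let mG : MeasurableSpace G := borel G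
  have : BorelSpace G := ⟨rfl⟩
  have hLm : Measurable L := L.continuous.measurable
  have := Measure.isProbabilityMeasure_map (μ := μ) hLm.aemeasurable
  -- Rotation invariance of μ ⊗ μ passes to the image because rotations commute with L × L.
  have hrot : ((μ.map L).prod (μ.map L)).map (ContinuousLinearMap.rotation (-(Real.pi / 4)))
      = (μ.map L).prod (μ.map L) := by
    rw [Measure.map_prod_map _ _ hLm hLm, Measure.map_map (by fun_prop) (by fun_prop)]
    have : (ContinuousLinearMap.rotation (-(Real.pi / 4)) : G × G → G × G) ∘ Prod.map L L
        = Prod.map L L ∘ (ContinuousLinearMap.rotation (-(Real.pi / 4)) : X × X → X × X) := by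
      ext z <;> simp [ContinuousLinearMap.rotation_apply]
    rw [this, ← Measure.map_map (by fun_prop) (by fun_prop),
      IsGaussian.map_rotation_eq_self_of_forall_strongDual_eq_zero hμ]
  have hint := integrable_norm_sq_clm μ L
  -- Markov's inequality for ‖L x‖²: the mean is at most a²/4, so the ball of radius a misses at
  -- most 1/4 of the mass.
  have hca : c ≤ (μ.map L) {z | ‖z‖ ≤ a} := by
    have h1 := mul_meas_ge_le_integral_of_nonneg (ae_of_all μ fun x => sq_nonneg ‖L x‖) hint
      (a ^ 2)
    have h2 : μ.real {x | a ^ 2 ≤ ‖L x‖ ^ 2} ≤ 1 / 4 := by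
      have := h1.trans hL
      have h3 : 0 < a ^ 2 := by positivity
      nlinarith
    have h3 : μ.real {x | a ^ 2 ≤ ‖L x‖ ^ 2}ᶜ ≥ 3 / 4 := by
      rw [probReal_compl_eq_one_sub (measurableSet_le measurable_const (by fun_prop))]
      linarith
    rw [Measure.map_apply hLm (measurableSet_le (by fun_prop) measurable_const)]
    have h4 : {x | a ^ 2 ≤ ‖L x‖ ^ 2}ᶜ ⊆ L ⁻¹' {z | ‖z‖ ≤ a} := by
      intro x hx
      have h5 : ‖L x‖ ^ 2 < a ^ 2 := not_le.1 hx
      exact (abs_lt_of_sq_lt_sq h5 ha.le).le.trans' (le_abs_self _)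
    have h5 := h3.le.trans (measureReal_mono h4)
    rw [← ENNReal.toReal_le_toReal (by rw [hc]; finiteness) (measure_ne_top _ _), hc1]
    exact h5
  have hF := lintegral_exp_mul_sq_norm_le_of_map_rotation_eq_self hrot hca hc_gt
  rw [← hK, lintegral_map (by fun_prop) hLm] at hF
  have hmk := meas_ge_le_lintegral_div (μ := μ) (f := fun x => ENNReal.ofReal
    (Real.exp (κ * a⁻¹ ^ 2 * ‖L x‖ ^ 2))) (by fun_prop)
    (ε := ENNReal.ofReal (Real.exp (κ * (r / a) ^ 2)))
    (by simpa using Real.exp_pos _) ENNReal.ofReal_ne_top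
  have hsub : {x | r ≤ ‖L x‖} ⊆ {x | ENNReal.ofReal (Real.exp (κ * (r / a) ^ 2))
      ≤ ENNReal.ofReal (Real.exp (κ * a⁻¹ ^ 2 * ‖L x‖ ^ 2))} := by
    intro x hx
    have hx' : r ≤ ‖L x‖ := hx
    refine ENNReal.ofReal_le_ofReal (Real.exp_le_exp.2 ?_)
    rw [div_eq_mul_inv, mul_pow, mul_assoc]
    rw [mul_comm (r ^ 2)]
    gcongr
  have hfin := (measure_mono hsub).trans (hmk.trans (ENNReal.div_le_div_right hF _))
  have h6 := ENNReal.toReal_mono (ENNReal.div_ne_top hKtop (by simpa using Real.exp_pos _)) hfin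
  rw [ENNReal.toReal_div, ENNReal.toReal_ofReal (Real.exp_pos _).le] at h6
  rw [Real.exp_neg, ← div_eq_mul_inv]
  exact h6

variable [CompleteSpace X] [SecondCountableTopology X]

/-- A sequence of identically distributed Gaussian vectors, divided by `√(2 log n)`, is almost
surely relatively compact. -/
lemma ae_exists_subseq_tendsto {μ : Measure X} [IsGaussian μ]
    (hμ : ∀ ℓ : StrongDual ℝ X, ∫ x, ℓ x ∂μ = 0) {U : ℕ → X →L[ℝ] X}
    (hU : ∀ n, μ.map (U n) = μ) :
    ∀ᵐ x ∂μ, ∀ ψ : ℕ → ℕ, ∃ z, ∃ φ : ℕ → ℕ, StrictMono φ ∧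
      Tendsto (fun n => (√(2 * Real.log (ψ (φ n))))⁻¹ • U (ψ (φ n)) x) atTop (𝓝 z) := by
  obtain ⟨κ, hκ, C, hC⟩ := exists_measureReal_lt_norm_clm_le
  -- Fernique at scale a = ε√κ and radius r = ε√(2 log n) gives the exponent κ(r/a)² = 2 log n,
  -- hence summable probabilities of order n⁻².
  have key : ∀ {G : Type _} [SeminormedAddCommGroup G] [NormedSpace ℝ G]
      [SecondCountableTopology G] (L : X →L[ℝ] G) {ε : ℝ}, 0 < ε →
      ∫ x, ‖L x‖ ^ 2 ∂μ ≤ (ε * √κ) ^ 2 / 4 →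
      ∀ᵐ x ∂μ, ∀ᶠ n : ℕ in atTop, ‖L ((√(2 * Real.log n))⁻¹ • U n x)‖ ≤ ε := by
    intro G _ _ _ L ε hε hL
    have h := ae_eventually_notMem_of_le_exp_log (μ := μ) (C := C) (p := 2)
      (A := fun n => {x | ε * √(2 * Real.log n) ≤ ‖L (U n x)‖}) one_lt_two fun n hn => ?_
    · filter_upwards [h] with x hx
      filter_upwards [hx, eventually_ge_atTop 2] with n hn hn2
      have hs : 0 < √(2 * Real.log n) := Real.sqrt_pos.2 (mul_pos two_pos
        (Real.log_pos (by exact_mod_cast hn2)))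
      rw [map_smul, norm_smul, norm_inv, Real.norm_of_nonneg hs.le, inv_mul_le_iff₀ hs, mul_comm]
      exact (not_le.1 hn).le
    · have h1 := hC hμ L (by positivity) hL (ε * √(2 * Real.log n)) (by positivity)
      have h2 : κ * (ε * √(2 * Real.log n) / (ε * √κ)) ^ 2 = 2 * Real.log n := by
        rw [mul_div_mul_left _ _ hε.ne', div_pow, Real.sq_sqrt hκ.le, Real.sq_sqrt (mul_nonneg
          two_pos.le (Real.log_nonneg (by exact_mod_cast hn)))]
        field_simp
      rw [h2] at h1
      refine le_trans (le_of_eq ?_) h1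
      have hm : MeasurableSet {x | ε * √(2 * Real.log n) ≤ ‖L x‖} :=
        measurableSet_le measurable_const (L.continuous.norm.measurable)
      have h2 := measureReal_def (μ.map (U n)) {x | ε * √(2 * Real.log n) ≤ ‖L x‖}
      rw [Measure.map_apply (U n).measurable hm, hU n] at h2
      rw [h2, measureReal_def]; rfl
  have hbdd : ∃ M : ℝ, ∀ᵐ x ∂μ, ∀ᶠ n : ℕ in atTop, ‖(√(2 * Real.log n))⁻¹ • U n x‖ ≤ M := by
    set v := ∫ x : X, ‖x‖ ^ 2 ∂μ
    have hv : 0 ≤ v := integral_nonneg fun x => by positivity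
    -- For this radius the variance condition of `key` reads v ≤ (v+4)²/4.
    refine ⟨(v + 4) / √κ, key (ContinuousLinearMap.id ℝ X) (by positivity) ?_⟩
    rw [div_mul_cancel₀ _ (Real.sqrt_pos.2 hκ).ne']
    simp only [ContinuousLinearMap.id_apply]
    change v ≤ _
    nlinarith
  obtain ⟨M, hM⟩ := hbdd
  have happrox : ∀ m : ℕ, ∃ F : Submodule ℝ X, FiniteDimensional ℝ F ∧ ∀ᵐ x ∂μ,
      ∀ᶠ n : ℕ in atTop, ‖F.mkQL ((√(2 * Real.log n))⁻¹ • U n x)‖ ≤ 1 / ((m : ℝ) + 1) := by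
    intro m
    obtain ⟨F, hF, hFε⟩ := exists_integral_norm_mkQL_sq_le μ
      (ε := (1 / ((m : ℝ) + 1) * √κ) ^ 2 / 4) (by positivity)
    have : TopologicalSpace.SeparableSpace (X ⧸ F) :=
      (F.mkQ_surjective.denseRange).separableSpace F.mkQL.continuous
    have : SecondCountableTopology (X ⧸ F) := UniformSpace.secondCountable_of_separable _
    exact ⟨F, hF, key F.mkQL (by positivity) hFε⟩
  choose F hF hFx using happrox
  filter_upwards [hM, ae_all_iff.2 hFx] with x hx1 hx2 ψ
  refine exists_subseq_tendsto_of_norm_mkQL_le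
    (y := fun n => (√(2 * Real.log n))⁻¹ • U n x) hx1 (fun ε hε => ?_) ψ
  obtain ⟨m, hm⟩ := exists_nat_one_div_lt hε
  exact ⟨F m, hF m, (hx2 m).mono fun n hn => hn.trans hm.le⟩

end

/-! ### Strongly continuous semigroups -/

section

variable {X : Type*} [NormedAddCommGroup X] [NormedSpace ℝ X]

lemma IsStronglyContinuousSemigroup.map_zero {T : ℝ≥0 → X →L[ℝ] X}
    (hT : IsStronglyContinuousSemigroup T) : T 0 = ContinuousLinearMap.id ℝ X := by
  ext x
  refine tendsto_nhds_unique (((T 0).continuous.tendsto x).comp (hT.tendsto_zero x)) ?_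
  refine (hT.tendsto_zero x).congr fun t => ?_
  have := hT.map_add 0 t
  rw [zero_add] at this
  exact DFunLike.congr_fun this x

lemma IsStronglyContinuousSemigroup.tendsto_nhds_zero {T : ℝ≥0 → X →L[ℝ] X}
    (hT : IsStronglyContinuousSemigroup T) (x : X) : Tendsto (fun t => T t x) (𝓝 0) (𝓝 x) := by
  have h1 : Tendsto (fun t => T t x) (pure 0) (𝓝 x) := by
    refine tendsto_pure_left.2 fun s hs => ?_
    rw [hT.map_zero]; exact mem_of_mem_nhds hs
  have h2 := (hT.tendsto_zero x).sup h1
  have h3 : 𝓝 (0 : ℝ≥0) = 𝓝[>] 0 ⊔ pure 0 := by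
    have : (Set.univ : Set ℝ≥0) = insert 0 (Set.Ioi 0) := by
      ext t; simp
    rw [← nhdsWithin_univ, this, nhdsWithin_insert, sup_comm]
  rwa [h3]

/-- Otherwise there would be times tending to zero with norms tending to infinity, against
Banach-Steinhaus along that sequence. -/
lemma IsStronglyContinuousSemigroup.exists_norm_le [CompleteSpace X] {T : ℝ≥0 → X →L[ℝ] X}
    (hT : IsStronglyContinuousSemigroup T) : ∃ C, ∃ η > 0, ∀ r ≤ η, ‖T r‖ ≤ C := by
  by_contra! h
  have h0 : ∀ n : ℕ, (0 : ℝ≥0) < 1 / ((n : ℝ≥0) + 1) := fun n => by positivity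
  choose r hr hr' using fun n : ℕ => h n _ (h0 n)
  have hr0 : Tendsto r atTop (𝓝 0) :=
    tendsto_of_tendsto_of_tendsto_of_le_of_le tendsto_const_nhds
      tendsto_one_div_add_atTop_nhds_zero_nat (fun _ => zero_le) hr
  obtain ⟨C, hC⟩ := banach_steinhaus (g := fun n => T (r n)) fun x => by
    have := (((hT.tendsto_nhds_zero x).comp hr0).norm).bddAbove_range
    obtain ⟨C, hC⟩ := this
    exact ⟨C, fun n => hC ⟨n, rfl⟩⟩
  obtain ⟨n, hn⟩ := exists_nat_gt C
  exact absurd ((hr' n).trans_le (hC n)) (not_lt.2 hn.le)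

end

/-- A constant factor in time does not affect the normalisation; this pays both for refining the
time grid and for subsampling. -/
lemma tendsto_sqrt_log_const_mul_div {b : ℝ} (hb : 0 < b) :
    Tendsto (fun t : ℝ => √(2 * Real.log (b * t)) / √(2 * Real.log t)) atTop (𝓝 1) := by
  have h1 : Tendsto (fun t : ℝ => √(Real.log b / Real.log t + 1)) atTop (𝓝 (√(0 + 1))) :=
    (Real.continuous_sqrt.tendsto _).comp
      ((Real.tendsto_log_atTop.const_div_atTop _).add_const 1)
  rw [zero_add, Real.sqrt_one] at h1
  refine h1.congr' ?_
  filter_upwards [eventually_gt_atTop 1] with t ht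
  have hl := Real.log_pos ht
  rw [← Real.sqrt_div' _ (by positivity), Real.log_mul hb.ne' (by positivity),
    mul_div_mul_left _ _ two_ne_zero, add_div, div_self hl.ne']

/-! ### Almost sure bounds for the stationary process, from above and from below -/

section

variable {X H : Type*} [NormedAddCommGroup X] [NormedSpace ℝ X] [CompleteSpace X]
  [SecondCountableTopology X] [MeasurableSpace X] [BorelSpace X]
  [NormedAddCommGroup H] [InnerProductSpace ℝ H] [CompleteSpace H]
  {i : H →L[ℝ] X} {μ : Measure X}

set_option linter.unusedSectionVars false

namespace IsAbstractWienerSpace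

/-- Functionals, grid meshes and tolerances are countable, so one null set suffices. Given times t_k
with limit y, the operator T(r_k) carries the process to the next grid time. As r_k is at most the
mesh, T(r_k) is uniformly bounded and moves y little, so ℓ(y) is controlled by the value of ℓ at
grid times. -/
lemma ae_clusterPointsAtInfinity_subset (hW : IsAbstractWienerSpace i μ) {T : ℝ≥0 → X →L[ℝ] X}
    (hT : IsStronglyContinuousSemigroup T) (hTμ : ∀ t, μ.map (T t) = μ) :
    ∀ᵐ x ∂μ, clusterPointsAtInfinity (fun t : ℝ≥0 => (√(2 * Real.log t))⁻¹ • T t x)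
      ⊆ i '' Metric.closedBall (0 : H) 1 := by
  have := hW.isGaussian
  obtain ⟨D, hDc, hD, hDball⟩ := hW.exists_countable_dual
  obtain ⟨C, η, hη, hC⟩ := hT.exists_norm_le
  have hae : ∀ᵐ x ∂μ, ∀ ℓ ∈ D, ∀ m j : ℕ, ∀ᶠ n : ℕ in atTop,
      |ℓ (T ((n : ℝ≥0) / ((m : ℝ≥0) + 1)) x)| < (1 + 1 / ((j : ℝ) + 1)) * √(2 * Real.log n) := by
    refine (ae_ball_iff hDc).2 fun ℓ hℓ => ae_all_iff.2 fun m => ae_all_iff.2 fun j => ?_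
    have hj : (0 : ℝ) < 1 / ((j : ℝ) + 1) := by positivity
    exact ae_eventually_abs_dual_lt hW.centered
      (U := fun n : ℕ => T ((n : ℝ≥0) / ((m : ℝ≥0) + 1))) (fun n => hTμ _) (hD ℓ hℓ) (by linarith)
  filter_upwards [hae] with x hx
  rintro y ⟨t, -, ht, hy⟩
  refine hDball y fun ℓ hℓ => le_of_forall_pos_le_add fun θ hθ => ?_
  have hC0 : 0 ≤ C := (norm_nonneg _).trans (hC 0 zero_le)
  -- choose a fine grid
  set θ' := θ / (2 * (‖ℓ‖ + 1)) with hθ'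
  have hθ'0 : 0 < θ' := by positivity
  obtain ⟨ρ, hρ, hρy⟩ := Metric.eventually_nhds_iff.1
    (Metric.tendsto_nhds.1 (hT.tendsto_nhds_zero y) θ' hθ'0)
  obtain ⟨m, hm⟩ := exists_nat_one_div_lt (lt_min (show (0 : ℝ) < η from hη) hρ)
  obtain ⟨j, hj⟩ := exists_nat_one_div_lt (half_pos hθ)
  set b : ℝ≥0 := (m : ℝ≥0) + 1 with hb
  have hb0 : 0 < b := by positivity
  have hb1 : 1 ≤ b := le_add_of_nonneg_left zero_le
  have hbr : (b : ℝ) = (m : ℝ) + 1 := by simp [hb]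
  -- Rounding is upward because the semigroup can only be run forward in time.
  let n : ℕ → ℕ := fun k => ⌊t k * b⌋₊ + 1
  have hn1 : ∀ k, t k * b ≤ n k := fun k => by
    have := (Nat.lt_floor_add_one (t k * b)).le
    simpa [n] using this
  have hn2 : ∀ k, (n k : ℝ≥0) ≤ t k * b + 1 := fun k => by
    have := Nat.floor_le (zero_le (a := t k * b))
    simpa [n] using this
  have hnt : Tendsto n atTop atTop := by
    have h1 : Tendsto (fun k => (n k : ℝ≥0)) atTop atTop :=
      tendsto_atTop_mono (fun k => (le_mul_of_one_le_right zero_le hb1).trans (hn1 k)) ht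
    exact tendsto_natCast_atTop_iff.1 h1
  have htn : ∀ k, t k ≤ (n k : ℝ≥0) / b := fun k => by
    rw [le_div_iff₀ hb0]; exact hn1 k
  let r : ℕ → ℝ≥0 := fun k => (n k : ℝ≥0) / b - t k
  have hr : ∀ k, (n k : ℝ≥0) / b = r k + t k := fun k => (tsub_add_cancel_of_le (htn k)).symm
  have hrb : ∀ k, r k ≤ 1 / b := fun k => by
    rw [tsub_le_iff_right, div_le_iff₀ hb0, add_mul, one_div, inv_mul_cancel₀ hb0.ne', add_comm]
    exact hn2 k
  have hrb' : ∀ k, (r k : ℝ) < min (η : ℝ) ρ := fun k => by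
    refine lt_of_le_of_lt ?_ hm
    have : (r k : ℝ) ≤ ((1 / b : ℝ≥0) : ℝ) := NNReal.coe_le_coe.2 (hrb k)
    simpa [hbr] using this
  have hrη : ∀ k, r k ≤ η := fun k => NNReal.coe_le_coe.1 ((hrb' k).le.trans (min_le_left _ _))
  have hrρ : ∀ k, dist (T (r k) y) y < θ' := fun k => hρy (by
    rw [NNReal.dist_eq]
    simpa using (hrb' k).trans_le (min_le_right _ _))
  set Y : ℕ → X := fun k => (√(2 * Real.log (t k)))⁻¹ • T (t k) x with hY
  have htr : Tendsto (fun k => (t k : ℝ)) atTop atTop := NNReal.tendsto_coe_atTop.2 ht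
  have hlim : Tendsto (fun k => (1 + θ / 2)
      * (√(2 * Real.log ((b + 1 : ℝ) * t k)) / √(2 * Real.log (t k)))
      + ‖ℓ‖ * (C * dist (Y k) y + θ')) atTop (𝓝 ((1 + θ / 2) * 1 + ‖ℓ‖ * (C * 0 + θ'))) := by
    refine (((tendsto_sqrt_log_const_mul_div (by positivity)).comp htr).const_mul _).add
      ((((tendsto_iff_dist_tendsto_zero.1 hy).const_mul C).add_const θ').const_mul _)
  have hle : |ℓ y| ≤ (1 + θ / 2) * 1 + ‖ℓ‖ * (C * 0 + θ') := by
    refine ge_of_tendsto hlim ?_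
    filter_upwards [hnt.eventually (hx ℓ hℓ m j), htr.eventually_gt_atTop 1] with k hk htk
    have hs : 0 < √(2 * Real.log (t k)) := Real.sqrt_pos.2 (mul_pos two_pos (Real.log_pos htk))
    have h1 : T (r k) (Y k) = (√(2 * Real.log (t k)))⁻¹ • T ((n k : ℝ≥0) / b) x := by
      rw [hr k, hT.map_add, hY, map_smul]; rfl
    have h2 : |ℓ (T (r k) (Y k))|
        ≤ (1 + θ / 2) * (√(2 * Real.log ((b + 1 : ℝ) * t k)) / √(2 * Real.log (t k))) := by
      rw [h1, map_smul, smul_eq_mul, abs_mul, abs_inv, abs_of_pos hs, inv_mul_eq_div,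
        ← mul_div_assoc]
      refine div_le_div_of_nonneg_right (hk.le.trans ?_) hs.le
      -- The rounding error 1 is absorbed by t_k > 1.
      have hnk : (n k : ℝ) ≤ (b + 1 : ℝ) * t k := by
        have h3 : (n k : ℝ) ≤ t k * b + 1 := by exact_mod_cast hn2 k
        nlinarith
      have hnk0 : (0 : ℝ) < n k := by
        have : 0 < n k := Nat.succ_pos _
        exact_mod_cast this
      gcongr
    have h3 : dist (T (r k) (Y k)) y ≤ C * dist (Y k) y + θ' := by
      refine (dist_triangle _ (T (r k) y) _).trans (add_le_add ?_ (hrρ k).le)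
      rw [dist_eq_norm, ← map_sub, dist_eq_norm]
      exact (T (r k)).le_of_opNorm_le (hC _ (hrη k)) _
    have h4 : |ℓ y| ≤ |ℓ (T (r k) (Y k))| + ‖ℓ‖ * dist (T (r k) (Y k)) y := by
      have h5 : |ℓ (T (r k) (Y k)) - ℓ y| ≤ ‖ℓ‖ * dist (T (r k) (Y k)) y := by
        rw [← map_sub, dist_eq_norm]
        exact ℓ.le_opNorm _
      have h6 := abs_sub_abs_le_abs_sub (ℓ y) (ℓ (T (r k) (Y k)))
      rw [abs_sub_comm] at h6
      linarith
    refine h4.trans (add_le_add h2 ?_)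
    gcongr
  refine hle.trans ?_
  have : ‖ℓ‖ * θ' ≤ θ / 2 := by
    rw [hθ', mul_div_assoc', div_le_div_iff₀ (by positivity) two_pos]
    nlinarith [norm_nonneg ℓ]
  linarith

/-- This is the autocovariance of the stationary process ℓ(T_t x), which the mixing hypothesis sends
to zero. -/
lemma integral_dual_mul_dual_comp (hW : IsAbstractWienerSpace i μ) {S : H →L[ℝ] H}
    {T : X →L[ℝ] X} (hTi : ∀ h, T (i h) = i (S h)) (ℓ : StrongDual ℝ X) :
    ∫ x, ℓ (T x) * ℓ x ∂μ = ⟪S (dualEmbedding i ℓ), dualEmbedding i ℓ⟫ := by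
  have h := hW.inner_dualEmbedding_dualEmbedding (ℓ.comp T) ℓ
  rw [dualEmbedding_comp hTi, ContinuousLinearMap.adjoint_inner_left, real_inner_comm] at h
  exact h.symm

/-- No zero-one law is used: failure is shown to have probability at most ε' for every small ε'.
Sampling at multiples of a large N makes all covariances at most δ, so the bound on the maximum of n
variables applies. -/
lemma ae_frequently_le_dual (hW : IsAbstractWienerSpace i μ) {S : ℝ≥0 → H →L[ℝ] H}
    {T : ℝ≥0 → X →L[ℝ] X} (hT : IsStronglyContinuousSemigroup T) (hTμ : ∀ t, μ.map (T t) = μ)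
    (hS : ∀ x y : H, Tendsto (fun t => ⟪S t x, y⟫) atTop (𝓝 0))
    (hTi : ∀ t h, T t (i h) = i (S t h)) {ℓ : StrongDual ℝ X} (hℓ : ∫ x, ℓ x ^ 2 ∂μ = 1)
    {ε : ℝ} (hε : 0 < ε) (hε1 : ε < 1) :
    ∀ᵐ x ∂μ, ∃ᶠ n : ℕ in atTop, (1 - ε) * √(2 * Real.log n) ≤ ℓ (T n x) := by
  have := hW.isGaussian
  have hpres : ∀ t (g : X → ℝ), Continuous g → ∫ x, g (T t x) ∂μ = ∫ x, g x ∂μ := by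
    intro t g hg
    rw [← integral_map (by fun_prop) hg.aestronglyMeasurable, hTμ]
  have key : ∀ ε' : ℝ, 0 < ε' → ε' < ε →
      μ {x | ¬ ∃ᶠ n : ℕ in atTop, (1 - ε) * √(2 * Real.log n) ≤ ℓ (T n x)}
        ≤ ENNReal.ofReal ε' := by
    intro ε' hε' hεε'
    obtain ⟨δ, hδ, n₀, hn₀⟩ := exists_forall_measureReal_forall_lt_le hε' (hεε'.trans hε1)
    have hev := (hS (dualEmbedding i ℓ) (dualEmbedding i ℓ)).eventually_le_const hδ
    obtain ⟨s, hs⟩ := eventually_atTop.1 hev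
    obtain ⟨N', hN'⟩ := exists_nat_ge s
    set N := N' + 1 with hN
    have hNs : s ≤ N := hN'.trans (by exact_mod_cast Nat.le_succ _)
    let B : ℕ → Set X := fun n =>
      {x | ∀ k : Fin n, ℓ (T ((((k : ℕ) + 1) * N : ℕ) : ℝ≥0) x) < (1 - ε') * √(2 * Real.log n)}
    have hcov : ∀ k l : ℕ, k < l → ∫ x, ℓ (T (((k + 1) * N : ℕ) : ℝ≥0) x)
        * ℓ (T (((l + 1) * N : ℕ) : ℝ≥0) x) ∂μ ≤ δ := by
      intro k l hkl
      obtain ⟨d, rfl⟩ : ∃ d, l = k + (d + 1) := ⟨l - k - 1, by omega⟩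
      have e1 : (((k + (d + 1) + 1) * N : ℕ) : ℝ≥0) = (((d + 1) * N : ℕ) : ℝ≥0)
          + (((k + 1) * N : ℕ) : ℝ≥0) := by push_cast; ring
      -- Stationarity reduces the covariance to one at the time lag (d+1)N, which is at least s.
      have h1 := hpres (((k + 1) * N : ℕ) : ℝ≥0)
        (fun z => ℓ (T (((d + 1) * N : ℕ) : ℝ≥0) z) * ℓ z) (by fun_prop)
      rw [hW.integral_dual_mul_dual_comp (hTi _)] at h1
      have h2 : s ≤ (((d + 1) * N : ℕ) : ℝ≥0) := by
        refine hNs.trans ?_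
        push_cast
        exact le_mul_of_one_le_left zero_le (le_add_of_nonneg_left zero_le)
      refine le_trans (le_of_eq ?_) (h1.le.trans (hs _ h2))
      congr 1; ext x
      rw [e1, hT.map_add, mul_comm]; rfl
    have hB : ∀ n ≥ n₀, μ (B n) ≤ ENNReal.ofReal ε' := by
      intro n hn
      have h := hn₀ (Fin n) (by simpa using hn) hW.centered
        (fun k => ℓ.comp (T ((((k : ℕ) + 1) * N : ℕ) : ℝ≥0))) ?_ ?_
      · rw [← ENNReal.ofReal_toReal (measure_ne_top μ (B n))]
        refine ENNReal.ofReal_le_ofReal (le_trans (le_of_eq ?_) h)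
        simp [B, measureReal_def]
      · intro k
        have h1 := hpres ((((k : ℕ) + 1) * N : ℕ) : ℝ≥0) (fun z => ℓ z ^ 2) (by fun_prop)
        rw [hℓ] at h1
        simpa [sq] using h1
      · intro k l hkl
        rcases lt_or_gt_of_ne hkl with h1 | h1
        · exact hcov k l h1
        · simpa [mul_comm] using hcov l k h1
    -- If the bound fails from time M on, then x lies in B n for all large n. Sampled times before M
    -- contribute a fixed bound b; later ones are at most Nn, and the gap between ε' and ε absorbs
    -- the passage from log(Nn) to log n.
    have hsub : {x | ¬ ∃ᶠ n : ℕ in atTop, (1 - ε) * √(2 * Real.log n) ≤ ℓ (T n x)}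
        ⊆ ⋃ m, ⋂ n ≥ m, B n := by
      intro x hx
      simp only [Set.mem_ofPred_eq, not_frequently, not_le] at hx
      obtain ⟨M, hM⟩ := eventually_atTop.1 hx
      obtain ⟨b, hb⟩ := ((Set.finite_Iio M).image fun m : ℕ => ℓ (T m x)).bddAbove
      have hb' : ∀ m < M, ℓ (T m x) ≤ b := fun m hm => hb ⟨m, hm, rfl⟩
      have h1 : ∀ᶠ n : ℕ in atTop, b < (1 - ε') * √(2 * Real.log n) :=
        (tendsto_sqrt_two_mul_log.const_mul_atTop (by linarith)).eventually_gt_atTop b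
      have h2 : ∀ᶠ n : ℕ in atTop, (1 - ε) * (√(2 * Real.log (N * n)) / √(2 * Real.log n))
          < 1 - ε' := by
        have hNpos : (0 : ℝ) < N := by rw [hN]; positivity
        have := ((tendsto_sqrt_log_const_mul_div hNpos).comp
          tendsto_natCast_atTop_atTop).const_mul (1 - ε)
        exact this.eventually_lt_const (by linarith)
      obtain ⟨m, hm⟩ := eventually_atTop.1 ((h1.and h2).and (eventually_ge_atTop 2))
      refine Set.mem_iUnion.2 ⟨m, Set.mem_iInter₂.2 fun n hn k => ?_⟩
      obtain ⟨⟨h1, h2⟩, h3⟩ := hm n hn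
      have hs : 0 < √(2 * Real.log n) := Real.sqrt_pos.2 (mul_pos two_pos
        (Real.log_pos (by exact_mod_cast h3)))
      by_cases hk : ((k : ℕ) + 1) * N < M
      · exact (hb' _ hk).trans_lt h1
      · refine (hM _ (not_lt.1 hk)).trans ?_
        rw [← mul_div_assoc, div_lt_iff₀ hs] at h2
        refine lt_of_le_of_lt ?_ h2
        have hpos : (0 : ℝ) < ((((k : ℕ) + 1) * N : ℕ) : ℝ) := by
          rw [hN]; positivity
        have hle : ((((k : ℕ) + 1) * N : ℕ) : ℝ) ≤ N * n := by
          rw [mul_comm]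
          exact_mod_cast Nat.mul_le_mul_left N k.2
        have : 0 ≤ 1 - ε := by linarith
        gcongr
    refine (measure_mono hsub).trans ?_
    -- The lower limit of the B n is an increasing union, each term of which lies in some B n with n
    -- ≥ n₀.
    have hmono : Monotone fun m => ⋂ n ≥ m, B n := fun m m' hmm' =>
      Set.biInter_subset_biInter_left fun n hn => le_trans hmm' hn
    rw [hmono.measure_iUnion]
    exact iSup_le fun m => (measure_mono (Set.biInter_subset_of_mem (le_max_left m n₀))).trans
      (hB _ (le_max_right m n₀))
  refine le_antisymm (le_of_forall_gt_imp_ge_of_dense fun a ha => ?_) zero_le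
  by_cases hatop : a = ∞
  · rw [hatop]; exact le_top
  have ha' : 0 < a.toReal := ENNReal.toReal_pos ha.ne' hatop
  refine (key (min (ε / 2) a.toReal) (by positivity)
    ((min_le_left _ _).trans_lt (by linarith))).trans ?_
  refine (ENNReal.ofReal_le_ofReal (min_le_right _ _)).trans_eq (ENNReal.ofReal_toReal hatop)

end IsAbstractWienerSpace

end

/-! ### The functional law of the iterated logarithm -/

section

variable {X H : Type*} [NormedAddCommGroup X] [NormedSpace ℝ X] [CompleteSpace X]
  [SecondCountableTopology X] [MeasurableSpace X] [BorelSpace X]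
  [NormedAddCommGroup H] [InnerProductSpace ℝ H] [CompleteSpace H]
  {i : H →L[ℝ] X} {μ : Measure X}

set_option linter.unusedSectionVars false

namespace IsAbstractWienerSpace

lemma sphere_subset_closure (hW : IsAbstractWienerSpace i μ) :
    Metric.sphere (0 : H) 1 ⊆ closure (dualEmbedding i '' {ℓ | ∫ x, ℓ x ^ 2 ∂μ = 1}) := by
  intro h hh
  have hn : ‖h‖ = 1 := by simpa using hh
  obtain ⟨e, he, hlim⟩ := mem_closure_iff_seq_limit.1 (dense_range_dualEmbedding hW.injective h)
  have hlim' : Tendsto (fun n => ‖e n‖⁻¹ • e n) atTop (𝓝 (‖h‖⁻¹ • h)) :=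
    (hlim.norm.inv₀ (by rw [hn]; exact one_ne_zero)).smul hlim
  rw [hn, inv_one, one_smul] at hlim'
  refine mem_closure_of_tendsto hlim' ?_
  filter_upwards [hlim.norm.eventually_ne (show ‖h‖ ≠ 0 by rw [hn]; exact one_ne_zero)] with n hne
  obtain ⟨ℓ, hℓ⟩ := he n
  refine ⟨‖e n‖⁻¹ • ℓ, ?_, by rw [map_smul, hℓ]⟩
  rw [Set.mem_ofPred_eq, ← hW.norm_dualEmbedding_sq, map_smul, hℓ, norm_smul, norm_inv, norm_norm,
    inv_mul_cancel₀ hne, one_pow]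

/-- For a unit vector k, the vectors S_n* k have norm one and tend weakly to zero; by compactness of
i a subsequence tends to zero in X. Adding √(1-‖h‖²) times these to h pushes the norm to 1 without
changing the limit in X, so the sphere is dense in the ball for the norm of X. -/
lemma image_closedBall_subset_closure [Nontrivial H] (hW : IsAbstractWienerSpace i μ)
    {S : ℝ≥0 → H →L[ℝ] H}
    (hS : ∀ t, S t ∘L ContinuousLinearMap.adjoint (S t) = ContinuousLinearMap.id ℝ H)
    (hS0 : ∀ x y : H, Tendsto (fun t => ⟪S t x, y⟫) atTop (𝓝 0)) :
    i '' Metric.closedBall (0 : H) 1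
      ⊆ closure (i '' (dualEmbedding i '' {ℓ | ∫ x, ℓ x ^ 2 ∂μ = 1})) := by
  rintro _ ⟨h, hh, rfl⟩
  have hh' : ‖h‖ ≤ 1 := by simpa using hh
  obtain ⟨k, hk⟩ := exists_norm_eq H (zero_le_one (α := ℝ))
  let κ : ℕ → H := fun n => ContinuousLinearMap.adjoint (S n) k
  have hκ : ∀ n, ‖κ n‖ ^ 2 = 1 := fun n => by
    rw [← real_inner_self_eq_norm_sq, ContinuousLinearMap.adjoint_inner_left,
      ← ContinuousLinearMap.comp_apply, hS, ContinuousLinearMap.id_apply,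
      real_inner_self_eq_norm_sq, hk, one_pow]
  have hκ0 : ∀ y : H, Tendsto (fun n => ⟪y, κ n⟫) atTop (𝓝 0) := fun y => by
    simp only [κ, ContinuousLinearMap.adjoint_inner_right]
    exact (hS0 y k).comp tendsto_natCast_atTop_atTop
  obtain ⟨φ, hφ, hlim⟩ := hW.exists_subseq_tendsto_zero (M := 1)
    (fun n => (pow_le_one_iff_of_nonneg (norm_nonneg _) two_ne_zero).1 (hκ n).le) hκ0
  set c := √(1 - ‖h‖ ^ 2) with hc
  have hc2 : c ^ 2 = 1 - ‖h‖ ^ 2 :=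
    Real.sq_sqrt (sub_nonneg.2 (pow_le_one₀ (norm_nonneg _) hh'))
  let v : ℕ → H := fun n => h + c • κ (φ n)
  have hv : Tendsto (fun n => ‖v n‖) atTop (𝓝 1) := by
    have h1 : ∀ n, ‖v n‖ ^ 2 = 1 + 2 * (c * ⟪h, κ (φ n)⟫) := fun n => by
      rw [norm_add_sq_real, inner_smul_right, norm_smul, mul_pow, hκ, Real.norm_eq_abs, sq_abs,
        hc2]
      ring
    have h2 : Tendsto (fun n => √(1 + 2 * (c * ⟪h, κ (φ n)⟫))) atTop
        (𝓝 (√(1 + 2 * (c * 0)))) :=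
      (Real.continuous_sqrt.tendsto _).comp
        (((((hκ0 h).comp hφ.tendsto_atTop).const_mul c).const_mul 2).const_add 1)
    simp only [mul_zero, add_zero, Real.sqrt_one] at h2
    refine h2.congr fun n => ?_
    rw [← h1, Real.sqrt_sq (norm_nonneg _)]
  have hw : Tendsto (fun n => i (‖v n‖⁻¹ • v n)) atTop (𝓝 ((1 : ℝ)⁻¹ • (i h + c • 0))) := by
    simp only [v, map_smul, map_add]
    exact (hv.inv₀ one_ne_zero).smul ((hlim.const_smul c).const_add (i h))
  simp only [inv_one, smul_zero, add_zero, one_smul] at hw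
  rw [← closure_closure]
  refine mem_closure_of_tendsto hw ?_
  filter_upwards [hv.eventually_ne one_ne_zero] with n hn
  refine image_closure_subset_closure_image i.continuous
    (Set.mem_image_of_mem i (hW.sphere_subset_closure ?_))
  rw [mem_sphere_zero_iff_norm, norm_smul, norm_inv, norm_norm, inv_mul_cancel₀ hn]

/-- Compactness along times at which ℓ is nearly maximal yields a cluster point i(h) with ‖h‖ ≤ 1
and ℓ(i h) ≥ 1. As the image e of ℓ has norm one, equality in Cauchy-Schwarz forces h = e. -/
lemma ae_dualEmbedding_mem_clusterPointsAtInfinity (hW : IsAbstractWienerSpace i μ)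
    {S : ℝ≥0 → H →L[ℝ] H} {T : ℝ≥0 → X →L[ℝ] X} (hT : IsStronglyContinuousSemigroup T)
    (hTμ : ∀ t, μ.map (T t) = μ)
    (hS : ∀ x y : H, Tendsto (fun t => ⟪S t x, y⟫) atTop (𝓝 0))
    (hTi : ∀ t h, T t (i h) = i (S t h)) {ℓ : StrongDual ℝ X} (hℓ : ∫ x, ℓ x ^ 2 ∂μ = 1) :
    ∀ᵐ x ∂μ, i (dualEmbedding i ℓ)
      ∈ clusterPointsAtInfinity (fun t : ℝ≥0 => (√(2 * Real.log t))⁻¹ • T t x) := by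
  have := hW.isGaussian
  have hfreq : ∀ᵐ x ∂μ, ∀ j : ℕ, ∃ᶠ n : ℕ in atTop,
      (1 - 1 / ((j : ℝ) + 2)) * √(2 * Real.log n) ≤ ℓ (T n x) :=
    ae_all_iff.2 fun j => hW.ae_frequently_le_dual hT hTμ hS hTi hℓ (by positivity)
      ((div_lt_one (by positivity)).2 (by linarith [(j.cast_nonneg : (0 : ℝ) ≤ j)]))
  filter_upwards [hfreq, hW.ae_clusterPointsAtInfinity_subset hT hTμ,
    ae_exists_subseq_tendsto hW.centered (U := fun n : ℕ => T n) (fun n => hTμ n)]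
    with x hx hsub hcpt
  -- The offset 2 keeps the logarithm positive, and ψ(j) ≥ j makes the times diverge.
  choose ψ hψ hψℓ using fun j => (frequently_atTop.1 (hx j)) (j + 2)
  obtain ⟨z, φ, hφ, hz⟩ := hcpt ψ
  have hψt : Tendsto (fun n => ψ (φ n)) atTop atTop :=
    (tendsto_atTop_mono (fun j => (Nat.le_add_right j 2).trans (hψ j)) tendsto_id).comp
      hφ.tendsto_atTop
  have hzc : z ∈ clusterPointsAtInfinity (fun t : ℝ≥0 => (√(2 * Real.log t))⁻¹ • T t x) := by
    refine mem_clusterPointsAtInfinity_iff.2 (hz.mapClusterPt.of_comp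
      (φ := fun n => (ψ (φ n) : ℝ≥0)) (tendsto_natCast_atTop_atTop.comp hψt))
  obtain ⟨h, hh, rfl⟩ := hsub hzc
  have hh' : ‖h‖ ≤ 1 := by simpa using hh
  have hℓz : 1 ≤ ℓ (i h) := by
    have h1 : Tendsto (fun n => 1 - 1 / ((φ n : ℝ) + 2)) atTop (𝓝 (1 - 0)) :=
      ((tendsto_const_nhds.div_atTop (tendsto_atTop_add_const_right _ _
        (tendsto_natCast_atTop_atTop.comp hφ.tendsto_atTop)))).const_sub 1
    rw [sub_zero] at h1
    refine le_of_tendsto_of_tendsto' h1 ((ℓ.continuous.tendsto _).comp hz) fun n => ?_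
    have h2 : 0 < √(2 * Real.log (ψ (φ n))) := Real.sqrt_pos.2 (mul_pos two_pos (Real.log_pos (by
      have := hψ (φ n)
      exact_mod_cast (by omega : 1 < ψ (φ n)))))
    rw [Function.comp_apply, map_smul, smul_eq_mul, inv_mul_eq_div, le_div_iff₀ h2]
    exact hψℓ (φ n)
  have he := hW.norm_dualEmbedding_sq ℓ
  rw [hℓ] at he
  -- ‖e - h‖² = 1 - 2ℓ(i h) + ‖h‖² ≤ 0.
  have hheq : dualEmbedding i ℓ = h := by
    rw [← sub_eq_zero, ← norm_eq_zero, ← sq_eq_zero_iff]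
    refine le_antisymm ?_ (sq_nonneg _)
    rw [norm_sub_sq_real, inner_dualEmbedding, he]
    nlinarith [norm_nonneg h]
  rwa [hheq]

/-- The functional law of the iterated logarithm for semigroups. -/
theorem ae_clusterPointsAtInfinity_eq (hW : IsAbstractWienerSpace i μ)
    {S : ℝ≥0 → H →L[ℝ] H} {T : ℝ≥0 → X →L[ℝ] X}
    (hS : ∀ t, S t ∘L ContinuousLinearMap.adjoint (S t) = ContinuousLinearMap.id ℝ H)
    (hS0 : ∀ x y : H, Tendsto (fun t => ⟪S t x, y⟫) atTop (𝓝 0))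
    (hT : IsStronglyContinuousSemigroup T) (hTi : ∀ t h, T t (i h) = i (S t h)) :
    ∀ᵐ x ∂μ, clusterPointsAtInfinity (fun t : ℝ≥0 => (√(2 * Real.log t))⁻¹ • T t x)
      = i '' Metric.closedBall (0 : H) 1 := by
  have := hW.isGaussian
  have hTμ : ∀ t, μ.map (T t) = μ := fun t => hW.map_eq_self (hS t) (hTi t)
  -- If H = 0 there is no functional of unit variance; compactness supplies a cluster point, which
  -- must then be zero.
  rcases subsingleton_or_nontrivial H with hH | hH
  · filter_upwards [hW.ae_clusterPointsAtInfinity_subset hT hTμ,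
      ae_exists_subseq_tendsto hW.centered (U := fun n : ℕ => T n) (fun n => hTμ n)] with x h1 h2
    refine h1.antisymm ?_
    obtain ⟨z, φ, hφ, hz⟩ := h2 id
    have hzc : z ∈ clusterPointsAtInfinity (fun t : ℝ≥0 => (√(2 * Real.log t))⁻¹ • T t x) :=
      mem_clusterPointsAtInfinity_iff.2 (hz.mapClusterPt.of_comp
        (φ := fun n => (φ n : ℝ≥0)) (tendsto_natCast_atTop_atTop.comp hφ.tendsto_atTop))
    rintro _ ⟨h, -, rfl⟩
    obtain ⟨h', -, rfl⟩ := h1 hzc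
    rwa [Subsingleton.elim h h']
  -- A countable dense family leaves a single null set, and closedness of the cluster set recovers
  -- the rest.
  obtain ⟨D, hD, hDc, hDd⟩ := (TopologicalSpace.IsSeparable.of_separableSpace
    (i '' (dualEmbedding i '' {ℓ | ∫ x, ℓ x ^ 2 ∂μ = 1}))).exists_countable_dense_subset
  have hae : ∀ᵐ x ∂μ, ∀ y ∈ D, y
      ∈ clusterPointsAtInfinity (fun t : ℝ≥0 => (√(2 * Real.log t))⁻¹ • T t x) := by
    refine (ae_ball_iff hDc).2 fun y hy => ?_
    obtain ⟨_, ⟨ℓ, hℓ, rfl⟩, rfl⟩ := hD hy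
    exact hW.ae_dualEmbedding_mem_clusterPointsAtInfinity hT hTμ hS0 hTi hℓ
  filter_upwards [hae, hW.ae_clusterPointsAtInfinity_subset hT hTμ] with x hx hsub
  refine hsub.antisymm ((hW.image_closedBall_subset_closure hS hS0).trans ?_)
  exact closure_minimal (hDd.trans (closure_minimal hx (isClosed_clusterPointsAtInfinity _)))
    (isClosed_clusterPointsAtInfinity _)

/-- The functional law of the iterated logarithm for multiplicative semigroups. -/
theorem ae_clusterPointsAtZero_eq (hW : IsAbstractWienerSpace i μ)
    {R : Set.Ioc (0 : ℝ) 1 → H →L[ℝ] H} {Q : Set.Ioc (0 : ℝ) 1 → X →L[ℝ] X}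
    (hR : ∀ ε, R ε ∘L ContinuousLinearMap.adjoint (R ε) = ContinuousLinearMap.id ℝ H)
    (hR0 : ∀ x y : H, Tendsto (fun ε => ⟪R ε x, y⟫) (comap Subtype.val (𝓝 (0 : ℝ))) (𝓝 0))
    (hQ : IsStronglyContinuousMulSemigroup Q) (hQi : ∀ ε h, Q ε (i h) = i (R ε h)) :
    ∀ᵐ x ∂μ, clusterPointsAtZero
        (fun ε : Set.Ioc (0 : ℝ) 1 => (√(2 * Real.log (Real.log (1 / (ε : ℝ)))))⁻¹ • Q ε x)
      = i '' Metric.closedBall (0 : H) 1 := by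
  have hT : IsStronglyContinuousSemigroup fun t => Q (expNeg t) := by
    refine ⟨fun t u => by rw [expNeg_add, hQ.map_mul], fun x => (hQ.tendsto_one x).comp ?_⟩
    have h0 : expNeg 0 = 1 := by ext; simp [expNeg]
    have hc : Continuous expNeg := by
      refine Continuous.subtype_mk ?_ _
      fun_prop
    refine tendsto_nhdsWithin_iff.2 ⟨?_, ?_⟩
    · have := hc.tendsto 0
      rw [h0] at this
      exact this.mono_left nhdsWithin_le_nhds
    · filter_upwards [self_mem_nhdsWithin] with t ht
      rw [← h0]
      exact strictAnti_expNeg ht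
  have h := hW.ae_clusterPointsAtInfinity_eq (S := fun t => R (expNeg t))
    (T := fun t => Q (expNeg t)) (fun t => hR _)
    (fun x y => (hR0 x y).comp (tendsto_comap_iff.2 (tendsto_coe_expNeg_comp_iff.2 tendsto_id)))
    hT (fun t => hQi _)
  filter_upwards [h] with x hx
  rw [clusterPointsAtZero_eq, ← hx]
  congr 1
  ext1 t
  have : Real.log (1 / (expNeg t : ℝ)) = t := by
    change Real.log (1 / Real.exp (-t)) = t
    rw [one_div, ← Real.exp_neg, neg_neg, Real.log_exp]
  rw [this]

end IsAbstractWienerSpace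

end

/-! ### Construction of abstract Wiener spaces and of their coisometries -/

section

variable {X H : Type*} [NormedAddCommGroup X] [NormedSpace ℝ X] [CompleteSpace X]
  [SecondCountableTopology X] [MeasurableSpace X] [BorelSpace X]
  [NormedAddCommGroup H] [InnerProductSpace ℝ H] [CompleteSpace H]
  {i : H →L[ℝ] X} {μ : Measure X}

set_option linter.unusedSectionVars false

/-- By invariance ℓ ∘ T has the same variance as ℓ, so it competes in the supremum for x. -/
lemma cameronMartinNorm_map_le {T : X →L[ℝ] X} (hT : μ.map T = μ) (x : X) :
    cameronMartinNorm μ (T x) ≤ cameronMartinNorm μ x := by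
  refine iSup₂_le fun ℓ hℓ => le_iSup₂_of_le (ℓ.comp T) ?_ le_rfl
  rw [← hT, integral_map (by fun_prop) (Continuous.aestronglyMeasurable (by fun_prop))] at hℓ
  exact hℓ

/-- An operator which preserves `μ` restricts to a coisometry of the Cameron-Martin space. -/
lemma IsAbstractWienerSpace.exists_coisometry (hW : IsAbstractWienerSpace i μ) {T : X →L[ℝ] X}
    (hT : μ.map T = μ) : ∃ S : H →L[ℝ] H, (∀ h, T (i h) = i (S h)) ∧
      S ∘L ContinuousLinearMap.adjoint S = ContinuousLinearMap.id ℝ H := by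
  have hex : ∀ h, ∃ k, i k = T (i h) := fun h => by
    have h1 : T (i h) ∈ {x | cameronMartinNorm μ x < ∞} := by
      refine (cameronMartinNorm_map_le hT _).trans_lt ?_
      rw [hW.norm_eq]
      exact enorm_lt_top
    rwa [← hW.range_eq] at h1
  choose S hS using hex
  let S' : H →ₗ[ℝ] H :=
    { toFun := S
      map_add' := fun h k => hW.injective (by simp [hS])
      map_smul' := fun c h => hW.injective (by simp [hS]) }
  have hS' : ∀ h, ‖S' h‖ ≤ 1 * ‖h‖ := fun h => by
    have h1 := cameronMartinNorm_map_le hT (i h)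
    rw [← hS, hW.norm_eq, hW.norm_eq, enorm_le_iff_norm_le] at h1
    rwa [one_mul]
  have hTi : ∀ h, T (i h) = i (S'.mkContinuous 1 hS' h) := fun h => (hS h).symm
  refine ⟨S'.mkContinuous 1 hS', hTi, ?_⟩
  set R := S'.mkContinuous 1 hS'
  -- The adjoint sends the image of ℓ to that of ℓ ∘ T, which has the same variance; density of
  -- these images does the rest.
  have h1 : ∀ x, ‖ContinuousLinearMap.adjoint R x‖ = ‖x‖ := by
    intro x
    refine (dense_range_dualEmbedding hW.injective).induction
      (P := fun x => ‖ContinuousLinearMap.adjoint R x‖ = ‖x‖) ?_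
      (isClosed_eq (by fun_prop) (by fun_prop)) x
    rintro _ ⟨ℓ, rfl⟩
    rw [← dualEmbedding_comp hTi, ← sq_eq_sq₀ (norm_nonneg _) (norm_nonneg _),
      hW.norm_dualEmbedding_sq, hW.norm_dualEmbedding_sq]
    conv_rhs => rw [← hT]
    rw [integral_map (by fun_prop) (Continuous.aestronglyMeasurable (by fun_prop))]
    rfl
  have h2 := (ContinuousLinearMap.norm_map_iff_adjoint_comp_self _).1 h1
  rwa [ContinuousLinearMap.adjoint_adjoint] at h2

lemma integral_dual_sq_of_map_eq_gaussianReal {v : ℝ≥0} {ℓ : StrongDual ℝ X}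
    (h : μ.map ℓ = gaussianReal 0 v) : ∫ x, ℓ x ∂μ = 0 ∧ ∫ x, ℓ x ^ 2 ∂μ = v := by
  have h1 : ∫ x, ℓ x ∂μ = ∫ y, y ∂(μ.map ℓ) :=
    by
    rw [integral_map (by fun_prop) (Continuous.aestronglyMeasurable (by fun_prop))]
  have h2 : ∫ x, ℓ x ^ 2 ∂μ = ∫ y, y ^ 2 ∂(μ.map ℓ) :=
    by
    rw [integral_map (by fun_prop) (Continuous.aestronglyMeasurable (by fun_prop))]
  have h3 : ∫ y, y ∂(gaussianReal 0 v) = 0 := integral_id_gaussianReal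
  have h4 := variance_of_integral_eq_zero (X := id) (μ := gaussianReal 0 v) (by fun_prop) h3
  rw [variance_id_gaussianReal] at h4
  rw [h1, h2, h]
  exact ⟨h3, h4.symm⟩

/-- A centered Gaussian measure with the covariance of an injective operator `i : H → X` makes
`i` an abstract Wiener space. -/
theorem isAbstractWienerSpace_of_map_eq_gaussianReal (hi : Function.Injective i)
    (hμ : ∀ ℓ : StrongDual ℝ X, μ.map ℓ = gaussianReal 0 (‖dualEmbedding i ℓ‖₊ ^ 2)) :
    IsAbstractWienerSpace i μ := by
  have hV : ∀ ℓ : StrongDual ℝ X, ∫ x, ℓ x ^ 2 ∂μ = ‖dualEmbedding i ℓ‖ ^ 2 := fun ℓ => by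
    rw [(integral_dual_sq_of_map_eq_gaussianReal (hμ ℓ)).2]; simp
  have hdense := dense_range_dualEmbedding hi
  have hle : ∀ x, cameronMartinNorm μ x < ∞ → ∀ ℓ : StrongDual ℝ X,
      ‖ℓ x‖ ≤ (cameronMartinNorm μ x).toReal * ‖dualEmbedding i ℓ‖ := by
    intro x hx ℓ
    have hlim : Tendsto (fun c : ℝ => (cameronMartinNorm μ x).toReal * c)
        (𝓝[>] ‖dualEmbedding i ℓ‖) (𝓝 ((cameronMartinNorm μ x).toReal * ‖dualEmbedding i ℓ‖)) :=
      (tendsto_id.const_mul _).mono_left nhdsWithin_le_nhds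
    refine ge_of_tendsto hlim ?_
    filter_upwards [self_mem_nhdsWithin] with c hc
    have hc0 : 0 < c := (norm_nonneg _).trans_lt hc
    have h1 : ∫ y, ((c⁻¹ • ℓ) y) ^ 2 ∂μ ≤ 1 := by
      rw [hV, map_smul, norm_smul, norm_inv, Real.norm_of_nonneg hc0.le]
      refine pow_le_one₀ (by positivity) ?_
      rw [inv_mul_le_one₀ hc0]
      exact le_of_lt hc
    have h2 : ‖(c⁻¹ • ℓ) x‖ₑ ≤ cameronMartinNorm μ x :=
      le_iSup₂ (f := fun (ℓ : StrongDual ℝ X) (_ : ∫ y, (ℓ y) ^ 2 ∂μ ≤ 1) => ‖ℓ x‖ₑ) (c⁻¹ • ℓ) h1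
    have h3 := ENNReal.toReal_mono hx.ne h2
    rw [toReal_enorm, smul_apply, norm_smul, norm_inv, Real.norm_of_nonneg hc0.le,
      inv_mul_le_iff₀ hc0] at h3
    linarith
  have hnorm : ∀ h : H, cameronMartinNorm μ (i h) = ‖h‖ₑ := by
    intro h
    have hup : cameronMartinNorm μ (i h) ≤ ‖h‖ₑ := by
      refine iSup₂_le fun ℓ hℓ => ?_
      rw [enorm_le_iff_norm_le, ← inner_dualEmbedding]
      rw [hV] at hℓ
      have : ‖dualEmbedding i ℓ‖ ≤ 1 := (pow_le_one_iff_of_nonneg (norm_nonneg _) two_ne_zero).1 hℓ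
      exact (norm_inner_le_norm _ _).trans (mul_le_of_le_one_left (norm_nonneg _) this)
    have hfin : cameronMartinNorm μ (i h) < ∞ := hup.trans_lt enorm_lt_top
    refine hup.antisymm ?_
    have h1 : ∀ k : H, ‖⟪k, h⟫‖ ≤ (cameronMartinNorm μ (i h)).toReal * ‖k‖ := by
      intro k
      refine hdense.induction (P := fun k => ‖⟪k, h⟫‖ ≤ (cameronMartinNorm μ (i h)).toReal * ‖k‖)
        ?_ (isClosed_le (by fun_prop) (by fun_prop)) k
      rintro _ ⟨ℓ, rfl⟩
      rw [inner_dualEmbedding]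
      exact hle _ hfin ℓ
    have h2 : ‖h‖ ≤ (cameronMartinNorm μ (i h)).toReal := by
      rcases (norm_nonneg h).eq_or_lt with h0 | h0
      · rw [← h0]; exact ENNReal.toReal_nonneg
      · have := h1 h
        rw [real_inner_self_eq_norm_sq, norm_pow, norm_norm, sq] at this
        exact le_of_mul_le_mul_right this h0
    rw [← ofReal_norm]
    exact ENNReal.ofReal_le_of_le_toReal h2
  refine ⟨isGaussian_of_map_eq_gaussianReal fun ℓ => ⟨_, _, hμ ℓ⟩,
    fun ℓ => (integral_dual_sq_of_map_eq_gaussianReal (hμ ℓ)).1, ?_, hnorm⟩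
  ext x
  constructor
  · rintro ⟨h, rfl⟩
    rw [Set.mem_ofPred_eq, hnorm]
    exact enorm_lt_top
  · intro hx
    -- A point x of finite Cameron-Martin norm makes ℓ ↦ ℓ(x) bounded in the norm of the images of ℓ
    -- in H. It extends to H by density, and its Riesz representative is the preimage of x.
    let f : StrongDual ℝ X →ₗ[ℝ] ℝ :=
      { toFun := fun ℓ => ℓ x
        map_add' := fun _ _ => rfl
        map_smul' := fun _ _ => rfl }
    let F : H →L[ℝ] ℝ := f.extendOfNorm (dualEmbedding i)
    have hF : ∀ ℓ, F (dualEmbedding i ℓ) = ℓ x :=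
      fun ℓ => f.extendOfNorm_eq hdense ⟨_, hle x hx⟩ ℓ
    refine ⟨(InnerProductSpace.toDual ℝ H).symm F, ?_⟩
    rw [← sub_eq_zero, SeparatingDual.eq_zero_iff_forall_dual_eq_zero (R := ℝ)]
    intro ℓ
    rw [map_sub, ← hF, ← inner_dualEmbedding, real_inner_comm, InnerProductSpace.toDual_symm_apply,
      sub_self]

end

/-! ### Laws on `C[0,1]` -/

section

variable {H : Type*} [NormedAddCommGroup H] [InnerProductSpace ℝ H]

/-- The operator `h ↦ (u ↦ ⟪χ u, h⟫)` from `H` to `C[0,1]`. -/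
noncomputable def innerCLM (χ : C(unitInterval, H)) : H →L[ℝ] C(unitInterval, ℝ) :=
  LinearMap.mkContinuous
    { toFun := fun h => ⟨fun u => ⟪χ u, h⟫, by fun_prop⟩
      map_add' := fun h k => by ext u; simp [inner_add_right]
      map_smul' := fun c h => by ext u; simp [inner_smul_right] } ‖χ‖ fun h => by
    refine (ContinuousMap.norm_le _ (by positivity)).2 fun u => ?_
    exact (norm_inner_le_norm _ _).trans (by gcongr; exact χ.norm_coe_le_norm u)

@[simp] lemma innerCLM_apply (χ : C(unitInterval, H)) (h : H) (u : unitInterval) :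
    innerCLM χ h u = ⟪χ u, h⟫ := rfl

lemma norm_innerCLM_apply_le (χ : C(unitInterval, H)) (h : H) : ‖innerCLM χ h‖ ≤ ‖χ‖ * ‖h‖ := by
  refine (ContinuousMap.norm_le _ (by positivity)).2 fun u => ?_
  exact (norm_inner_le_norm _ _).trans (by gcongr; exact χ.norm_coe_le_norm u)

/-- Bernstein polynomials reduce a functional on C[0,1] to finite combinations of point evaluations,
with no need for representing measures. -/
lemma dual_bernsteinApproximation (ℓ : StrongDual ℝ C(unitInterval, ℝ)) (n : ℕ)
    (f : C(unitInterval, ℝ)) : ℓ (bernsteinApproximation n f)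
      = ∑ k : Fin (n + 1), ℓ (bernstein n k) * f (bernstein.z k) := by
  have : bernsteinApproximation n f
      = ∑ k : Fin (n + 1), f (bernstein.z k) • bernstein n k := by
    ext u
    simp [bernsteinApproximation.apply, mul_comm]
  simp [this, mul_comm]

variable [CompleteSpace H]

lemma norm_dualEmbedding_innerCLM_sub_le (χ ξ : C(unitInterval, H))
    (ℓ : StrongDual ℝ C(unitInterval, ℝ)) :
    ‖dualEmbedding (innerCLM χ) ℓ - dualEmbedding (innerCLM ξ) ℓ‖ ≤ ‖ℓ‖ * ‖χ - ξ‖ := by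
  set v := dualEmbedding (innerCLM χ) ℓ - dualEmbedding (innerCLM ξ) ℓ with hv
  have h1 : ‖v‖ ^ 2 = ℓ (innerCLM (χ - ξ) v) := by
    rw [← real_inner_self_eq_norm_sq]
    conv_lhs => rw [hv, inner_sub_left, ← hv, inner_dualEmbedding, inner_dualEmbedding, ← map_sub]
    congr 1
    ext u
    simp [inner_sub_left]
  have h2 : ‖v‖ ^ 2 ≤ ‖ℓ‖ * (‖χ - ξ‖ * ‖v‖) := by
    rw [h1]
    exact (le_abs_self _).trans ((ℓ.le_opNorm _).trans
      (by gcongr; exact norm_innerCLM_apply_le _ _))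
  rcases (norm_nonneg v).eq_or_lt with h0 | h0
  · rw [← h0]; positivity
  · rw [sq, ← mul_assoc] at h2
    exact le_of_mul_le_mul_right h2 h0

lemma dualEmbedding_innerCLM_bernsteinApproximation (χ : C(unitInterval, H))
    (ℓ : StrongDual ℝ C(unitInterval, ℝ)) (n : ℕ) :
    dualEmbedding (innerCLM (bernsteinApproximation n χ)) ℓ
      = ∑ k : Fin (n + 1), ℓ (bernstein n k) • χ (bernstein.z k) := by
  refine ext_inner_right ℝ fun h => ?_
  have : innerCLM (bernsteinApproximation n χ) h = bernsteinApproximation n (innerCLM χ h) := by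
    ext u
    simp [bernsteinApproximation.apply, sum_inner, inner_smul_left]
  rw [inner_dualEmbedding, this, dual_bernsteinApproximation, sum_inner]
  simp [inner_smul_left]

lemma tendsto_sum_bernstein_smul (χ : C(unitInterval, H)) (ℓ : StrongDual ℝ C(unitInterval, ℝ)) :
    Tendsto (fun n : ℕ => ∑ k : Fin (n + 1), ℓ (bernstein n k) • χ (bernstein.z k)) atTop
      (𝓝 (dualEmbedding (innerCLM χ) ℓ)) := by
  rw [tendsto_iff_norm_sub_tendsto_zero]
  have h := (tendsto_iff_norm_sub_tendsto_zero.1 (bernsteinApproximation_uniform χ)).const_mul ‖ℓ‖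
  rw [mul_zero] at h
  refine squeeze_zero (fun _ => norm_nonneg _) (fun n => ?_) h
  rw [← dualEmbedding_innerCLM_bernsteinApproximation]
  exact norm_dualEmbedding_innerCLM_sub_le _ _ _

end

section

variable {H : Type*} [NormedAddCommGroup H] [InnerProductSpace ℝ H]
  {χ : C(unitInterval, H)} {Ω : Type*} [MeasurableSpace Ω] {P : Measure Ω} {B : ℝ≥0 → Ω → ℝ}

/-- The curve χ has the covariance min(u, v) of Brownian motion, so both variances are the same
double sum. -/
lemma map_sum_mul_eq_gaussianReal (hχ : ∀ u v, ⟪χ u, χ v⟫ = min (u : ℝ) v)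
    (hB : IsPreBrownianReal B P) {ι : Type*} [Fintype ι] (a : ι → ℝ) (u : ι → unitInterval) :
    P.map (fun ω => ∑ k, a k * B (unitInterval.toNNReal (u k)) ω)
      = gaussianReal 0 (‖∑ k, a k • χ (u k)‖₊ ^ 2) := by
  have hlaw : HasGaussianLaw (fun ω => ∑ k, a k * B (unitInterval.toNNReal (u k)) ω) P :=
    ((hB.isGaussianProcess.comp_right fun k => (unitInterval.toNNReal (u k))).smul a).hasGaussianLaw_fun_sum
      (I := Finset.univ)
  have := hlaw.isProbabilityMeasure
  have hint : ∀ k, MemLp (fun ω => a k * B (unitInterval.toNNReal (u k)) ω) 2 P := fun k =>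
    (hB.isGaussianProcess.hasGaussianLaw_eval _).memLp_two.const_mul _
  rw [hlaw.map_eq_gaussianReal]
  congr 1
  · rw [integral_finsetSum _ fun k _ => (hint k).integrable one_le_two]
    refine Finset.sum_eq_zero fun k _ => ?_
    rw [integral_const_mul, hB.integral_eval, mul_zero]
  · rw [variance_fun_sum hint]
    have h1 : ‖∑ k, a k • χ (u k)‖ ^ 2 = ∑ k, ∑ l,
        cov[fun ω => a k * B (unitInterval.toNNReal (u k)) ω, fun ω => a l * B (unitInterval.toNNReal (u l)) ω; P] := by
      rw [← real_inner_self_eq_norm_sq, sum_inner]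
      refine Finset.sum_congr rfl fun k _ => ?_
      rw [inner_sum]
      refine Finset.sum_congr rfl fun l _ => ?_
      rw [covariance_const_mul_left, covariance_const_mul_right, hB.covariance_fun_eval,
        real_inner_smul_left, real_inner_smul_right, hχ]
      rfl
    rw [← h1, Real.toNNReal_pow (norm_nonneg _), norm_toNNReal]

/-- The path is the uniform limit of its Bernstein polynomials, each of which depends on finitely
many values of B. -/
lemma aemeasurable_path [MeasurableSpace C(unitInterval, ℝ)] [BorelSpace C(unitInterval, ℝ)]
    {W : Ω → C(unitInterval, ℝ)} (hB : ∀ t, AEMeasurable (B t) P)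
    (hW : ∀ᵐ ω ∂P, ∀ u, W ω u = B (unitInterval.toNNReal u) ω) : AEMeasurable W P := by
  refine aemeasurable_of_tendsto_metrizable_ae atTop
    (f := fun (n : ℕ) ω => ∑ k : Fin (n + 1),
      B (unitInterval.toNNReal (bernstein.z k)) ω • bernstein n k) (fun n => ?_) ?_
  · refine Finset.aemeasurable_fun_sum _ fun k _ => ?_
    exact (Continuous.measurable (by fun_prop : Continuous fun x : ℝ =>
      x • bernstein n k)).comp_aemeasurable (hB _)
  · filter_upwards [hW] with ω hω
    refine (bernsteinApproximation_uniform (W ω)).congr fun n => ?_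
    ext u
    simp [bernsteinApproximation.apply, hω, mul_comm]

variable [CompleteSpace H]

/-- ℓ(W) is the pointwise limit of Gaussian combinations of values of B, whose variances converge by
`tendsto_sum_bernstein_smul`; characteristic functions identify the limit law. -/
lemma map_dual_path_eq_gaussianReal [MeasurableSpace C(unitInterval, ℝ)]
    [BorelSpace C(unitInterval, ℝ)] (hχ : ∀ u v, ⟪χ u, χ v⟫ = min (u : ℝ) v)
    (hB : IsPreBrownianReal B P) {W : Ω → C(unitInterval, ℝ)}
    (hW : ∀ᵐ ω ∂P, ∀ u, W ω u = B (unitInterval.toNNReal u) ω) (ℓ : StrongDual ℝ C(unitInterval, ℝ)) :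
    (P.map W).map ℓ = gaussianReal 0 (‖dualEmbedding (innerCLM χ) ℓ‖₊ ^ 2) := by
  have := hB.isGaussianProcess.isProbabilityMeasure
  have hWm := aemeasurable_path hB.aemeasurable hW
  have := Measure.isProbabilityMeasure_map (μ := P) hWm
  have := Measure.isProbabilityMeasure_map (μ := P.map W) (f := ℓ) (by fun_prop)
  have hm : ∀ n : ℕ, AEMeasurable (fun ω => ∑ k : Fin (n + 1),
      ℓ (bernstein n k) * B (unitInterval.toNNReal (bernstein.z k)) ω) P := fun n =>
    Finset.aemeasurable_fun_sum _ fun k _ => (hB.aemeasurable _).const_mul _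
  refine Measure.ext_of_charFun (funext fun t => ?_)
  have h1 : Tendsto (fun n : ℕ => charFun (P.map fun ω => ∑ k : Fin (n + 1),
      ℓ (bernstein n k) * B (unitInterval.toNNReal (bernstein.z k)) ω) t) atTop
      (𝓝 (charFun ((P.map W).map ℓ) t)) := by
    simp only [charFun_apply_real]
    rw [integral_map (by fun_prop) (Continuous.aestronglyMeasurable (by fun_prop)),
      integral_map hWm (Continuous.aestronglyMeasurable (by fun_prop))]
    have h2 : ∀ n : ℕ, ∫ x, Complex.exp (t * x * Complex.I) ∂(P.map fun ω => ∑ k : Fin (n + 1),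
        ℓ (bernstein n k) * B (unitInterval.toNNReal (bernstein.z k)) ω)
        = ∫ ω, Complex.exp (t * ((∑ k : Fin (n + 1),
        ℓ (bernstein n k) * B (unitInterval.toNNReal (bernstein.z k)) ω : ℝ) : ℂ) * Complex.I) ∂P := fun n =>
      integral_map (hm n) (Continuous.aestronglyMeasurable (by fun_prop))
    simp only [h2]
    refine tendsto_integral_of_dominated_convergence (fun _ => 1) (fun n => ?_)
      (integrable_const _) (fun n => ae_of_all _ fun ω => ?_) ?_
    · exact (Continuous.measurable (by fun_prop : Continuous fun x : ℝ =>
        Complex.exp (t * (x : ℂ) * Complex.I))).comp_aemeasurable (hm n) |>.aestronglyMeasurable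
    · rw [← Complex.ofReal_mul, Complex.norm_exp_ofReal_mul_I]
    · filter_upwards [hW] with ω hω
      have h3 : Tendsto (fun n : ℕ => ∑ k : Fin (n + 1),
          ℓ (bernstein n k) * B (unitInterval.toNNReal (bernstein.z k)) ω) atTop (𝓝 (ℓ (W ω))) := by
        refine ((ℓ.continuous.tendsto _).comp (bernsteinApproximation_uniform (W ω))).congr
          fun n => ?_
        rw [Function.comp_apply, dual_bernsteinApproximation]
        simp only [hω]
      exact ((by fun_prop : Continuous fun x : ℝ =>
        Complex.exp (t * (x : ℂ) * Complex.I)).tendsto _).comp h3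
  refine tendsto_nhds_unique h1 ?_
  simp only [map_sum_mul_eq_gaussianReal hχ hB, charFun_gaussianReal]
  have h4 := (tendsto_sum_bernstein_smul χ ℓ).norm
  have h5 : Continuous fun x : ℝ => Complex.exp (t * (0 : ℝ) * Complex.I
    - ((x ^ 2 : ℝ) : ℂ) * t ^ 2 / 2) := by fun_prop
  refine ((h5.tendsto _).comp h4).congr' (Eventually.of_forall fun n => ?_) |>.trans_eq ?_
  · simp
  · simp

end

/-! ### Brownian rescaling -/

/-- The Brownian rescaling as a continuous linear map. -/
noncomputable def brownianRescalingCLM (ε : Set.Ioc (0 : ℝ) 1) :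
    C(unitInterval, ℝ) →L[ℝ] C(unitInterval, ℝ) :=
  LinearMap.mkContinuous
    { toFun := brownianRescaling ε
      map_add' := fun f g => by ext u; simp [brownianRescaling, mul_add]
      map_smul' := fun c f => by ext u; simp [brownianRescaling, mul_left_comm] }
    (√(ε : ℝ))⁻¹ fun f => by
      refine (ContinuousMap.norm_le _ (by positivity)).2 fun u => ?_
      change ‖(√(ε : ℝ))⁻¹ * f (⟨(ε : ℝ), ε.2.1.le, ε.2.2⟩ * u)‖ ≤ _
      rw [norm_mul, norm_inv, Real.norm_of_nonneg (Real.sqrt_nonneg _)]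
      gcongr
      exact f.norm_coe_le_norm _

@[simp] lemma brownianRescalingCLM_apply (ε : Set.Ioc (0 : ℝ) 1) (f : C(unitInterval, ℝ)) :
    brownianRescalingCLM ε f = brownianRescaling ε f := rfl

lemma brownianRescaling_apply (ε : Set.Ioc (0 : ℝ) 1) (f : C(unitInterval, ℝ))
    (u : unitInterval) : brownianRescaling ε f u
      = (√(ε : ℝ))⁻¹ * f (⟨(ε : ℝ), ε.2.1.le, ε.2.2⟩ * u) := rfl

lemma continuous_brownianRescaling (f : C(unitInterval, ℝ)) :
    Continuous fun ε => brownianRescaling ε f := by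
  let F : C(Set.Ioc (0 : ℝ) 1 × unitInterval, ℝ) :=
    ⟨fun p => (√(p.1 : ℝ))⁻¹ * f (⟨(p.1 : ℝ), p.1.2.1.le, p.1.2.2⟩ * p.2), by
      have h : ∀ p : Set.Ioc (0 : ℝ) 1 × unitInterval, √(p.1 : ℝ) ≠ 0 :=
        fun p => (Real.sqrt_pos.2 p.1.2.1).ne'
      fun_prop (disch := exact h)⟩
  exact F.curry.continuous

lemma isStronglyContinuousMulSemigroup_brownianRescalingCLM :
    IsStronglyContinuousMulSemigroup brownianRescalingCLM where
  map_mul ε δ := by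
    ext f u
    simp only [brownianRescalingCLM_apply, ContinuousLinearMap.comp_apply,
      brownianRescaling_apply]
    have h1 : √((ε * δ : Set.Ioc (0 : ℝ) 1) : ℝ) = √(ε : ℝ) * √(δ : ℝ) := by
      rw [Set.Ioc.coe_mul, Real.sqrt_mul ε.2.1.le]
    rw [h1, mul_inv, mul_assoc]
    congr 3
    refine Subtype.ext ?_
    change (ε : ℝ) * δ * u = δ * (ε * u)
    ring
  tendsto_one f := by
    have h := (continuous_brownianRescaling f).tendsto 1
    have h1 : brownianRescaling 1 f = f := by
      ext u
      simp only [brownianRescaling_apply, Set.Ioc.coe_one, Real.sqrt_one, inv_one, one_mul]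
      congr 1
      ext
      simp
    rw [h1] at h
    exact h.mono_left nhdsWithin_le_nhds

section

variable {H : Type*} [NormedAddCommGroup H] [InnerProductSpace ℝ H]

lemma tendsto_inner_zero_of_dense_span {ι : Type*} {l : Filter ι} {v : ι → H} {M : ℝ}
    (hM : ∀ a, ‖v a‖ ≤ M) {D : Set H} (hD : Dense (Submodule.span ℝ D : Set H))
    (h : ∀ d ∈ D, Tendsto (fun a => ⟪v a, d⟫) l (𝓝 0)) (y : H) :
    Tendsto (fun a => ⟪v a, y⟫) l (𝓝 0) := by
  rcases isEmpty_or_nonempty ι with hι | ⟨⟨a⟩⟩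
  · rw [l.filter_eq_bot_of_isEmpty]; exact tendsto_bot
  have hM0 : 0 ≤ M := (norm_nonneg _).trans (hM a)
  have hspan : ∀ z ∈ Submodule.span ℝ D, Tendsto (fun a => ⟪v a, z⟫) l (𝓝 0) := by
    intro z hz
    induction hz using Submodule.span_induction with
    | mem d hd => exact h d hd
    | zero => simpa using tendsto_const_nhds
    | add z w _ _ hz hw => simpa [inner_add_right] using hz.add hw
    | smul c z _ hz => simpa [inner_smul_right] using hz.const_mul c
  refine Metric.tendsto_nhds.2 fun r hr => ?_
  obtain ⟨z, hz, hyz⟩ := Metric.dense_iff.1 hD y (r / (2 * (M + 1))) (by positivity)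
  filter_upwards [Metric.tendsto_nhds.1 (hspan z hyz) (r / 2) (by positivity)] with a ha
  rw [dist_zero_right] at ha ⊢
  rw [Metric.mem_ball, dist_comm, dist_eq_norm] at hz
  have h1 : ⟪v a, y⟫ = ⟪v a, z⟫ + ⟪v a, y - z⟫ := by rw [inner_sub_right]; ring
  have h2 : ‖⟪v a, y - z⟫‖ ≤ M * (r / (2 * (M + 1))) :=
    (norm_inner_le_norm _ _).trans (by gcongr; exact hM a)
  have h3 : M * (r / (2 * (M + 1))) ≤ r / 2 := by
    rw [mul_div_assoc', div_le_div_iff₀ (by positivity) two_pos]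
    nlinarith
  rw [h1]
  refine (norm_add_le _ _).trans_lt ?_
  linarith

set_option linter.unusedSectionVars false

variable [CompleteSpace H] {χ : C(unitInterval, H)}

lemma dense_span_range_of_injective_innerCLM (hi : Function.Injective (innerCLM χ)) :
    Dense (Submodule.span ℝ (Set.range χ) : Set H) := by
  rw [Submodule.dense_iff_topologicalClosure_eq_top, Submodule.topologicalClosure_eq_top_iff,
    Submodule.eq_bot_iff]
  intro h hh
  refine hi ?_
  ext u
  rw [map_zero]
  exact hh _ (Submodule.subset_span ⟨u, rfl⟩)

lemma norm_le_of_comp_adjoint_eq_id {S : H →L[ℝ] H}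
    (hS : S ∘L ContinuousLinearMap.adjoint S = ContinuousLinearMap.id ℝ H) (x : H) :
    ‖S x‖ ≤ ‖x‖ := by
  have h1 := (ContinuousLinearMap.norm_map_iff_adjoint_comp_self (ContinuousLinearMap.adjoint S)).2
    (by rw [ContinuousLinearMap.adjoint_adjoint]; exact hS) (S x)
  have h2 : ‖S x‖ * ‖S x‖ ≤ ‖x‖ * ‖S x‖ := by
    rw [← real_inner_self_eq_norm_mul_norm, ← ContinuousLinearMap.adjoint_inner_right]
    refine (real_inner_le_norm _ _).trans ?_
    rw [h1]
  rcases (norm_nonneg (S x)).eq_or_lt with h0 | h0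
  · rw [← h0]; positivity
  · exact le_of_mul_le_mul_right h2 h0

lemma norm_sq_of_inner_eq_min (hχ : ∀ u v, ⟪χ u, χ v⟫ = min (u : ℝ) v) (u : unitInterval) :
    ‖χ u‖ ^ 2 = u := by
  rw [← real_inner_self_eq_norm_sq, hχ, min_self]

/-- Mixing of the Brownian rescaling. The vectors ε^(-1/2) χ(εu) have norm at most one, and their
inner product with χ(v) is at most ε^(-1/2) εu ≤ √ε; the χ(v) span a dense subspace. -/
lemma tendsto_inner_rescaling (hχ : ∀ u v, ⟪χ u, χ v⟫ = min (u : ℝ) v)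
    (hi : Function.Injective (innerCLM χ)) (u : unitInterval) (h : H) :
    Tendsto (fun ε : Set.Ioc (0 : ℝ) 1 =>
      ⟪(√(ε : ℝ))⁻¹ • χ (⟨(ε : ℝ), ε.2.1.le, ε.2.2⟩ * u), h⟫)
      (comap Subtype.val (𝓝 (0 : ℝ))) (𝓝 0) := by
  refine tendsto_inner_zero_of_dense_span (M := 1) (fun ε => ?_)
    (dense_span_range_of_injective_innerCLM hi) ?_ h
  · rw [norm_smul, norm_inv, Real.norm_of_nonneg (Real.sqrt_nonneg _),
      inv_mul_le_iff₀ (Real.sqrt_pos.2 ε.2.1), mul_one,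
      ← pow_le_pow_iff_left₀ (norm_nonneg _) (Real.sqrt_nonneg _) two_ne_zero,
      norm_sq_of_inner_eq_min hχ, Real.sq_sqrt ε.2.1.le, Set.Icc.coe_mul]
    exact mul_le_of_le_one_right ε.2.1.le u.2.2
  · rintro _ ⟨v, rfl⟩
    have h0 : Tendsto (fun ε : Set.Ioc (0 : ℝ) 1 => √(ε : ℝ)) (comap Subtype.val (𝓝 (0 : ℝ)))
        (𝓝 0) := by
      have := (Real.continuous_sqrt.tendsto 0).comp
        (tendsto_comap (f := (Subtype.val : Set.Ioc (0 : ℝ) 1 → ℝ)) (x := 𝓝 (0 : ℝ)))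
      rwa [Real.sqrt_zero] at this
    refine squeeze_zero (fun ε => ?_) (fun ε => ?_) h0
    · rw [real_inner_smul_left, hχ]
      have := (⟨(ε : ℝ), ε.2.1.le, ε.2.2⟩ * u : unitInterval).2.1
      have := v.2.1
      positivity
    · rw [real_inner_smul_left, hχ, inv_mul_le_iff₀ (Real.sqrt_pos.2 ε.2.1),
        Real.mul_self_sqrt ε.2.1.le]
      refine (min_le_left _ _).trans ?_
      rw [Set.Icc.coe_mul]
      exact mul_le_of_le_one_right ε.2.1.le u.2.2

/-- Strassen's law, with the Cameron-Martin space represented by a Hilbert space `H` which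
contains a curve with the covariance of Brownian motion. -/
theorem ae_clusterPointsAtZero_brownianRescaling_eq (hχ : ∀ u v, ⟪χ u, χ v⟫ = min (u : ℝ) v)
    (hi : Function.Injective (innerCLM χ)) {Ω : Type*} [MeasurableSpace Ω] {P : Measure Ω}
    {B : ℝ≥0 → Ω → ℝ} (hB : IsPreBrownianReal B P) {W : Ω → C(unitInterval, ℝ)}
    (hW : ∀ᵐ ω ∂P, ∀ u, W ω u = B (unitInterval.toNNReal u) ω) :
    ∀ᵐ ω ∂P, clusterPointsAtZero
        (fun ε : Set.Ioc (0 : ℝ) 1 =>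
          (√(2 * Real.log (Real.log (1 / (ε : ℝ)))))⁻¹ • brownianRescaling ε (W ω))
      = innerCLM χ '' Metric.closedBall (0 : H) 1 := by
  borelize C(unitInterval, ℝ)
  have hWm : AEMeasurable W P := aemeasurable_path hB.aemeasurable hW
  have hAWS : IsAbstractWienerSpace (innerCLM χ) (P.map W) :=
    isAbstractWienerSpace_of_map_eq_gaussianReal hi (map_dual_path_eq_gaussianReal hχ hB hW)
  have := hAWS.isGaussian
  -- The rescaled process is again a Brownian motion, and the law of a path in C[0,1] is determined
  -- by its covariance through all functionals.
  have hinv : ∀ ε, (P.map W).map (brownianRescalingCLM ε) = P.map W := by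
    intro ε
    have hsmul := hB.smul (c := ⟨ε, ε.2.1.le⟩) (by
      intro h0
      exact ε.2.1.ne' (congrArg NNReal.toReal h0))
    have hW' : ∀ᵐ ω ∂P, ∀ u, (brownianRescalingCLM ε (W ω)) u
        = (√((⟨ε, ε.2.1.le⟩ : ℝ≥0) : ℝ))⁻¹
          * B (⟨ε, ε.2.1.le⟩ * unitInterval.toNNReal u) ω := by
      filter_upwards [hW] with ω hω u
      rw [brownianRescalingCLM_apply, brownianRescaling_apply, hω]
      rfl
    refine Measure.ext_of_charFunDual (funext fun ℓ => ?_)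
    rw [charFunDual_eq_charFun_map_one, charFunDual_eq_charFun_map_one,
      map_dual_path_eq_gaussianReal hχ hB hW ℓ,
      ← map_dual_path_eq_gaussianReal hχ hsmul hW' ℓ,
      AEMeasurable.map_map_of_aemeasurable (by fun_prop) hWm]
    rfl
  choose R hR hRR using fun ε => hAWS.exists_coisometry (hinv ε)
  have hmix : ∀ x y : H, Tendsto (fun ε => ⟪R ε x, y⟫) (comap Subtype.val (𝓝 (0 : ℝ))) (𝓝 0) := by
    intro x y
    refine tendsto_inner_zero_of_dense_span (fun ε => norm_le_of_comp_adjoint_eq_id (hRR ε) x)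
      (dense_span_range_of_injective_innerCLM hi) ?_ y
    rintro _ ⟨u, rfl⟩
    -- Evaluating at u the rescaling of the path of x pairs x with ε^(-1/2) χ(εu), the image of χ(u)
    -- under the adjoint of R ε.
    refine (tendsto_inner_rescaling hχ hi u x).congr fun ε => ?_
    calc _ = brownianRescalingCLM ε (innerCLM χ x) u := real_inner_smul_left _ _ _
      _ = ⟪χ u, R ε x⟫ := by rw [hR]; rfl
      _ = _ := real_inner_comm _ _
  have hmain := hAWS.ae_clusterPointsAtZero_eq hRR hmix
    isStronglyContinuousMulSemigroup_brownianRescalingCLM hR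
  exact ae_of_ae_map hWm hmain

end

/-! ### The Cameron-Martin space of Brownian motion -/

/-- The indicator function of `(0,u]` in `L²[0,1]`. -/
noncomputable def indicatorIocLp (u : unitInterval) :
    Lp ℝ 2 (volume.restrict (Set.Icc (0 : ℝ) 1)) :=
  indicatorConstLp 2 (measurableSet_Ioc (a := (0 : ℝ)) (b := u)) (by finiteness) 1

lemma inner_indicatorIocLp (u : unitInterval) (g : Lp ℝ 2 (volume.restrict (Set.Icc (0 : ℝ) 1))) :
    ⟪indicatorIocLp u, g⟫ = ∫ s in (0 : ℝ)..u, g s := by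
  rw [indicatorIocLp, L2.inner_indicatorConstLp_one, intervalIntegral.integral_of_le u.2.1,
    Measure.restrict_restrict measurableSet_Ioc, Set.inter_eq_left.2]
  exact fun s hs => ⟨hs.1.le, hs.2.trans u.2.2⟩

lemma inner_indicatorIocLp_indicatorIocLp (u v : unitInterval) :
    ⟪indicatorIocLp u, indicatorIocLp v⟫ = min (u : ℝ) v := by
  have hm : 0 ≤ min (u : ℝ) v := le_min u.2.1 v.2.1
  rw [indicatorIocLp, indicatorIocLp, L2.real_inner_indicatorConstLp_one_indicatorConstLp_one,
    Set.Ioc_inter_Ioc, max_self, measureReal_restrict_apply measurableSet_Ioc,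
    Set.inter_eq_left.2, Real.volume_real_Ioc_of_le hm, sub_zero]
  exact fun s hs => ⟨hs.1.le, hs.2.trans ((min_le_left _ _).trans u.2.2)⟩

/-- The curve `u ↦ 1_{(0,u]}` in `L²[0,1]`. -/
noncomputable def indicatorCurve :
    C(unitInterval, Lp ℝ 2 (volume.restrict (Set.Icc (0 : ℝ) 1))) where
  toFun := indicatorIocLp
  continuous_toFun := by
    refine continuous_iff_continuousAt.2 fun v => tendsto_iff_norm_sub_tendsto_zero.2 ?_
    -- The radicand is the squared L² distance of the two indicators, expanded through their inner
    -- products.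
    have h : Tendsto (fun u : unitInterval => √((u : ℝ) + v - 2 * min (u : ℝ) v)) (𝓝 v)
        (𝓝 (√((v : ℝ) + v - 2 * min (v : ℝ) v))) :=
      (by fun_prop : Continuous fun u : unitInterval =>
        √((u : ℝ) + v - 2 * min (u : ℝ) v)).tendsto v
    rw [min_self, two_mul, sub_self, Real.sqrt_zero] at h
    refine h.congr fun u => ?_
    rw [← Real.sqrt_sq (norm_nonneg _), norm_sub_sq_real, ← real_inner_self_eq_norm_sq,
      ← real_inner_self_eq_norm_sq]
    simp only [inner_indicatorIocLp_indicatorIocLp, min_self]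
    congr 1
    ring

lemma innerCLM_indicatorCurve_apply (g : Lp ℝ 2 (volume.restrict (Set.Icc (0 : ℝ) 1)))
    (u : unitInterval) : innerCLM indicatorCurve g u = ∫ s in (0 : ℝ)..u, g s :=
  inner_indicatorIocLp u g

/-- By Lebesgue differentiation g is almost everywhere the derivative of its primitive, which
vanishes. -/
lemma injective_innerCLM_indicatorCurve : Function.Injective (innerCLM indicatorCurve) := by
  refine (injective_iff_map_eq_zero _).2 fun g hg => ?_
  have hzero : ∀ u ∈ Set.Icc (0 : ℝ) 1, ∫ s in (0 : ℝ)..u, g s = 0 := fun u hu => by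
    rw [← innerCLM_indicatorCurve_apply g ⟨u, hu⟩]
    exact DFunLike.congr_fun hg ⟨u, hu⟩
  have hint : IntervalIntegrable g volume 0 1 := by
    rw [intervalIntegrable_iff_integrableOn_Icc_of_le zero_le_one]
    exact (Lp.memLp g).integrable one_le_two
  rw [Lp.eq_zero_iff_ae_eq_zero]
  have h : ∀ᵐ s ∂(volume.restrict (Set.Icc (0 : ℝ) 1)), g s = 0 := by
    rw [ae_restrict_iff' measurableSet_Icc]
    have hend : ∀ᵐ s : ℝ, s ≠ 0 ∧ s ≠ 1 := (Measure.ae_ne _ 0).and (Measure.ae_ne _ 1)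
    filter_upwards [hint.ae_hasDerivAt_integral, hend] with s hs hse hsI
    have hs01 : s ∈ Set.Ioo (0 : ℝ) 1 :=
      ⟨hsI.1.lt_of_ne' hse.1, hsI.2.lt_of_ne hse.2⟩
    rw [Set.uIcc_of_le zero_le_one] at hs
    have h1 := hs (Set.Ioo_subset_Icc_self hs01) 0 (by simp)
    refine h1.unique ((hasDerivAt_const s (0 : ℝ)).congr_of_eventuallyEq ?_)
    filter_upwards [isOpen_Ioo.mem_nhds hs01] with u hu
    exact hzero u (Set.Ioo_subset_Icc_self hu)
  exact h

lemma integral_sq_eq_norm_toLp_sq {g : ℝ → ℝ}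
    (hg : MemLp g 2 (volume.restrict (Set.Icc (0 : ℝ) 1))) :
    ∫ s in (0 : ℝ)..1, g s ^ 2 = ‖hg.toLp g‖ ^ 2 := by
  rw [← real_inner_self_eq_norm_sq, L2.inner_def, intervalIntegral.integral_of_le zero_le_one,
    ← integral_Icc_eq_integral_Ioc]
  refine integral_congr_ae ?_
  filter_upwards [hg.coeFn_toLp] with s hs
  rw [hs, real_inner_self_eq_norm_sq, Real.norm_eq_abs, sq_abs]

lemma innerCLM_indicatorCurve_toLp_apply {g : ℝ → ℝ}
    (hg : MemLp g 2 (volume.restrict (Set.Icc (0 : ℝ) 1))) (u : unitInterval) :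
    innerCLM indicatorCurve (hg.toLp g) u = ∫ s in (0 : ℝ)..u, g s := by
  rw [innerCLM_indicatorCurve_apply]
  refine intervalIntegral.integral_congr_ae ?_
  have h := (ae_restrict_iff' measurableSet_Icc).1 hg.coeFn_toLp
  filter_upwards [h] with s hs hsu
  rw [Set.uIoc_of_le u.2.1] at hsu
  exact hs ⟨hsu.1.le, hsu.2.trans u.2.2⟩

lemma innerCLM_indicatorCurve_image_closedBall :
    innerCLM indicatorCurve '' Metric.closedBall 0 1 = strassenBall := by
  ext f
  constructor
  · rintro ⟨g, hg, rfl⟩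
    have hg1 : ‖g‖ ≤ 1 := by simpa using hg
    have hm := Lp.memLp g
    have hgl : hm.toLp g = g := Lp.toLp_coeFn g hm
    refine ⟨g, hm, ?_, fun u => ?_⟩
    · rw [integral_sq_eq_norm_toLp_sq hm, hgl]
      exact pow_le_one₀ (norm_nonneg _) hg1
    · rw [← innerCLM_indicatorCurve_toLp_apply hm, hgl]
  · rintro ⟨g, hm, hg, hf⟩
    rw [integral_sq_eq_norm_toLp_sq hm] at hg
    refine ⟨hm.toLp g, ?_, ?_⟩
    · rw [mem_closedBall_zero_iff]
      exact (pow_le_one_iff_of_nonneg (norm_nonneg _) two_ne_zero).1 hg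
    · ext u
      rw [innerCLM_indicatorCurve_toLp_apply, hf]

/-- Strassen's law of the iterated logarithm at zero. -/
theorem ae_exists_clusterPointsAtZero_eq_strassenBall {Ω : Type*} [MeasurableSpace Ω]
    {P : Measure Ω} {B : ℝ≥0 → Ω → ℝ} (hB : IsBrownianReal B P) :
    ∀ᵐ ω ∂P, ∃ f : C(unitInterval, ℝ), (∀ u : unitInterval, f u = B ⟨(u : ℝ), u.2.1⟩ ω) ∧
      clusterPointsAtZero
        (fun ε : Set.Ioc (0 : ℝ) 1 =>
          (√(2 * Real.log (Real.log (1 / (ε : ℝ)))))⁻¹ • brownianRescaling ε f)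
        = strassenBall := by
  classical
  have hc : Continuous unitInterval.toNNReal := by fun_prop
  -- The value zero on discontinuous paths is immaterial, as these form a null set.
  let W : Ω → C(unitInterval, ℝ) := fun ω =>
    if h : Continuous (B · ω) then ⟨fun u => B (unitInterval.toNNReal u) ω, h.comp hc⟩ else 0
  have hW : ∀ᵐ ω ∂P, ∀ u, W ω u = B (unitInterval.toNNReal u) ω := by
    filter_upwards [hB.cont] with ω hω u
    simp only [W, dif_pos hω]
    rfl
  filter_upwards [hW, ae_clusterPointsAtZero_brownianRescaling_eq inner_indicatorIocLp_indicatorIocLp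
    injective_innerCLM_indicatorCurve hB.toIsPreBrownianReal hW] with ω h1 h2
  exact ⟨W ω, h1, by rw [h2, innerCLM_indicatorCurve_image_closedBall]⟩

theorem proposition1p2 :
    (∀ (X : Type*) [NormedAddCommGroup X] [NormedSpace ℝ X] [CompleteSpace X]
      [TopologicalSpace.SeparableSpace X] [MeasurableSpace X] [BorelSpace X]
      (H : Type*) [NormedAddCommGroup H] [InnerProductSpace ℝ H] [CompleteSpace H]
      (i : H →L[ℝ] X) (μ : Measure X), IsAbstractWienerSpace i μ →
      -- the additive form
      (∀ (S : ℝ≥0 → H →L[ℝ] H) (T : ℝ≥0 → X →L[ℝ] X),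
        (∀ t u, S (t + u) = S t ∘L S u) →
        (∀ t, S t ∘L ContinuousLinearMap.adjoint (S t) = ContinuousLinearMap.id ℝ H) →
        (∀ x y : H, Tendsto (fun t => ⟪S t x, y⟫) atTop (𝓝 0)) →
        IsStronglyContinuousSemigroup T →
        (∀ t h, T t (i h) = i (S t h)) →
        ∀ᵐ x ∂μ,
          clusterPointsAtInfinity (fun t : ℝ≥0 => (√(2 * Real.log t))⁻¹ • T t x)
            = i '' Metric.closedBall (0 : H) 1) ∧
      -- the multiplicative form
      (∀ (R : Set.Ioc (0 : ℝ) 1 → H →L[ℝ] H) (Q : Set.Ioc (0 : ℝ) 1 → X →L[ℝ] X),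
        (∀ ε δ, R (ε * δ) = R ε ∘L R δ) →
        (∀ ε, R ε ∘L ContinuousLinearMap.adjoint (R ε) = ContinuousLinearMap.id ℝ H) →
        (∀ x y : H, Tendsto (fun ε => ⟪R ε x, y⟫) (comap Subtype.val (𝓝 (0 : ℝ))) (𝓝 0)) →
        IsStronglyContinuousMulSemigroup Q →
        (∀ ε h, Q ε (i h) = i (R ε h)) →
        ∀ᵐ x ∂μ,
          clusterPointsAtZero
              (fun ε : Set.Ioc (0 : ℝ) 1 => (√(2 * Real.log (Real.log (1 / (ε : ℝ)))))⁻¹ • Q ε x)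
            = i '' Metric.closedBall (0 : H) 1)) ∧
    -- the classical law for Brownian motion
    (∀ (Ω : Type*) [MeasurableSpace Ω] (P : Measure Ω) (B : ℝ≥0 → Ω → ℝ), IsBrownianReal B P →
      ∀ᵐ ω ∂P, ∃ f : C(unitInterval, ℝ),
        (∀ u : unitInterval, f u = B ⟨(u : ℝ), u.2.1⟩ ω) ∧
        clusterPointsAtZero
            (fun ε : Set.Ioc (0 : ℝ) 1 =>
              (√(2 * Real.log (Real.log (1 / (ε : ℝ)))))⁻¹ • brownianRescaling ε f)
          = strassenBall) := by
  refine ⟨?_, ?_⟩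
  · intro X _ _ _ _ _ _ H _ _ _ i μ hW
    have := UniformSpace.secondCountable_of_separable X
    exact ⟨fun S T _ hS hS0 hT hTi => hW.ae_clusterPointsAtInfinity_eq hS hS0 hT hTi,
      fun R Q _ hR hR0 hQ hQi => hW.ae_clusterPointsAtZero_eq hR hR0 hQ hQi⟩
  · exact fun Ω _ P B hB => ae_exists_clusterPointsAtZero_eq_strassenBall hB
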